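/- Let $\mu(f)=|a|\prod_{n}\max\{1,|\gamma_n|\}$ be the Mahler measure of a polynomial $f(x)=a\prod_n(x-\gamma_n)\in\mathbb{C}[x]$, extended to Laurent polynomials by $\mu(x^{-n}f)=\mu(f)$, and let $\rho(f)=\mu\bigl(f(x+1/x)\bigr)$ be the reciprocal Mahler measure of $f\in\mathbb{C}[x]$. For $N\ge 1$ and $\mathbf b=(b_1,\dots,b_N)\in\mathbb{C}^N$ put \[ \widetilde\rho(\mathbf b)=\rho\Bigl(x^N+\sum_{n=1}^N b_n x^{N-n}\Bigr), \] and define the real and complex degree $N$ moment functions of $\rho$ by \[ F_N(\rho;s)=\int_{\mathbb{R}^N}\widetilde\rho(\mathbf b)^{-s}\,d\lambda_N(\mathbf b),\qquad H_N(\rho;s)=\int_{\mathbb{C}^N}\widetilde\rho(\mathbf b)^{-2s}\,d\lambda_{2N}(\mathbf b), \] where $\lambda_N$ and $\lambda_{2N}$ denote Lebesgue measure on $\mathbb{R}^N$ and on $\mathbb{C}^N$. Then both integrals converge absolutely and define analytic functions of $s$ in the half-plane $\Re(s)>N$, and both functions continue analytically to rational functions of $s$. Explicitly, \[ H_N(\rho;s)=2^N\pi^N\prod_{n=1}^N\frac{s}{s^2-n^2},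 \] and, with $J$ the integer part of $(N-1)/2$, \[ F_N(\rho;s)=v_N\prod_{j=0}^{J}\frac{s^2}{s^2-(N-2j)^2},\qquad v_N=\frac{2^N}{N!}\prod_{n=1}^N\left(\frac{2n}{2n-1}\right)^{N+1-n}. \] -/

import Mathlib

open Polynomial MeasureTheory
open scoped LaurentPolynomial

noncomputable section

namespace MomentFunctions

/-- Mahler's measure of a Laurent polynomial `g`: the Mahler measure of any polynomial of the form
`x ^ n * g`. The choice is immaterial, see `laurentMahlerMeasure_eq`. -/
def laurentMahlerMeasure (g : ℂ[T;T⁻¹]) : ℝ :=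
  (LaurentPolynomial.exists_T_pow g).choose_spec.choose.mahlerMeasure

theorem laurentMahlerMeasure_eq (g : ℂ[T;T⁻¹]) (n : ℕ) (p : ℂ[X])
    (h : toLaurent p = g * LaurentPolynomial.T n) :
    laurentMahlerMeasure g = p.mahlerMeasure := by
  have h' := (LaurentPolynomial.exists_T_pow g).choose_spec.choose_spec
  unfold laurentMahlerMeasure
  set m := (LaurentPolynomial.exists_T_pow g).choose
  set q := (LaurentPolynomial.exists_T_pow g).choose_spec.choose
  have key : q * X ^ n = p * X ^ m := by
    apply Polynomial.toLaurent_injective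
    rw [map_mul, map_mul, h, h', Polynomial.toLaurent_X_pow, Polynomial.toLaurent_X_pow,
      mul_assoc, mul_assoc, mul_comm (LaurentPolynomial.T (m : ℤ))]
  have hX : ∀ k : ℕ, (X ^ k : ℂ[X]).mahlerMeasure = 1 := by
    intro k
    rw [Polynomial.mahlerMeasure_eq_leadingCoeff_mul_prod_roots]
    simp [Multiset.map_nsmul, Multiset.prod_nsmul]
  simpa [Polynomial.mahlerMeasure_mul, hX] using congrArg Polynomial.mahlerMeasure key

/-- The reciprocal Mahler measure `ρ(f) = μ(f(x + 1/x))`. -/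
def reciprocalMahlerMeasure (f : ℂ[X]) : ℝ :=
  laurentMahlerMeasure (aeval (LaurentPolynomial.T 1 + LaurentPolynomial.T (-1) : ℂ[T;T⁻¹]) f)

/-- The degree `N` monic restriction of `Φ`: its value at
`x ^ N + b₁ x ^ (N - 1) + ⋯ + b_N`, where `b i` with `i : Fin N` is the coefficient `b_{i + 1}`. -/
def monicRestriction (Φ : ℂ[X] → ℝ) (N : ℕ) (b : Fin N → ℂ) : ℝ :=
  Φ (X ^ N + ∑ i : Fin N, C (b i) * X ^ (N - (i + 1 : ℕ)))

/-- The integrand of the real degree `N` moment function of `Φ`. -/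
def realMomentIntegrand (Φ : ℂ[X] → ℝ) (N : ℕ) (s : ℂ) (b : Fin N → ℝ) : ℂ :=
  (monicRestriction Φ N (fun i => (b i : ℂ)) : ℂ) ^ (-s)

/-- The integrand of the complex degree `N` moment function of `Φ`. -/
def complexMomentIntegrand (Φ : ℂ[X] → ℝ) (N : ℕ) (s : ℂ) (b : Fin N → ℂ) : ℂ :=
  (monicRestriction Φ N b : ℂ) ^ (-(2 * s))

/-- The real degree `N` moment function `F_N(Φ; s)`, an integral over `ℝ ^ N`. -/
def realMoment (Φ : ℂ[X] → ℝ) (N : ℕ) (s : ℂ) : ℂ :=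
  ∫ b : Fin N → ℝ, realMomentIntegrand Φ N s b

/-- The complex degree `N` moment function `H_N(Φ; s)`, an integral over `ℂ ^ N`. -/
def complexMoment (Φ : ℂ[X] → ℝ) (N : ℕ) (s : ℂ) : ℂ :=
  ∫ b : Fin N → ℂ, complexMomentIntegrand Φ N s b

/-- `F`, given as an analytic function on the open set `U`, continues analytically to the rational
function `R`: it is analytic on `U`, and at each point of `U` the rational function `R` has no pole
and takes the value of `F`. -/
def ContinuesToRational (F : ℂ → ℂ) (U : Set ℂ) (R : RatFunc ℂ) : Prop :=
  AnalyticOnNhd ℂ F U ∧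
    ∀ s ∈ U, R.denom.eval s ≠ 0 ∧ F s = R.eval (RingHom.id ℂ) s

/-- The rational constant `v_N`. -/
def vConst (N : ℕ) : ℚ :=
  2 ^ N / (N.factorial : ℚ) *
    ∏ n ∈ Finset.Icc 1 N, ((2 * n : ℚ) / (2 * n - 1)) ^ (N + 1 - n)

/-- The rational function `2 ^ N π ^ N ∏_{n = 1}^N s / (s² - n²)`. -/
def complexMomentRat (N : ℕ) : RatFunc ℂ :=
  RatFunc.C ((2 : ℂ) ^ N * (Real.pi : ℂ) ^ N) *
    ∏ n ∈ Finset.Icc 1 N, RatFunc.X / (RatFunc.X ^ 2 - RatFunc.C (n : ℂ) ^ 2)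

/-- The rational function `v_N ∏_{j = 0}^J s² / (s² - (N - 2 j)²)` with `J = ⌊(N - 1) / 2⌋`. -/
def realMomentRat (N : ℕ) : RatFunc ℂ :=
  RatFunc.C (vConst N : ℂ) *
    ∏ j ∈ Finset.range ((N - 1) / 2 + 1),
      RatFunc.X ^ 2 / (RatFunc.X ^ 2 - RatFunc.C ((N : ℂ) - 2 * (j : ℂ)) ^ 2)

end MomentFunctions

end

open Polynomial MeasureTheory
open scoped LaurentPolynomial

noncomputable section

namespace MomentFunctions

/-! ### Area formula for finite families of maps -/

section AreaFormula

open Set Function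

variable {V : Type*} [NormedAddCommGroup V] [NormedSpace ℝ V] [FiniteDimensional ℝ V]

/-! The coefficients of a monic polynomial are functions of its roots, and up to sign the complex
Jacobian determinant of this map is the Vandermonde determinant V. Since ρ is multiplicative and ρ(x
- β) = |α| whenever β = α + α⁻¹ with |α| ≥ 1, passing from coefficients to roots turns each moment
into an integral of a product of one-variable weights against |V|² (complex case) or |V| (real
case). Column operations replace the powers in V by the monic Chebyshev polynomials S_n(x) =
U_n(x/2), and S_n(α + α⁻¹) = (α^(n+1) - α^(-n-1)) / (α - α⁻¹). The Jacobian of α ↦ α + α⁻¹ absorbs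
these denominators, so all integrals that occur are elementary.

Complex case: |V|² = V(r) V(r̄) is expanded twice over permutations. The S_n are orthogonal in the
plane for the weight ρ^(-2s), with norms 2π s / (s² - (n+1)²) (`integral_wcheb_mul_wcheb_conj`).
Only the N! diagonal terms survive, and N! is also the size of a generic fibre of the root map.

Real case: |V| is not a polynomial and the number of real roots varies. Write N = 2M + e with e ≤ 1
and group the roots into M pairs and e single roots. A pair is either two arbitrary reals or two
complex conjugates x, y, and it carries the phase of the conjugate of y - x. The key combinatorial
fact is `sum_slotProd_mul_vandPhase`: summed over all fillings of the slots by a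
conjugation-invariant set of N points, these weights times the phase of V give 2^M M!, whatever the
number of real points. The area formula with these weights replaces |V| by V and expresses 2^M M!
F_N as a signed sum over permutations of products of M pair integrals and e single integrals.

Pair integrals vanish for two indices of equal parity and single integrals vanish for odd index, so
this Pfaffian-type sum collapses to 2^M M! times one determinant (`sum_sign_skew`). With j odd and k
even denoting the indices plus one, the pair integral is 16 k s² / (j (k² - j²) (s² - k²)) and the
single integral is 4 s² / (j (s² - j²)). Up to row and column factors the matrix is therefore a
Cauchy matrix with nodes j² against the nodes k² and, for odd N, s²; `det_cauchy` gives the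
dependence on s. The modulus of the constant is matched with v_N by adding nodes alternately
(`norm_cauchyConst`), and its sign is forced by positivity of the integral at real s. -/

theorem exists_radius_injOn (f : V → V) (A : V →L[ℝ] V) :
    ∃ δ : NNReal, δ ≠ 0 ∧
      (A.det ≠ 0 → ∀ t, ApproximatesLinearOn f A t δ → InjOn f t) := by
  -- The partition theorem used below wants a radius for every linear map, so the singular ones
  -- receive an arbitrary value. For invertible `A`, any radius below `‖A⁻¹‖⁻¹` forces injectivity.
  by_cases hA : A.det = 0
  · exact ⟨1, one_ne_zero, fun h => absurd hA h⟩
  set e := A.toContinuousLinearEquivOfDetNeZero hA with he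
  have heA : (e : V →L[ℝ] V) = A := A.coe_toContinuousLinearEquivOfDetNeZero hA
  rcases subsingleton_or_nontrivial V with hV | hV
  · exact ⟨1, one_ne_zero, fun _ t _ => fun x _ y _ _ => Subsingleton.elim x y⟩
  · have hpos : 0 < ‖(e.symm : V →L[ℝ] V)‖₊ := e.norm_symm_pos
    refine ⟨‖(e.symm : V →L[ℝ] V)‖₊⁻¹ / 2, by positivity, fun _ t ht => ?_⟩
    rw [← heA] at ht
    exact ht.injOn (Or.inr (NNReal.half_lt_self (by positivity)))

variable [MeasurableSpace V] [BorelSpace V]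

/-- The set where a differentiable map has invertible derivative splits into countably many
measurable pieces on which the map is injective. -/
theorem exists_injOn_partition {f : V → V} {f' : V → V →L[ℝ] V}
    (hf' : ∀ x, HasFDerivAt f (f' x) x) (hdet : Measurable fun x => (f' x).det) :
    ∃ A : ℕ → Set V, Pairwise (Disjoint on A) ∧ (∀ n, MeasurableSet (A n)) ∧
      (⋃ n, A n) = {x | (f' x).det ≠ 0} ∧ ∀ n, InjOn f (A n) := by
  choose r hr hinj using exists_radius_injOn f
  set s : Set V := {x | (f' x).det ≠ 0}
  have hs : MeasurableSet s := hdet (measurableSet_singleton 0).compl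
  obtain ⟨t, B, hdisj, hmeas, hcov, happ, hB⟩ :=
    exists_partition_approximatesLinearOn_of_hasFDerivWithinAt f s f'
      (fun x _ => (hf' x).hasFDerivWithinAt) r hr
  refine ⟨fun n => s ∩ t n, fun i j hij => (hdisj hij).mono inter_subset_right inter_subset_right,
    fun n => hs.inter (hmeas n), ?_, fun n => ?_⟩
  · rw [← inter_iUnion]
    exact inter_eq_left.2 hcov
  · rcases s.eq_empty_or_nonempty with h | h
    · simp [h]
    · obtain ⟨y, hy, hBy⟩ := hB h n
      exact hinj (B n) (by rw [hBy]; exact hy) _ (happ n)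

variable (μ : Measure V) [μ.IsAddHaarMeasure]

/-- An upper bound only needs almost every `y` to be hit at least once at a regular point, with no
control of multiplicities. It gives integrability on the target before any fibre is counted. -/
theorem lintegral_le_sum_lintegral_abs_det {T : Type*} [Fintype T] {f : T → V → V}
    {f' : T → V → V →L[ℝ] V} (hf' : ∀ t x, HasFDerivAt (f t) (f' t x) x)
    (hdet : ∀ t, Measurable fun x => (f' t x).det) (g : V → ENNReal) (hg : Measurable g)
    (hcov : ∀ᵐ y ∂μ, ∃ t x, f t x = y ∧ (f' t x).det ≠ 0) :
    ∫⁻ y, g y ∂μ ≤ ∑ t, ∫⁻ x, ENNReal.ofReal |(f' t x).det| * g (f t x) ∂μ := by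
  choose A hdisj hmeas hun hinj using fun t => exists_injOn_partition (hf' t) (hdet t)
  have him : ∀ t n, MeasurableSet (f t '' A t n) := fun t n =>
    measurable_image_of_fderivWithin (hmeas t n) (fun x _ => (hf' t x).hasFDerivWithinAt)
      (hinj t n)
  calc ∫⁻ y, g y ∂μ ≤ ∫⁻ y, ∑ t, ∑' n, (f t '' A t n).indicator g y ∂μ := by
        refine lintegral_mono_ae (hcov.mono fun y hy => ?_)
        obtain ⟨t, x, hx, hd⟩ := hy
        have hx' : x ∈ ⋃ n, A t n := by rw [hun]; exact hd
        obtain ⟨n, hn⟩ := mem_iUnion.1 hx'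
        calc g y = (f t '' A t n).indicator g y :=
              (indicator_of_mem (show y ∈ f t '' A t n from ⟨x, hn, hx⟩) g).symm
          _ ≤ ∑' n, (f t '' A t n).indicator g y := ENNReal.le_tsum n
          _ ≤ _ := Finset.single_le_sum
            (f := fun t => ∑' n, (f t '' A t n).indicator g y) (fun _ _ => zero_le)
            (Finset.mem_univ t)
    _ = ∑ t, ∑' n, ∫⁻ x in A t n, ENNReal.ofReal |(f' t x).det| * g (f t x) ∂μ := by
        rw [lintegral_finsetSum]
        · refine Finset.sum_congr rfl fun t _ => ?_
          rw [lintegral_tsum fun n => (hg.indicator (him t n)).aemeasurable]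
          refine tsum_congr fun n => ?_
          rw [lintegral_indicator (him t n), lintegral_image_eq_lintegral_abs_det_fderiv_mul μ
            (hmeas t n) (fun x _ => (hf' t x).hasFDerivWithinAt) (hinj t n)]
        · exact fun t _ => Measurable.tsum fun n => hg.indicator (him t n)
    _ ≤ _ := by
        refine Finset.sum_le_sum fun t _ => ?_
        rw [← lintegral_iUnion (hmeas t) (hdisj t)]
        exact setLIntegral_le_lintegral _ _

/-- The area formula in equal dimensions, for a finite family of differentiable maps. -/
theorem sum_integral_abs_det_smul_eq_integral_tsum_fiber {T : Type*} [Fintype T] {f : T → V → V}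
    {f' : T → V → V →L[ℝ] V} (hf' : ∀ t x, HasFDerivAt (f t) (f' t x) x)
    (hdet : ∀ t, Measurable fun x => (f' t x).det) (F : T → V → ℂ)
    (hF : ∀ t, Integrable (fun x => |(f' t x).det| • F t x) μ) :
    ∑ t, ∫ x, |(f' t x).det| • F t x ∂μ =
      ∫ y, ∑' q : {q : T × V // f q.1 q.2 = y ∧ (f' q.1 q.2).det ≠ 0}, F q.1.1 q.1.2 ∂μ := by
  choose A hdisj hmeas hun hinj using fun t => exists_injOn_partition (hf' t) (hdet t)
  have hfw : ∀ t n, ∀ x ∈ A t n, HasFDerivWithinAt (f t) (f' t x) (A t n) x :=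
    fun t n x _ => (hf' t x).hasFDerivWithinAt
  have him : ∀ t n, MeasurableSet (f t '' A t n) := fun t n =>
    measurable_image_of_fderivWithin (hmeas t n) (hfw t n) (hinj t n)
  -- `H (t, n)` transports `F t` from the piece `A t n` to its image, where the map has an inverse;
  -- the injective change of variables then applies piece by piece.
  set H : T × ℕ → V → ℂ := fun p =>
    (f p.1 '' A p.1 p.2).indicator fun y => F p.1 (invFunOn (f p.1) (A p.1 p.2) y) with hH
  have hinv : ∀ t n, ∀ x ∈ A t n, invFunOn (f t) (A t n) (f t x) = x := fun t n x hx =>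
    (hinj t n).leftInvOn_invFunOn hx
  have hHint : ∀ p, Integrable (H p) μ := by
    rintro ⟨t, n⟩
    simp only [hH]
    rw [integrable_indicator_iff (him t n),
      integrableOn_image_iff_integrableOn_abs_det_fderiv_smul μ (hmeas t n) (hfw t n) (hinj t n)]
    refine (hF t).integrableOn.congr_fun (fun x hx => ?_) (hmeas t n)
    simp only [hinv t n x hx]
  have hval : ∀ t n, ∫ y, H (t, n) y ∂μ = ∫ x in A t n, |(f' t x).det| • F t x ∂μ := by
    intro t n
    simp only [hH]
    rw [integral_indicator (him t n),
      integral_image_eq_integral_abs_det_fderiv_smul μ (hmeas t n) (hfw t n) (hinj t n)]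
    exact setIntegral_congr_fun (hmeas t n) fun x hx => by simp only [hinv t n x hx]
  have hnorm : ∀ t n, ∫ y, ‖H (t, n) y‖ ∂μ = ∫ x in A t n, ‖|(f' t x).det| • F t x‖ ∂μ := by
    intro t n
    simp only [hH, norm_indicator_eq_indicator_norm]
    rw [integral_indicator (him t n),
      integral_image_eq_integral_abs_det_fderiv_smul μ (hmeas t n) (hfw t n) (hinj t n)]
    exact setIntegral_congr_fun (hmeas t n) fun x hx => by
      simp only [hinv t n x hx, norm_smul, Real.norm_eq_abs, abs_abs, smul_eq_mul]
  have hsum : Summable fun p => ∫ y, ‖H p y‖ ∂μ := by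
    rw [summable_prod_of_nonneg fun p => integral_nonneg fun y => norm_nonneg _]
    refine ⟨fun t => ?_, (hasSum_fintype _).summable⟩
    simp_rw [hnorm]
    exact (hasSum_integral_iUnion (hmeas t) (hdisj t) (hF t).norm.integrableOn).summable
  -- For each `t`, a regular point of the fibre lies in exactly one piece, so the sum over pieces is
  -- the sum over the fibre.
  have hfib : ∀ y, ∑' p, H p y =
      ∑' q : {q : T × V // f q.1 q.2 = y ∧ (f' q.1 q.2).det ≠ 0}, F q.1.1 q.1.2 := by
    intro y
    have hidx : ∀ q : {q : T × V // f q.1 q.2 = y ∧ (f' q.1 q.2).det ≠ 0},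
        ∃ n, q.1.2 ∈ A q.1.1 n := by
      intro q
      have : q.1.2 ∈ ⋃ n, A q.1.1 n := by rw [hun]; exact q.2.2
      exact mem_iUnion.1 this
    choose ν hν using hidx
    set ν' : {q : T × V // f q.1 q.2 = y ∧ (f' q.1 q.2).det ≠ 0} → T × ℕ :=
      fun q => (q.1.1, ν q) with hν'
    have hνinj : Injective ν' := by
      rintro ⟨⟨t, x⟩, hx⟩ ⟨⟨t', x'⟩, hx'⟩ h
      simp only [hν', Prod.mk.injEq] at h
      obtain ⟨rfl, h⟩ := h
      have h1 := hν ⟨(t, x), hx⟩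
      have h2 := hν ⟨(t, x'), hx'⟩
      rw [← h] at h2
      simp only [Subtype.mk.injEq, Prod.mk.injEq, true_and]
      exact hinj t _ h1 h2 (hx.1.trans hx'.1.symm)
    have hsupp : support (fun p => H p y) ⊆ range ν' := by
      rintro ⟨t, n⟩ hn
      have hy : y ∈ f t '' A t n := by
        by_contra h
        exact hn (indicator_of_notMem h _)
      obtain ⟨x, hx, hxy⟩ := hy
      have hx' : (f' t x).det ≠ 0 := by
        have : x ∈ ⋃ n, A t n := mem_iUnion.2 ⟨n, hx⟩
        rw [hun] at this
        exact this
      refine ⟨⟨(t, x), hxy, hx'⟩, ?_⟩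
      by_contra hne
      have hne' : ν ⟨(t, x), hxy, hx'⟩ ≠ n := fun h => hne (by simp [hν', h])
      exact disjoint_left.1 (hdisj t hne') (hν ⟨(t, x), hxy, hx'⟩) hx
    rw [← hνinj.tsum_eq hsupp]
    refine tsum_congr fun q => ?_
    have hmem : y ∈ f q.1.1 '' A q.1.1 (ν q) := ⟨q.1.2, hν q, q.2.1⟩
    simp only [hH, hν', indicator_of_mem hmem]
    have := hinv _ _ _ (hν q)
    rw [q.2.1] at this
    rw [this]
  -- Critical points carry Jacobian zero on the left and are excluded from the fibres on the right,
  -- so nothing has to be known about the size of the critical values.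
  have hzero : ∀ t x, x ∉ ⋃ n, A t n → |(f' t x).det| • F t x = 0 := by
    intro t x hx
    rw [hun] at hx
    have : (f' t x).det = 0 := by simpa using hx
    simp [this]
  have hS : Summable fun p => ∫ y, H p y ∂μ :=
    hsum.of_norm_bounded fun p => norm_integral_le_integral_norm _
  simp_rw [← hfib]
  rw [← integral_tsum_of_summable_integral_norm hHint hsum, hS.tsum_prod, tsum_fintype]
  refine Finset.sum_congr rfl fun t _ => ?_
  rw [← setIntegral_eq_integral_of_forall_compl_eq_zero (hzero t),
    integral_iUnion (hmeas t) (hdisj t) (hF t).integrableOn]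
  simp_rw [← hval]

end AreaFormula

set_option linter.unusedSectionVars false

/-! ### Roots, coefficients and the Vandermonde Jacobian -/

section RootMap

variable {ι : Type*} [Fintype ι] [DecidableEq ι] {N : ℕ}

/-- The monic polynomial with the given roots. -/
def rootPoly (r : ι → ℂ) : ℂ[X] := ∏ j, (X - C (r j))

/-- The monic polynomial of degree `N` with coefficient `c i` at `X ^ κ i`. -/
def coeffPoly (κ : ι ≃ Fin N) (c : ι → ℂ) : ℂ[X] := X ^ N + ∑ i, C (c i) * X ^ (κ i : ℕ)

/-- The map from roots to coefficients. -/
def rootMap (κ : ι ≃ Fin N) (r : ι → ℂ) (i : ι) : ℂ := (rootPoly r).coeff (κ i)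

/-- The Jacobian matrix of `rootMap`. -/
def rootMapDeriv (κ : ι ≃ Fin N) (r : ι → ℂ) : Matrix ι ι ℂ :=
  Matrix.of fun i j => -(∏ l ∈ Finset.univ.erase j, (X - C (r l))).coeff (κ i)

/-- The Vandermonde matrix of `r`, with columns indexed through `κ`. -/
def vand (κ : ι ≃ Fin N) (r : ι → ℂ) : Matrix ι ι ℂ := Matrix.of fun k i => r k ^ (κ i : ℕ)

theorem coeffPoly_coeff (κ : ι ≃ Fin N) (c : ι → ℂ) (i : ι) :
    (coeffPoly κ c).coeff (κ i) = c i := by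
  have h : (κ i : ℕ) ≠ N := (κ i).2.ne
  simp only [coeffPoly, coeff_add, coeff_X_pow, h, if_false, finsetSum_coeff, coeff_C_mul,
    zero_add, mul_ite, mul_one, mul_zero]
  rw [Finset.sum_eq_single i]
  · simp
  · intro j _ hj
    rw [if_neg]
    intro h'
    exact hj (κ.injective (Fin.ext h'.symm))
  · simp

theorem coeffPoly_degree_sum_lt (κ : ι ≃ Fin N) (c : ι → ℂ) :
    (∑ i, C (c i) * X ^ (κ i : ℕ)).degree < (N : WithBot ℕ) := by
  refine (degree_sum_le _ _).trans_lt ?_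
  refine (Finset.sup_lt_iff (WithBot.bot_lt_coe N)).2 fun i _ => ?_
  exact (degree_C_mul_X_pow_le _ _).trans_lt (Nat.cast_lt.2 (κ i).2)

theorem coeffPoly_monic (κ : ι ≃ Fin N) (c : ι → ℂ) : (coeffPoly κ c).Monic :=
  monic_X_pow_add (coeffPoly_degree_sum_lt κ c)

theorem coeffPoly_natDegree (κ : ι ≃ Fin N) (c : ι → ℂ) : (coeffPoly κ c).natDegree = N := by
  apply natDegree_eq_of_degree_eq_some
  rw [coeffPoly, degree_add_eq_left_of_degree_lt, degree_X_pow]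
  rw [degree_X_pow]
  exact coeffPoly_degree_sum_lt κ c

theorem rootPoly_monic (r : ι → ℂ) : (rootPoly r).Monic :=
  monic_prod_of_monic _ _ fun i _ => monic_X_sub_C (r i)

theorem rootPoly_natDegree (r : ι → ℂ) : (rootPoly r).natDegree = Fintype.card ι := by
  rw [rootPoly, natDegree_prod_of_monic _ _ fun i _ => monic_X_sub_C (r i)]
  simp

theorem rootPoly_eq_coeffPoly_iff (κ : ι ≃ Fin N) (r c : ι → ℂ) :
    rootPoly r = coeffPoly κ c ↔ rootMap κ r = c := by
  have hcard : Fintype.card ι = N := by simpa using Fintype.card_congr κ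
  constructor
  · intro h
    ext i
    rw [rootMap, h, coeffPoly_coeff]
  · rintro rfl
    ext n
    rcases lt_trichotomy n N with h | h | h
    · obtain ⟨i, hi⟩ := κ.surjective ⟨n, h⟩
      have : n = (κ i : ℕ) := by rw [hi]
      rw [this, coeffPoly_coeff, rootMap]
    · have h1 := (rootPoly_monic r).coeff_natDegree
      have h2 := (coeffPoly_monic κ (rootMap κ r)).coeff_natDegree
      rw [rootPoly_natDegree, hcard] at h1
      rw [coeffPoly_natDegree] at h2
      rw [h, h1, h2]
    · rw [coeff_eq_zero_of_natDegree_lt (by rwa [rootPoly_natDegree, hcard]),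
        coeff_eq_zero_of_natDegree_lt (by rwa [coeffPoly_natDegree])]

theorem exists_rootPoly_eq_coeffPoly (κ : ι ≃ Fin N) (c : ι → ℂ) :
    ∃ r : ι → ℂ, rootPoly r = coeffPoly κ c := by
  set p := coeffPoly κ c with hp
  have hs : p.Splits := IsAlgClosed.splits p
  have hcard : p.roots.toList.length = N := by
    rw [Multiset.length_toList, ← hs.natDegree_eq_card_roots, hp, coeffPoly_natDegree]
  refine ⟨fun i => p.roots.toList[(κ i : ℕ)]'(by rw [hcard]; exact (κ i).2), ?_⟩
  have h1 : p = (p.roots.map (X - C ·)).prod :=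
    hs.eq_prod_roots_of_monic (coeffPoly_monic κ c)
  conv_rhs => rw [h1, ← Multiset.coe_toList p.roots]
  rw [rootPoly, Multiset.map_coe, Multiset.prod_coe,
    κ.prod_comp (fun k : Fin N => X - C (p.roots.toList[(k : ℕ)]'(by rw [hcard]; exact k.2))),
    ← List.prod_ofFn]
  congr 1
  apply List.ext_getElem
  · simp [hcard]
  · intro n h1 h2
    simp

/-- The product is affine in each root, with slope minus the product of the other factors. The
induction splits off one factor `X - C (r a)` and runs over all coefficient indices at once, since
multiplication by `X` shifts them. -/
theorem hasFDerivAt_coeff_prod_X_sub_C (s : Finset ι) (n : ℕ) (r : ι → ℂ) :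
    HasFDerivAt (𝕜 := ℂ) (fun r : ι → ℂ => (∏ j ∈ s, (X - C (r j))).coeff n)
      (∑ j ∈ s, (-(∏ l ∈ s.erase j, (X - C (r l))).coeff n) •
        (ContinuousLinearMap.proj j : (ι → ℂ) →L[ℂ] ℂ)) r := by
  induction s using Finset.induction_on generalizing n with
  | empty => simpa using hasFDerivAt_const (𝕜 := ℂ) ((1 : ℂ[X]).coeff n) r
  | insert a s ha ih =>
    have hX : HasFDerivAt (𝕜 := ℂ) (fun r : ι → ℂ => (X * ∏ j ∈ s, (X - C (r j))).coeff n)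
        (∑ j ∈ s, (-(X * ∏ l ∈ s.erase j, (X - C (r l))).coeff n) •
        (ContinuousLinearMap.proj j : (ι → ℂ) →L[ℂ] ℂ)) r := by
      cases n with
      | zero =>
        refine ((hasFDerivAt_const (𝕜 := ℂ) (0 : ℂ) r).congr_fderiv ?_).congr_of_eventuallyEq
          (Filter.Eventually.of_forall fun r => by simp)
        ext v
        simp
      | succ n => simpa only [coeff_X_mul] using ih n
    have ha' : HasFDerivAt (𝕜 := ℂ) (fun r : ι → ℂ => r a)
        (ContinuousLinearMap.proj a : (ι → ℂ) →L[ℂ] ℂ) r := hasFDerivAt_apply a r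
    have h := hX.sub (ha'.mul (ih n))
    refine (h.congr_fderiv ?_).congr_of_eventuallyEq (Filter.Eventually.of_forall fun r => ?_)
    · ext v
      have hj : ∀ j ∈ s, (∏ l ∈ (insert a s).erase j, (X - C (r l))).coeff n =
          (X * ∏ l ∈ s.erase j, (X - C (r l))).coeff n -
            r a * (∏ l ∈ s.erase j, (X - C (r l))).coeff n := by
        intro j hj
        have hja : a ≠ j := fun h => ha (h ▸ hj)
        rw [Finset.erase_insert_of_ne hja, Finset.prod_insert (by simp [ha]), sub_mul, coeff_sub,
          coeff_C_mul]
      have hs : ∑ j ∈ s, -(∏ l ∈ (insert a s).erase j, (X - C (r l))).coeff n * v j =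
          ∑ j ∈ s, -(X * ∏ l ∈ s.erase j, (X - C (r l))).coeff n * v j -
            r a * ∑ j ∈ s, -(∏ l ∈ s.erase j, (X - C (r l))).coeff n * v j := by
        rw [Finset.mul_sum, ← Finset.sum_sub_distrib]
        exact Finset.sum_congr rfl fun j hj' => by rw [hj j hj']; ring
      simp only [sub_apply, add_apply, smul_apply, sum_apply,
        ContinuousLinearMap.proj_apply, smul_eq_mul, Finset.sum_insert ha,
        Finset.erase_insert ha, hs]
      ring
    · simp [Finset.prod_insert ha, sub_mul]

theorem hasFDerivAt_rootMap (κ : ι ≃ Fin N) (r : ι → ℂ) :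
    HasFDerivAt (𝕜 := ℂ) (rootMap κ) (Matrix.toLin' (rootMapDeriv κ r)).toContinuousLinearMap
      r := by
  rw [hasFDerivAt_pi']
  intro i
  refine (hasFDerivAt_coeff_prod_X_sub_C Finset.univ (κ i) r).congr_fderiv ?_
  ext v
  simp [rootMapDeriv, Matrix.mulVec, dotProduct]

theorem vand_eq_submatrix (κ : ι ≃ Fin N) (r : ι → ℂ) :
    vand κ r = (Matrix.vandermonde (r ∘ κ.symm)).submatrix κ κ := by
  ext i j
  simp [vand, Matrix.vandermonde_apply]

theorem det_vand (κ : ι ≃ Fin N) (r : ι → ℂ) :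
    (vand κ r).det = ∏ i : Fin N, ∏ j ∈ Finset.Ioi i, (r (κ.symm j) - r (κ.symm i)) := by
  rw [vand_eq_submatrix, Matrix.det_submatrix_equiv_self, Matrix.det_vandermonde]
  rfl

theorem det_vand_ne_zero_iff (κ : ι ≃ Fin N) (r : ι → ℂ) :
    (vand κ r).det ≠ 0 ↔ Function.Injective r := by
  rw [vand_eq_submatrix, Matrix.det_submatrix_equiv_self, Matrix.det_vandermonde_ne_zero_iff,
    κ.symm.injective_comp]

/-- The sign relating the Vandermonde determinant to the Jacobian of the root map. -/
def vandSign (N : ℕ) : ℂ := (-1) ^ N * ∏ i : Fin N, ∏ _j ∈ Finset.Ioi i, (-1)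

theorem norm_vandSign (N : ℕ) : ‖vandSign N‖ = 1 := by
  simp [vandSign, norm_prod]

/-- Every unordered pair occurs twice with opposite signs; `vandSign` collects the signs and the
square of the Vandermonde product remains. -/
theorem prod_prod_erase_sub (v : Fin N → ℂ) :
    ∏ i, -∏ j ∈ Finset.univ.erase i, (v i - v j) =
      vandSign N * (∏ i, ∏ j ∈ Finset.Ioi i, (v j - v i)) ^ 2 := by
  have h1 : ∀ i : Fin N, ∏ j ∈ Finset.univ.erase i, (v i - v j) =
      (∏ j ∈ Finset.Iio i, (v i - v j)) * ∏ j ∈ Finset.Ioi i, (v i - v j) := by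
    intro i
    rw [← Finset.prod_union]
    · congr 1
      ext j
      simp [lt_or_lt_iff_ne]
    · rw [Finset.disjoint_left]
      intro j hj hj'
      simp only [Finset.mem_Iio, Finset.mem_Ioi] at hj hj'
      exact lt_asymm hj hj'
  have h2 : ∏ i, ∏ j ∈ Finset.Iio i, (v i - v j) = ∏ i, ∏ j ∈ Finset.Ioi i, (v j - v i) := by
    apply Finset.prod_comm'
    simp
  have h3 : ∏ i, ∏ j ∈ Finset.Ioi i, (v i - v j) =
      (∏ i : Fin N, ∏ _j ∈ Finset.Ioi i, (-1)) * ∏ i, ∏ j ∈ Finset.Ioi i, (v j - v i) := by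
    rw [← Finset.prod_mul_distrib]
    refine Finset.prod_congr rfl fun i _ => ?_
    rw [← Finset.prod_mul_distrib]
    exact Finset.prod_congr rfl fun j _ => by ring
  rw [Finset.prod_congr rfl fun i _ => (neg_one_mul _).symm, Finset.prod_mul_distrib,
    Finset.prod_congr rfl fun i _ => h1 i, Finset.prod_mul_distrib, h2, h3, vandSign]
  simp only [Finset.prod_const, Finset.card_univ, Fintype.card_fin]
  ring

/-- Row `k` of the Vandermonde matrix evaluates a polynomial at `x k`, and column `j` of the
Jacobian lists the coefficients of minus the product of the factors other than `j`. The case `x = r`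
yields the Jacobian determinant; independent nodes `x` and `r` yield the Cauchy determinant later
on. -/
theorem vand_mul_rootMapDeriv (κ : ι ≃ Fin N) (x r : ι → ℂ) :
    vand κ x * rootMapDeriv κ r =
      Matrix.of fun k j => -∏ l ∈ Finset.univ.erase j, (x k - r l) := by
  ext k j
  have hdeg : (∏ l ∈ Finset.univ.erase j, (X - C (r l))).natDegree < N := by
    have hcard : Fintype.card ι = N := by simpa using Fintype.card_congr κ
    have : 0 < N := (κ j).pos
    rw [natDegree_prod_of_monic _ _ fun i _ => monic_X_sub_C (r i)]
    simp [Finset.card_erase_of_mem, hcard, this]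
  have h := eval_eq_sum_range' hdeg (x k)
  rw [eval_prod] at h
  simp only [eval_sub, eval_X, eval_C] at h
  have h2 := Fin.sum_univ_eq_sum_range (fun i =>
    (∏ l ∈ Finset.univ.erase j, (X - C (r l))).coeff i * x k ^ i) N
  rw [Matrix.mul_apply, Matrix.of_apply, h, ← h2, ← κ.sum_comp, ← Finset.sum_neg_distrib]
  refine Finset.sum_congr rfl fun i _ => ?_
  simp [vand, rootMapDeriv, mul_comm]

/-- For distinct roots, multiplying by the Vandermonde matrix gives a diagonal matrix and one
Vandermonde factor cancels. For a repeated root two columns of the Jacobian agree and both sides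
vanish. -/
theorem det_rootMapDeriv (κ : ι ≃ Fin N) (r : ι → ℂ) :
    (rootMapDeriv κ r).det = vandSign N * (vand κ r).det := by
  by_cases hr : Function.Injective r
  · have hne : (vand κ r).det ≠ 0 := (det_vand_ne_zero_iff κ r).2 hr
    apply mul_left_cancel₀ hne
    rw [← Matrix.det_mul, vand_mul_rootMapDeriv]
    have hd : (Matrix.of fun k j => -∏ l ∈ Finset.univ.erase j, (r k - r l)) =
        Matrix.diagonal fun j => -∏ l ∈ Finset.univ.erase j, (r j - r l) := by
      ext k j
      rw [Matrix.of_apply, Matrix.diagonal_apply]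
      split_ifs with h
      · rw [h]
      · rw [Finset.prod_eq_zero (i := k) (by simp [h]) (sub_self _), neg_zero]
    rw [hd, Matrix.det_diagonal, det_vand]
    have h := prod_prod_erase_sub (fun i => r (κ.symm i))
    rw [mul_left_comm, ← sq, ← h, ← κ.symm.prod_comp]
    refine Finset.prod_congr rfl fun i _ => ?_
    congr 1
    refine (Finset.prod_bij (fun j _ => κ.symm j) ?_ ?_ ?_ ?_).symm
    · simp
    · simp
    · intro l hl
      exact ⟨κ l, by simpa [Equiv.eq_symm_apply] using hl, by simp⟩
    · simp
  · have h0 : (vand κ r).det = 0 := by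
      by_contra h
      exact hr ((det_vand_ne_zero_iff κ r).1 h)
    rw [h0, mul_zero]
    simp only [Function.Injective, not_forall] at hr
    obtain ⟨a, b, hab, hne⟩ := hr
    refine Matrix.det_zero_of_column_eq hne fun k => ?_
    simp only [rootMapDeriv, Matrix.of_apply]
    congr 2
    rw [← Finset.mul_prod_erase (Finset.univ.erase a) _ (by simp [Ne.symm hne] : b ∈ _),
      ← Finset.mul_prod_erase (Finset.univ.erase b) _ (by simp [hne] : a ∈ _), hab,
      Finset.erase_right_comm]

section Generic

variable {K : Type*} [NormedField K] [SecondCountableTopology K] [MeasureSpace K] [BorelSpace K]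
  [ProperSpace K] [SigmaFinite (volume : Measure K)] [NullSingletonClass (volume : Measure K)]

theorem eval_coeffPoly (κ : ι ≃ Fin N) (c : ι → ℂ) (z : ℂ) :
    (coeffPoly κ c).eval z = z ^ N + ∑ i, c i * z ^ (κ i : ℕ) := by
  simp [coeffPoly, eval_finsetSum]

theorem eval_derivative_coeffPoly (κ : ι ≃ Fin N) (c : ι → ℂ) (z : ℂ) :
    (derivative (coeffPoly κ c)).eval z =
      N * z ^ (N - 1) + ∑ i, c i * ((κ i : ℕ) * z ^ ((κ i : ℕ) - 1)) := by
  simp [coeffPoly, eval_finsetSum, derivative_X_pow]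

/-- Fix all coefficients but the constant one, so that the polynomial is `q + C (e x)`. A common
zero `z` with the derivative satisfies `q' z = 0` and `e x = -q z`. As `q'` is nonzero it has
finitely many zeros, so each slice is finite and Fubini applies. -/
theorem ae_no_common_root_fin (e : K →+* ℂ) (he : Continuous e) (n : ℕ) :
    ∀ᵐ b : Fin (n + 1) → K, ∀ z : ℂ, (coeffPoly (Equiv.refl _) fun i => e (b i)).eval z = 0 →
      (derivative (coeffPoly (Equiv.refl _) fun i => e (b i))).eval z ≠ 0 := by
  set B : Set (Fin (n + 1) → K) := {b | ∃ z : ℂ,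
    (coeffPoly (Equiv.refl _) fun i => e (b i)).eval z = 0 ∧
      (derivative (coeffPoly (Equiv.refl _) fun i => e (b i))).eval z = 0} with hB
  have hBm : MeasurableSet B := by
    set D : Set ((Fin (n + 1) → K) × ℂ) := {p |
      (coeffPoly (Equiv.refl _) fun i => e (p.1 i)).eval p.2 = 0 ∧
      (derivative (coeffPoly (Equiv.refl _) fun i => e (p.1 i))).eval p.2 = 0} with hD
    -- The exceptional set is the projection of a closed, hence σ-compact set; it is thus a
    -- countable union of compact sets, which makes it measurable.
    have hDc : IsClosed D := by
      simp only [hD, eval_coeffPoly, eval_derivative_coeffPoly]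
      exact (isClosed_eq (by fun_prop) continuous_const).inter
        (isClosed_eq (by fun_prop) continuous_const)
    have hDσ : IsSigmaCompact (Prod.fst '' D) :=
      (isSigmaCompact_univ.of_isClosed_subset hDc (Set.subset_univ _)).image continuous_fst
    have hBD : B = Prod.fst '' D := by
      ext b
      simp [hB, hD]
    rw [hBD]
    obtain ⟨S, hS, hSU⟩ := hDσ
    rw [← hSU]
    exact MeasurableSet.iUnion fun i => (hS i).isClosed.measurableSet
  have hB0 : volume B = 0 := by
    have hmp := (volume_preserving_piFinSuccAbove (fun _ : Fin (n + 1) => K) 0).symm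
    rw [← hmp.measure_preimage_equiv, Measure.volume_eq_prod,
      ← Measure.prod_swap, Measure.map_apply measurable_swap
        (hmp.measurable hBm), Measure.measure_prod_null (measurable_swap (hmp.measurable hBm))]
    refine Filter.Eventually.of_forall fun a => ?_
    set q : ℂ[X] := coeffPoly (Equiv.refl _) fun i => e ((Fin.cons 0 a : Fin (n + 1) → K) i)
    have hq : ∀ x : K, coeffPoly (Equiv.refl _)
        (fun i => e ((Fin.cons x a : Fin (n + 1) → K) i)) = q + C (e x) := by
      intro x
      simp only [q, coeffPoly, Fin.sum_univ_succ, Fin.cons_zero, Fin.cons_succ]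
      simp
      ring
    have hq0 : derivative q ≠ 0 := by
      intro h
      have h1 := derivative_eq_zero.1 h
      rw [coeffPoly_natDegree] at h1
      exact absurd h1 (Nat.succ_ne_zero n)
    refine Set.Finite.measure_zero (Set.Finite.preimage e.injective.injOn
      (((derivative q).roots.toFinset.finite_toSet).image fun z => -q.eval z) |>.subset ?_) _
    intro x hx
    simp only [Set.mem_preimage, Prod.swap_prod_mk, hB, Set.mem_ofPred_eq] at hx
    obtain ⟨z, h1, h2⟩ := hx
    have hc : ((MeasurableEquiv.piFinSuccAbove (fun _ : Fin (n + 1) => K) 0).symm (x, a)) =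
        Fin.cons x a := by
      ext i
      refine Fin.cases ?_ (fun i => ?_) i <;> simp [MeasurableEquiv.piFinSuccAbove]
    rw [hc, hq] at h1 h2
    simp only [eval_add, eval_C, derivative_add, derivative_C, add_zero] at h1 h2
    refine ⟨z, ?_, ?_⟩
    · simp [hq0, h2]
    · exact (eq_neg_of_add_eq_zero_right h1).symm
  rw [ae_iff]
  convert hB0 using 2
  ext b
  simp [hB]

/-- Almost every monic polynomial has no repeated root. -/
theorem ae_injective_of_rootPoly_eq (e : K →+* ℂ) (he : Continuous e) (κ : ι ≃ Fin N) :
    ∀ᵐ c : ι → K, ∀ r : ι → ℂ, (rootPoly r = coeffPoly κ fun i => e (c i)) →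
      Function.Injective r := by
  cases N with
  | zero =>
    refine Filter.Eventually.of_forall fun c r _ a => ?_
    exact (κ a).elim0
  | succ n =>
    have hmp := volume_measurePreserving_piCongrLeft (fun _ : Fin (n + 1) => K) κ
    filter_upwards [hmp.quasiMeasurePreserving.ae (ae_no_common_root_fin e he n)] with c hc r hr
    have hcp : coeffPoly (Equiv.refl _) (fun i => e (MeasurableEquiv.piCongrLeft
        (fun _ : Fin (n + 1) => K) κ c i)) = coeffPoly κ fun i => e (c i) := by
      simp only [coeffPoly]
      rw [← κ.sum_comp]
      congr 1
      refine Finset.sum_congr rfl fun i _ => ?_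
      have : MeasurableEquiv.piCongrLeft (fun _ : Fin (n + 1) => K) κ c (κ i) = c i :=
        Equiv.piCongrLeft_apply_apply (fun _ : Fin (n + 1) => K) κ c i
      rw [this]
      rfl
    rw [hcp, ← hr] at hc
    intro a b hab
    by_contra hne
    have hfac : rootPoly r = (X - C (r a)) ^ 2 *
        ∏ l ∈ (Finset.univ.erase a).erase b, (X - C (r l)) := by
      rw [rootPoly, ← Finset.mul_prod_erase Finset.univ _ (Finset.mem_univ a),
        ← Finset.mul_prod_erase (Finset.univ.erase a) _ (by simp [Ne.symm hne] : b ∈ _), hab]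
      ring
    refine hc (r a) ?_ ?_
    · rw [hfac]; simp
    · rw [hfac, sq]; simp

end Generic

end RootMap

/-! ### The reciprocal Mahler measure of linear factors -/

section ReciprocalMahler

theorem laurentMahlerMeasure_mul (g h : ℂ[T;T⁻¹]) :
    laurentMahlerMeasure (g * h) = laurentMahlerMeasure g * laurentMahlerMeasure h := by
  obtain ⟨n, p, hp⟩ := LaurentPolynomial.exists_T_pow g
  obtain ⟨m, q, hq⟩ := LaurentPolynomial.exists_T_pow h
  rw [laurentMahlerMeasure_eq g n p hp, laurentMahlerMeasure_eq h m q hq,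
    laurentMahlerMeasure_eq (g * h) (n + m) (p * q), mahlerMeasure_mul]
  rw [map_mul, hp, hq, Nat.cast_add, LaurentPolynomial.T_add]
  ring

theorem laurentMahlerMeasure_one : laurentMahlerMeasure 1 = 1 := by
  rw [laurentMahlerMeasure_eq 1 0 1 (by simp), mahlerMeasure_one]

theorem reciprocalMahlerMeasure_prod {ι : Type*} (s : Finset ι) (f : ι → ℂ[X]) :
    reciprocalMahlerMeasure (∏ i ∈ s, f i) = ∏ i ∈ s, reciprocalMahlerMeasure (f i) := by
  classical
  induction s using Finset.induction_on with
  | empty => simp [reciprocalMahlerMeasure, laurentMahlerMeasure_one]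
  | insert a s ha ih =>
    rw [Finset.prod_insert ha, Finset.prod_insert ha, ← ih]
    simp [reciprocalMahlerMeasure, laurentMahlerMeasure_mul]

/-- The reciprocal Mahler measure of the linear polynomial with root `β`. -/
def linMeasure (β : ℂ) : ℝ := reciprocalMahlerMeasure (X - C β)

theorem reciprocalMahlerMeasure_rootPoly {ι : Type*} [Fintype ι] (r : ι → ℂ) :
    reciprocalMahlerMeasure (rootPoly r) = ∏ i, linMeasure (r i) :=
  reciprocalMahlerMeasure_prod _ _

/-- Multiplication by `X` turns `x + x⁻¹ - (α + α⁻¹)` into `(X - C α) * (X - C α⁻¹)`, and `α⁻¹` lies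
in the closed unit disc. -/
theorem linMeasure_add_inv {α : ℂ} (hα : 1 ≤ ‖α‖) : linMeasure (α + α⁻¹) = ‖α‖ := by
  have h0 : α ≠ 0 := by
    rintro rfl
    simp at hα
    linarith
  rw [linMeasure, reciprocalMahlerMeasure,
    laurentMahlerMeasure_eq _ 1 ((X - C α) * (X - C α⁻¹)), mahlerMeasure_mul,
    mahlerMeasure_X_sub_C, mahlerMeasure_X_sub_C, max_eq_right hα, max_eq_left, mul_one]
  · rw [norm_inv]
    exact inv_le_one_of_one_le₀ hα
  · have h1 : (X - C α) * (X - C α⁻¹) = X ^ 2 - C (α + α⁻¹) * X + 1 := by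
      have : C α * C α⁻¹ = (1 : ℂ[X]) := by rw [← C_mul, mul_inv_cancel₀ h0, C_1]
      rw [C_add]
      linear_combination this
    rw [h1]
    simp only [map_add, map_sub, map_mul, map_one, map_pow, aeval_X, aeval_C, toLaurent_X,
      toLaurent_C]
    have h2 : (LaurentPolynomial.T 1 : ℂ[T;T⁻¹]) * LaurentPolynomial.T (-1) = 1 := by
      rw [← LaurentPolynomial.T_add]
      simp
    simp only [LaurentPolynomial.algebraMap_apply, Algebra.algebraMap_self, RingHom.id_apply,
      Nat.cast_one]
    linear_combination -h2

/-- The two roots of `α ^ 2 - β * α + 1` are inverse to each other, so one of them has modulus at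
least one. -/
theorem exists_eq_add_inv (β : ℂ) : ∃ α : ℂ, 1 ≤ ‖α‖ ∧ β = α + α⁻¹ := by
  obtain ⟨w, hw⟩ := IsAlgClosed.exists_pow_nat_eq (β ^ 2 - 4) (n := 2) (by norm_num)
  set α := (β + w) / 2
  have h1 : α * ((β - w) / 2) = 1 := by
    simp only [α]
    linear_combination (-1 / 4) * hw
  have h2 : α⁻¹ = (β - w) / 2 := inv_eq_of_mul_eq_one_right h1
  have h3 : β = α + α⁻¹ := by rw [h2]; simp only [α]; ring
  rcases le_total 1 ‖α‖ with h | h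
  · exact ⟨α, h, h3⟩
  · refine ⟨α⁻¹, ?_, by rw [inv_inv, add_comm]; exact h3⟩
    rw [norm_inv]
    refine (one_le_inv₀ ?_).2 h
    rw [norm_pos_iff]
    rintro h
    rw [h, zero_mul] at h1
    exact zero_ne_one h1

theorem one_le_linMeasure (β : ℂ) : 1 ≤ linMeasure β := by
  obtain ⟨α, h, rfl⟩ := exists_eq_add_inv β
  rwa [linMeasure_add_inv h]

theorem linMeasure_pos (β : ℂ) : 0 < linMeasure β := one_pos.trans_le (one_le_linMeasure β)

theorem norm_le_two_mul_linMeasure (β : ℂ) : ‖β‖ ≤ 2 * linMeasure β := by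
  obtain ⟨α, h, rfl⟩ := exists_eq_add_inv β
  rw [linMeasure_add_inv h]
  have h1 : ‖α⁻¹‖ ≤ 1 := by
    rw [norm_inv]
    exact inv_le_one_of_one_le₀ h
  linarith [norm_add_le α α⁻¹]

theorem linMeasure_conj (β : ℂ) : linMeasure (starRingEnd ℂ β) = linMeasure β := by
  obtain ⟨α, h, rfl⟩ := exists_eq_add_inv β
  rw [linMeasure_add_inv h, map_add, map_inv₀, linMeasure_add_inv (by simpa using h)]
  simp

theorem linMeasure_neg (β : ℂ) : linMeasure (-β) = linMeasure β := by
  obtain ⟨α, h, rfl⟩ := exists_eq_add_inv β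
  rw [linMeasure_add_inv h, neg_add, ← inv_neg, linMeasure_add_inv (by simpa using h)]
  simp

variable {ι : Type*} [Fintype ι] [DecidableEq ι] {N : ℕ}

theorem reciprocalMahlerMeasure_coeffPoly_pos (κ : ι ≃ Fin N) (c : ι → ℂ) :
    0 < reciprocalMahlerMeasure (coeffPoly κ c) := by
  obtain ⟨r, hr⟩ := exists_rootPoly_eq_coeffPoly κ c
  rw [← hr, reciprocalMahlerMeasure_rootPoly]
  exact Finset.prod_pos fun i _ => linMeasure_pos _

/-- After multiplication by `X ^ N` the measure is that of a polynomial `P c` depending continuously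
on `c`. Its logarithm is the circle average of `log ‖P c‖`, and a parameter integral of a jointly
measurable function is measurable. Positivity of the measure shows `P c ≠ 0`, as the integral
formula requires. -/
theorem measurable_reciprocalMahlerMeasure_coeffPoly (κ : ι ≃ Fin N) :
    Measurable fun c : ι → ℂ => reciprocalMahlerMeasure (coeffPoly κ c) := by
  set P : (ι → ℂ) → ℂ[X] := fun c =>
    (X ^ 2 + 1) ^ N + ∑ i, C (c i) * ((X ^ 2 + 1) ^ (κ i : ℕ) * X ^ (N - κ i)) with hP
  have hρ : ∀ c, reciprocalMahlerMeasure (coeffPoly κ c) = (P c).mahlerMeasure := by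
    intro c
    have h1 : (LaurentPolynomial.T 1 + LaurentPolynomial.T (-1) : ℂ[T;T⁻¹]) *
        LaurentPolynomial.T 1 = LaurentPolynomial.T 1 ^ 2 + 1 := by
      rw [add_mul, ← LaurentPolynomial.T_add (-1)]
      simp [sq]
    have hT : ∀ n : ℕ, (LaurentPolynomial.T (n : ℤ) : ℂ[T;T⁻¹]) =
        LaurentPolynomial.T 1 ^ n := by
      intro n
      rw [LaurentPolynomial.T_pow]
      simp
    refine laurentMahlerMeasure_eq _ N _ ?_
    rw [hP, coeffPoly]
    simp only [map_add, map_mul, map_one, map_pow, map_sum, aeval_X, aeval_C, toLaurent_X,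
      toLaurent_C]
    rw [hT, add_mul, ← mul_pow, h1, Finset.sum_mul]
    congr 1
    refine Finset.sum_congr rfl fun i _ => ?_
    rw [LaurentPolynomial.algebraMap_apply, Algebra.algebraMap_self, RingHom.id_apply, mul_assoc]
    congr 1
    rw [← h1, mul_pow, mul_assoc, ← pow_add, Nat.add_sub_of_le (κ i).2.le]
  have hne : ∀ c, P c ≠ 0 := fun c h => by
    have := reciprocalMahlerMeasure_coeffPoly_pos κ c
    rw [hρ, h, mahlerMeasure_zero] at this
    exact lt_irrefl _ this
  have heq : (fun c : ι → ℂ => reciprocalMahlerMeasure (coeffPoly κ c)) =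
      fun c => Real.exp ((2 * Real.pi)⁻¹ * ∫ θ in Set.Ioc 0 (2 * Real.pi),
        Real.log ‖(P c).eval (circleMap 0 1 θ)‖) := by
    ext c
    rw [hρ, mahlerMeasure_def_of_ne_zero (hne c),
      intervalIntegral.integral_of_le Real.two_pi_pos.le]
  rw [heq]
  refine Real.measurable_exp.comp (Measurable.const_mul ?_ _)
  have hmeas : Measurable fun p : (ι → ℂ) × ℝ =>
      Real.log ‖(P p.1).eval (circleMap 0 1 p.2)‖ := by
    refine Real.measurable_log.comp (measurable_norm.comp (Continuous.measurable ?_))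
    have hc : Continuous (circleMap 0 1) := continuous_circleMap 0 1
    simp only [hP, eval_add, eval_pow, eval_X, eval_one, eval_finsetSum, eval_mul, eval_C]
    fun_prop
  exact (hmeas.stronglyMeasurable.integral_prod_right').measurable

theorem measurable_linMeasure : Measurable linMeasure := by
  have h : linMeasure = fun β => (fun c : Fin 1 → ℂ =>
      reciprocalMahlerMeasure (coeffPoly (Equiv.refl (Fin 1)) c)) (fun _ => -β) := by
    ext β
    simp [linMeasure, coeffPoly, sub_eq_add_neg]
  rw [h]
  exact (measurable_reciprocalMahlerMeasure_coeffPoly _).comp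
    (measurable_pi_iff.2 fun _ => measurable_neg)

end ReciprocalMahler

/-! ### Chebyshev polynomials in the variable α + α⁻¹ -/

section Chebyshev

/-- The monic Chebyshev polynomial of the second kind `U_n(x / 2)`. -/
def chebS (n : ℕ) : ℂ[X] := Chebyshev.S ℂ n

theorem chebS_zero : chebS 0 = 1 := by simp [chebS]

theorem chebS_one : chebS 1 = X := by simp [chebS]

theorem chebS_add_two (n : ℕ) : chebS (n + 2) = X * chebS (n + 1) - chebS n := by
  simp [chebS]

theorem chebS_natDegree_monic (n : ℕ) : (chebS n).natDegree = n ∧ (chebS n).Monic := by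
  induction n using Nat.twoStepInduction with
  | zero => simp [chebS_zero]
  | one => simp [chebS_one]
  | more n ih1 ih2 =>
    have hm : (X * chebS (n + 1)).Monic := monic_X.mul ih2.2
    have hd : (X * chebS (n + 1)).natDegree = n + 2 := by
      rw [monic_X.natDegree_mul ih2.2, ih2.1, natDegree_X]
      ring
    have hlt : (chebS n).natDegree < (X * chebS (n + 1)).natDegree := by
      rw [hd, ih1.1]
      lia
    rw [chebS_add_two]
    refine ⟨by rw [natDegree_sub_eq_left_of_natDegree_lt hlt, hd], ?_⟩
    exact hm.sub_of_left (degree_lt_degree hlt)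

/-- A recursion without division: the closed form divides by `α - α⁻¹`, which vanishes at `α = ±1`,
whereas the growth bound below must hold there too. -/
theorem chebS_succ_eval {α : ℂ} (h0 : α ≠ 0) (n : ℕ) :
    (chebS (n + 1)).eval (α + α⁻¹) = α * (chebS n).eval (α + α⁻¹) + (α⁻¹) ^ (n + 1) := by
  induction n with
  | zero => simp [chebS_zero, chebS_one]
  | succ n ih =>
    rw [chebS_add_two]
    simp only [eval_sub, eval_mul, eval_X]
    have : α⁻¹ * α = 1 := inv_mul_cancel₀ h0
    rw [ih]
    linear_combination ((chebS n).eval (α + α⁻¹)) * this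

theorem sub_inv_mul_chebS_eval {α : ℂ} (h0 : α ≠ 0) (n : ℕ) :
    (α - α⁻¹) * (chebS n).eval (α + α⁻¹) = α ^ (n + 1) - (α⁻¹) ^ (n + 1) := by
  induction n with
  | zero => simp [chebS_zero]
  | succ n ih =>
    rw [chebS_succ_eval h0]
    have : α * α⁻¹ = 1 := mul_inv_cancel₀ h0
    linear_combination α * ih

theorem norm_chebS_eval_le (n : ℕ) (β : ℂ) :
    ‖(chebS n).eval β‖ ≤ (n + 1) * linMeasure β ^ n := by
  obtain ⟨α, h, rfl⟩ := exists_eq_add_inv β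
  rw [linMeasure_add_inv h]
  have h0 : α ≠ 0 := by
    rintro rfl
    simp at h
    linarith
  induction n with
  | zero => simp [chebS_zero]
  | succ n ih =>
    rw [chebS_succ_eval h0]
    have h1 : ‖(α⁻¹) ^ (n + 1)‖ ≤ ‖α‖ ^ (n + 1) := by
      rw [norm_pow, norm_inv]
      exact pow_le_pow_left₀ (by positivity) ((inv_le_one_of_one_le₀ h).trans h) _
    calc _ ≤ ‖α‖ * ‖(chebS n).eval (α + α⁻¹)‖ + ‖(α⁻¹) ^ (n + 1)‖ := by
          rw [← norm_mul]
          exact norm_add_le _ _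
      _ ≤ ‖α‖ * ((n + 1) * ‖α‖ ^ n) + ‖α‖ ^ (n + 1) := by gcongr
      _ = _ := by push_cast; ring

theorem chebS_eval_conj (n : ℕ) (β : ℂ) :
    (chebS n).eval (starRingEnd ℂ β) = starRingEnd ℂ ((chebS n).eval β) := by
  induction n using Nat.twoStepInduction with
  | zero => simp [chebS_zero]
  | one => simp [chebS_one]
  | more n ih1 ih2 => simp [chebS_add_two, ih1, ih2]

theorem chebS_eval_neg (n : ℕ) (β : ℂ) :
    (chebS n).eval (-β) = (-1) ^ n * (chebS n).eval β := by
  induction n using Nat.twoStepInduction with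
  | zero => simp [chebS_zero]
  | one => simp [chebS_one]
  | more n ih1 ih2 =>
    simp only [chebS_add_two, eval_sub, eval_mul, eval_X, ih1, ih2]
    ring

variable {ι : Type*} [Fintype ι] [DecidableEq ι] {N : ℕ}

/-- Monic polynomials of degrees `0, …, N - 1` arise from the powers by unitriangular column
operations; hence the monic normalization of `chebS`. -/
theorem det_vand_eq_det_chebS (κ : ι ≃ Fin N) (r : ι → ℂ) :
    (vand κ r).det = (Matrix.of fun k i => (chebS (κ i)).eval (r k)).det := by
  rw [vand_eq_submatrix, Matrix.det_submatrix_equiv_self,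
    Matrix.det_eval_matrixOfPolynomials_eq_det_vandermonde (r ∘ κ.symm)
      (fun i => chebS i) (fun i => (chebS_natDegree_monic i).1)
      (fun i => (chebS_natDegree_monic i).2),
    ← Matrix.det_submatrix_equiv_self κ]
  congr 1
  ext i j
  simp

end Chebyshev

/-! ### Integrability of the weighted Chebyshev polynomials -/

section Integrability

theorem norm_linMeasure_cpow (β s : ℂ) : ‖(linMeasure β : ℂ) ^ s‖ = linMeasure β ^ s.re :=
  Complex.norm_cpow_eq_rpow_re_of_pos (linMeasure_pos β) s

theorem measurable_linMeasure_cpow (s : ℂ) : Measurable fun β => (linMeasure β : ℂ) ^ s :=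
  (Complex.measurable_ofReal.comp measurable_linMeasure).pow_const s

theorem integrable_linMeasure_rpow_comp {V : Type*} [NormedAddCommGroup V] [NormedSpace ℝ V]
    [FiniteDimensional ℝ V] [MeasurableSpace V] [BorelSpace V] (μ : Measure V)
    [μ.IsAddHaarMeasure] (e : V → ℂ) (he : Measurable e) (hnorm : ∀ x, ‖e x‖ = ‖x‖) {q : ℝ}
    (hq : (Module.finrank ℝ V : ℝ) < q) :
    Integrable (fun x => linMeasure (e x) ^ (-q)) μ := by
  have hq0 : 0 < q := lt_of_le_of_lt (Nat.cast_nonneg _) hq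
  -- The constant comes from `1 + ‖x‖ ≤ 3 * linMeasure (e x)`, as the measure is at least `1` and at
  -- least `‖x‖ / 2`.
  refine ((integrable_one_add_norm (μ := μ) hq).const_mul (3 ^ q)).mono'
    ((measurable_linMeasure.comp he).pow_const _).aestronglyMeasurable
    (Filter.Eventually.of_forall fun x => ?_)
  have h1 := one_le_linMeasure (e x)
  have h2 := norm_le_two_mul_linMeasure (e x)
  rw [hnorm] at h2
  have hpos := linMeasure_pos (e x)
  have hx : 0 < 1 + ‖x‖ := by positivity
  rw [Real.norm_of_nonneg (Real.rpow_nonneg hpos.le _), Real.rpow_neg hpos.le,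
    Real.rpow_neg hx.le, ← div_eq_mul_inv, inv_eq_one_div,
    div_le_div_iff₀ (Real.rpow_pos_of_pos hpos _) (Real.rpow_pos_of_pos hx _), one_mul,
    ← Real.mul_rpow (by norm_num) hpos.le]
  exact Real.rpow_le_rpow hx.le (by linarith) hq0.le

/-- The weighted Chebyshev polynomial `ρ(X - x)⁻ˢ S_n(x)`. -/
def wcheb (s : ℂ) (n : ℕ) (x : ℂ) : ℂ := (linMeasure x : ℂ) ^ (-s) * (chebS n).eval x

theorem measurable_wcheb (s : ℂ) (n : ℕ) : Measurable (wcheb s n) :=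
  (measurable_linMeasure_cpow _).mul (chebS n).continuous.measurable

theorem norm_wcheb_le (s : ℂ) (n : ℕ) (x : ℂ) :
    ‖wcheb s n x‖ ≤ (n + 1) * linMeasure x ^ (-(s.re - n)) := by
  have hpos := linMeasure_pos x
  rw [wcheb, norm_mul, norm_linMeasure_cpow, Complex.neg_re]
  calc _ ≤ linMeasure x ^ (-s.re) * ((n + 1) * linMeasure x ^ n) := by
        gcongr
        exact norm_chebS_eval_le n x
    _ = (n + 1) * (linMeasure x ^ (-s.re) * linMeasure x ^ (n : ℝ)) := by
        rw [Real.rpow_natCast]; ring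
    _ = _ := by
        rw [← Real.rpow_add hpos]
        congr 2
        ring

theorem integrable_wcheb_real {s : ℂ} {n : ℕ} (h : (n : ℝ) + 1 < s.re) :
    Integrable fun x : ℝ => wcheb s n (x : ℂ) := by
  refine ((integrable_linMeasure_rpow_comp volume (fun x : ℝ => (x : ℂ))
    Complex.measurable_ofReal (fun x => by simp) (q := s.re - n) ?_).const_mul (n + 1)).mono'
    ((measurable_wcheb s n).comp Complex.measurable_ofReal).aestronglyMeasurable
    (Filter.Eventually.of_forall fun x => norm_wcheb_le s n x)
  simp
  linarith

theorem integrable_wcheb_mul_wcheb_conj {s : ℂ} {m n : ℕ} (h : (m : ℝ) + n + 2 < 2 * s.re) :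
    Integrable fun z : ℂ => wcheb s m z * wcheb s n (starRingEnd ℂ z) := by
  refine ((integrable_linMeasure_rpow_comp volume (fun x : ℂ => x)
    measurable_id (fun x => rfl) (q := 2 * s.re - m - n) ?_).const_mul
      ((m + 1) * (n + 1))).mono'
    ((measurable_wcheb s m).mul ((measurable_wcheb s n).comp
      Complex.continuous_conj.measurable)).aestronglyMeasurable
    (Filter.Eventually.of_forall fun x => ?_)
  · rw [Complex.finrank_real_complex]
    push_cast
    linarith
  · have hpos := linMeasure_pos x
    rw [norm_mul]
    calc _ ≤ ((m + 1) * linMeasure x ^ (-(s.re - m))) *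
          ((n + 1) * linMeasure x ^ (-(s.re - n))) := by
          have h1 := norm_wcheb_le s n (starRingEnd ℂ x)
          rw [linMeasure_conj] at h1
          exact mul_le_mul (norm_wcheb_le s m x) h1 (norm_nonneg _) (by positivity)
      _ = (m + 1) * (n + 1) *
          (linMeasure x ^ (-(s.re - m)) * linMeasure x ^ (-(s.re - n))) := by ring
      _ = _ := by
        rw [← Real.rpow_add hpos]
        congr 2
        ring

end Integrability

/-! ### Integrals over the complex plane -/

section Plane

open Set Real

theorem hasFDerivAt_add_inv {α : ℂ} (h0 : α ≠ 0) :
    HasFDerivAt (fun z : ℂ => z + z⁻¹)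
      (((1 - (α ^ 2)⁻¹) • (1 : ℂ →L[ℂ] ℂ)).restrictScalars ℝ) α := by
  have h : HasDerivAt (fun z : ℂ => z + z⁻¹) (1 - (α ^ 2)⁻¹) α := by
    exact ((hasDerivAt_id' α).fun_add (hasDerivAt_inv h0)).congr_deriv (by ring)
  have h' := h.hasFDerivAt.restrictScalars ℝ
  refine h'.congr_fderiv ?_
  ext
  simp [mul_comm]

theorem det_smul_one_restrictScalars (c : ℂ) :
    (((c • (1 : ℂ →L[ℂ] ℂ))).restrictScalars ℝ).det = ‖c‖ ^ 2 := by
  change LinearMap.det ((c • (LinearMap.id : ℂ →ₗ[ℂ] ℂ)).restrictScalars ℝ) = _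
  rw [LinearMap.det_restrictScalars]
  simp [Algebra.norm_complex_eq, Complex.normSq_eq_norm_sq]

theorem injOn_add_inv : InjOn (fun z : ℂ => z + z⁻¹) {z | 1 < ‖z‖} := by
  intro z hz w hw h
  have hz0 : z ≠ 0 := norm_pos_iff.1 (one_pos.trans hz)
  have hw0 : w ≠ 0 := norm_pos_iff.1 (one_pos.trans hw)
  have h1 : (z - w) * (z * w - 1) = 0 := by
    simp only at h
    field_simp at h
    linear_combination h
  rcases mul_eq_zero.1 h1 with h2 | h2
  · exact sub_eq_zero.1 h2
  · exfalso
    have h3 : ‖z‖ * ‖w‖ = 1 := by rw [← norm_mul, sub_eq_zero.1 h2, norm_one]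
    have : 1 < ‖z‖ * ‖w‖ := one_lt_mul_of_lt_of_le hz (le_of_lt hw)
    linarith

/-- The missing values are of the form `α + α⁻¹` with `‖α‖ = 1`; then `α⁻¹` is the conjugate of `α`,
so they lie on the real line, a null subspace. -/
theorem volume_compl_image_add_inv :
    volume ((fun z : ℂ => z + z⁻¹) '' {z | 1 < ‖z‖})ᶜ = 0 := by
  refine measure_mono_null (t := (LinearMap.ker Complex.imLm : Submodule ℝ ℂ)) ?_ ?_
  · intro β hβ
    obtain ⟨α, hα, rfl⟩ := exists_eq_add_inv β
    have h1 : ‖α‖ = 1 := by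
      by_contra h
      exact hβ ⟨α, lt_of_le_of_ne hα (Ne.symm h), rfl⟩
    have h2 : α⁻¹ = starRingEnd ℂ α := by
      rw [Complex.inv_def, Complex.normSq_eq_norm_sq, h1]
      simp
    simp [h2]
  · refine Measure.addHaar_submodule _ _ fun h => ?_
    have : Complex.I ∈ (LinearMap.ker Complex.imLm : Submodule ℝ ℂ) := by rw [h]; trivial
    simp at this

/-- The point `r * exp(i θ)`. -/
def polarPoint (p : ℝ × ℝ) : ℂ := p.1 * Complex.exp (p.2 * Complex.I)

theorem norm_polarPoint {p : ℝ × ℝ} (hp : 0 ≤ p.1) : ‖polarPoint p‖ = p.1 := by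
  rw [polarPoint, norm_mul, Complex.norm_exp_ofReal_mul_I, mul_one, Complex.norm_real,
    Real.norm_of_nonneg hp]

/-- Integration over the plane in the coordinates `β = α + α⁻¹`, `α = r * exp(i θ)`, `r > 1`. -/
theorem integral_eq_integral_joukowski_polar (G : ℂ → ℂ) :
    ∫ β, G β = ∫ p in Ioi (1 : ℝ) ×ˢ Ioo (-π) π,
      (p.1⁻¹ * ‖polarPoint p - (polarPoint p)⁻¹‖ ^ 2) •
        G (polarPoint p + (polarPoint p)⁻¹) := by
  have hm : MeasurableSet {z : ℂ | 1 < ‖z‖} := measurableSet_lt measurable_const measurable_norm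
  have hne : ∀ z ∈ {z : ℂ | 1 < ‖z‖}, z ≠ 0 := fun z hz => norm_pos_iff.1 (one_pos.trans hz)
  have hd : ∀ z ∈ {z : ℂ | 1 < ‖z‖}, HasFDerivWithinAt (fun z : ℂ => z + z⁻¹)
      (((1 - (z ^ 2)⁻¹) • (1 : ℂ →L[ℂ] ℂ)).restrictScalars ℝ) {z | 1 < ‖z‖} z :=
    fun z hz => (hasFDerivAt_add_inv (hne z hz)).hasFDerivWithinAt
  have h1 : ∫ β, G β = ∫ β in (fun z : ℂ => z + z⁻¹) '' {z | 1 < ‖z‖}, G β := by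
    rw [← setIntegral_univ]
    refine setIntegral_congr_set ?_
    exact (ae_eq_univ.2 volume_compl_image_add_inv).symm
  rw [h1, integral_image_eq_integral_abs_det_fderiv_smul volume hm hd injOn_add_inv,
    ← integral_indicator hm, ← Complex.integral_comp_polarCoord_symm, polarCoord_target]
  have hsub : Ioi (1 : ℝ) ×ˢ Ioo (-π) π ⊆ Ioi (0 : ℝ) ×ˢ Ioo (-π) π :=
    prod_mono (Ioi_subset_Ioi zero_le_one) subset_rfl
  have hms : MeasurableSet (Ioi (1 : ℝ) ×ˢ Ioo (-π) π) := measurableSet_Ioi.prod measurableSet_Ioo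
  have hpp : ∀ p : ℝ × ℝ, Complex.polarCoord.symm p = polarPoint p := by
    intro p
    rw [Complex.polarCoord_symm_apply, polarPoint, Complex.exp_mul_I]
    simp
  rw [setIntegral_eq_of_subset_of_forall_sdiff_eq_zero
    (measurableSet_Ioi.prod measurableSet_Ioo) hsub (f := fun p : ℝ × ℝ =>
      p.1 • indicator {z : ℂ | 1 < ‖z‖} (fun x => |(((1 - (x ^ 2)⁻¹) •
        (1 : ℂ →L[ℂ] ℂ)).restrictScalars ℝ).det| • G (x + x⁻¹)) (Complex.polarCoord.symm p))]
  · refine setIntegral_congr_fun hms fun p hp => ?_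
    have hp1 : 1 < p.1 := hp.1
    have hp0 : 0 < p.1 := one_pos.trans hp1
    have hn : ‖polarPoint p‖ = p.1 := norm_polarPoint hp0.le
    have h0 : polarPoint p ≠ 0 := norm_pos_iff.1 (by rw [hn]; exact hp0)
    have hmem : polarPoint p ∈ {z : ℂ | 1 < ‖z‖} := by
      change 1 < ‖polarPoint p‖
      rw [hn]
      exact hp1
    simp only [hpp, indicator_of_mem hmem]
    rw [det_smul_one_restrictScalars, abs_of_nonneg (by positivity), smul_smul]
    congr 1
    have h2 : polarPoint p - (polarPoint p)⁻¹ =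
        polarPoint p * (1 - (polarPoint p ^ 2)⁻¹) := by
      field_simp
    rw [h2, norm_mul, hn, mul_pow]
    field_simp
  · intro p hp
    have hp1 : ¬ 1 < ‖Complex.polarCoord.symm p‖ := by
      rw [hpp, norm_polarPoint (le_of_lt hp.1.1)]
      intro h
      exact hp.2 ⟨h, hp.1.2⟩
    rw [indicator_of_notMem (by exact hp1), smul_zero]

theorem integral_Ioi_one_cpow_sub {z : ℂ} {a : ℤ} (h : (a : ℝ) < z.re) :
    IntegrableOn (fun r : ℝ => (r : ℂ) ^ (-z - 1 + a)) (Ioi 1) ∧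
      ∫ r in Ioi (1 : ℝ), (r : ℂ) ^ (-z - 1 + a) = 1 / (z - a) := by
  have hre : (-z - 1 + a : ℂ).re < -1 := by
    simp
    linarith
  refine ⟨integrableOn_Ioi_cpow_of_lt hre one_pos, ?_⟩
  rw [integral_Ioi_cpow_of_lt hre one_pos]
  simp only [Complex.ofReal_one, Complex.one_cpow]
  rw [show (-z - 1 + a + 1 : ℂ) = -(z - a) by ring, neg_div_neg_eq]

/-- The Jacobian `‖α - α⁻¹‖ ^ 2` is a product of two conjugate factors which cancel the denominators
of the two Chebyshev values. What remains is a product of two binomials, hence four terms, each a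
power of `r` times a character of the angle. -/
theorem joukowski_integrand (s : ℂ) (m n : ℕ) {p : ℝ × ℝ} (hp : 1 < p.1) :
    ((p.1⁻¹ * ‖polarPoint p - (polarPoint p)⁻¹‖ ^ 2 : ℝ) : ℂ) *
      (wcheb s m (polarPoint p + (polarPoint p)⁻¹) *
        wcheb s n (starRingEnd ℂ (polarPoint p + (polarPoint p)⁻¹))) =
    (p.1 : ℂ) ^ (-(2 * s) - 1 + ((m + n + 2 : ℤ) : ℂ)) *
        Complex.exp (((m - n : ℤ) : ℂ) * (p.2 * Complex.I)) -
      (p.1 : ℂ) ^ (-(2 * s) - 1 + ((m - n : ℤ) : ℂ)) *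
        Complex.exp (((m + n + 2 : ℤ) : ℂ) * (p.2 * Complex.I)) -
      (p.1 : ℂ) ^ (-(2 * s) - 1 + ((n - m : ℤ) : ℂ)) *
        Complex.exp (((-(m + n + 2) : ℤ) : ℂ) * (p.2 * Complex.I)) +
      (p.1 : ℂ) ^ (-(2 * s) - 1 + ((-(m + n + 2) : ℤ) : ℂ)) *
        Complex.exp (((n - m : ℤ) : ℂ) * (p.2 * Complex.I)) := by
  obtain ⟨r, θ⟩ := p
  have hr0 : (0 : ℝ) < r := one_pos.trans hp
  have hrc : (r : ℂ) ≠ 0 := by exact_mod_cast hr0.ne'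
  set u := Complex.exp (θ * Complex.I) with hu
  have hu0 : u ≠ 0 := Complex.exp_ne_zero _
  set α := polarPoint (r, θ) with hα
  have hαu : α = r * u := rfl
  have h0 : α ≠ 0 := mul_ne_zero hrc hu0
  have hn : ‖α‖ = r := norm_polarPoint hr0.le
  have hconju : starRingEnd ℂ u = u⁻¹ := by
    rw [hu, ← Complex.exp_conj, ← Complex.exp_neg]
    simp
  have hconjα : starRingEnd ℂ α = r * u⁻¹ := by rw [hαu, map_mul, hconju, Complex.conj_ofReal]
  have hlm : linMeasure (α + α⁻¹) = r := by rw [linMeasure_add_inv (by rw [hn]; exact hp.le), hn]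
  have hsq : ((‖α - α⁻¹‖ ^ 2 : ℝ) : ℂ) = (α - α⁻¹) * starRingEnd ℂ (α - α⁻¹) := by
    rw [Complex.mul_conj, Complex.normSq_eq_norm_sq]
  have hw : wcheb s m (α + α⁻¹) * wcheb s n (starRingEnd ℂ (α + α⁻¹)) =
      (r : ℂ) ^ (-(2 * s)) * ((chebS m).eval (α + α⁻¹) *
        starRingEnd ℂ ((chebS n).eval (α + α⁻¹))) := by
    rw [wcheb, wcheb, linMeasure_conj, hlm, chebS_eval_conj,
      show -(2 * s) = -s + -s by ring, Complex.cpow_add _ _ hrc]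
    ring
  have hR : ∀ a : ℤ, (r : ℂ) ^ (-(2 * s) - 1 + (a : ℂ)) =
      (r : ℂ) ^ (-(2 * s)) * (r : ℂ)⁻¹ * (r : ℂ) ^ a := by
    intro a
    rw [Complex.cpow_add _ _ hrc, Complex.cpow_sub _ _ hrc, Complex.cpow_one,
      Complex.cpow_intCast, div_eq_mul_inv]
  have hE : ∀ a : ℤ, Complex.exp ((a : ℂ) * (θ * Complex.I)) = u ^ a := by
    intro a
    rw [Complex.exp_int_mul]
  simp only [hR, hE]
  rw [hw, Complex.ofReal_mul, hsq]
  have e1 := sub_inv_mul_chebS_eval h0 m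
  have e2 := congrArg (starRingEnd ℂ) (sub_inv_mul_chebS_eval h0 n)
  rw [map_mul] at e2
  have e3 : (((r, θ) : ℝ × ℝ).1⁻¹ : ℝ) = r⁻¹ := rfl
  calc _ = (r : ℂ) ^ (-(2 * s)) * (r : ℂ)⁻¹ * (((α - α⁻¹) * (chebS m).eval (α + α⁻¹)) *
        (starRingEnd ℂ (α - α⁻¹) * starRingEnd ℂ ((chebS n).eval (α + α⁻¹)))) := by
        rw [e3, Complex.ofReal_inv]
        ring
    _ = _ := by
        rw [e1, e2]
        simp only [map_sub, map_pow, map_inv₀, hconjα]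
        rw [hαu]
        have z1 : ∀ x : ℂ, x ≠ 0 → x ^ (m + n + 2 : ℤ) = x ^ (m + 1) * x ^ (n + 1) := by
          intro x _
          rw [← pow_add, ← zpow_natCast]
          congr 1
          push_cast
          ring
        have z2 : ∀ x : ℂ, x ≠ 0 → x ^ (m - n : ℤ) = x ^ (m + 1) * (x ^ (n + 1))⁻¹ := by
          intro x hx
          rw [← zpow_natCast, ← zpow_natCast, ← zpow_neg, ← zpow_add₀ hx]
          congr 1
          push_cast
          ring
        have z3 : ∀ x : ℂ, x ≠ 0 → x ^ (n - m : ℤ) = (x ^ (m + 1))⁻¹ * x ^ (n + 1) := by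
          intro x hx
          rw [← zpow_natCast, ← zpow_natCast, ← zpow_neg, ← zpow_add₀ hx]
          congr 1
          push_cast
          ring
        have z4 : ∀ x : ℂ, x ≠ 0 → x ^ (-(m + n + 2) : ℤ) =
            (x ^ (m + 1))⁻¹ * (x ^ (n + 1))⁻¹ := by
          intro x hx
          rw [zpow_neg, z1 x hx, mul_inv]
        simp only [z1 _ hrc, z2 _ hrc, z3 _ hrc, z4 _ hrc, z1 _ hu0, z2 _ hu0, z3 _ hu0, z4 _ hu0,
          mul_inv, inv_inv, mul_pow, inv_pow]
        ring

/-- Weighted Chebyshev products over the plane, with a factor depending only on the angle. -/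
theorem integral_plane_wcheb {s : ℂ} {m n : ℕ} (h : (m : ℝ) + n + 2 < 2 * s.re)
    (χ : ℂ → ℂ) (c : ℝ → ℂ)
    (hχ : ∀ p : ℝ × ℝ, p ∈ Ioi (1 : ℝ) ×ˢ Ioo (-π) π →
      χ (polarPoint p + (polarPoint p)⁻¹) = c p.2)
    (hc : ∀ a : ℤ, IntegrableOn (fun θ : ℝ => c θ * Complex.exp ((a : ℂ) * (θ * Complex.I)))
      (Ioo (-π) π)) (Θ : ℤ → ℂ)
    (hΘ : ∀ a : ℤ, ∫ θ in Ioo (-π) π, c θ * Complex.exp ((a : ℂ) * (θ * Complex.I)) = Θ a) :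
    ∫ β, χ β * (wcheb s m β * wcheb s n (starRingEnd ℂ β)) =
      1 / (2 * s - (m + n + 2)) * Θ (m - n) - 1 / (2 * s - (m - n)) * Θ (m + n + 2)
      - 1 / (2 * s - (n - m)) * Θ (-(m + n + 2)) + 1 / (2 * s + (m + n + 2)) * Θ (n - m) := by
  rw [integral_eq_integral_joukowski_polar]
  have hms : MeasurableSet (Ioi (1 : ℝ) ×ˢ Ioo (-π) π) := measurableSet_Ioi.prod measurableSet_Ioo
  set t : ℤ → ℤ → ℝ × ℝ → ℂ := fun a b p => (p.1 : ℂ) ^ (-(2 * s) - 1 + (a : ℂ)) *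
    (c p.2 * Complex.exp ((b : ℂ) * (p.2 * Complex.I))) with ht
  have hcongr : ∫ p in Ioi (1 : ℝ) ×ˢ Ioo (-π) π,
      (p.1⁻¹ * ‖polarPoint p - (polarPoint p)⁻¹‖ ^ 2) • (χ (polarPoint p + (polarPoint p)⁻¹) *
        (wcheb s m (polarPoint p + (polarPoint p)⁻¹) *
        wcheb s n (starRingEnd ℂ (polarPoint p + (polarPoint p)⁻¹)))) =
      ∫ p in Ioi (1 : ℝ) ×ˢ Ioo (-π) π, (t (m + n + 2) (m - n) p - t (m - n) (m + n + 2) p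
        - t (n - m) (-(m + n + 2)) p + t (-(m + n + 2)) (n - m) p) := by
    refine setIntegral_congr_fun hms fun p hp => ?_
    simp only [ht]
    rw [hχ p hp, Complex.real_smul, mul_left_comm, joukowski_integrand s m n hp.1]
    ring
  have h_int : ∀ a b : ℤ, (a : ℝ) < (2 * s).re →
      Integrable (t a b) ((volume : Measure (ℝ × ℝ)).restrict (Ioi (1 : ℝ) ×ˢ Ioo (-π) π)) := by
    intro a b ha
    rw [Measure.volume_eq_prod, ← Measure.prod_restrict]
    exact (integral_Ioi_one_cpow_sub ha).1.mul_prod (hc b)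
  have hval : ∀ a b : ℤ, (a : ℝ) < (2 * s).re →
      ∫ p in Ioi (1 : ℝ) ×ˢ Ioo (-π) π, t a b p = 1 / (2 * s - a) * Θ b := by
    intro a b ha
    rw [Measure.volume_eq_prod, ← hΘ, ← (integral_Ioi_one_cpow_sub ha).2]
    exact setIntegral_prod_mul (fun r : ℝ => (r : ℂ) ^ (-(2 * s) - 1 + (a : ℂ)))
      (fun θ : ℝ => c θ * Complex.exp ((b : ℂ) * (θ * Complex.I))) (Ioi 1) (Ioo (-π) π)
  have hre : (2 * s).re = 2 * s.re := by simp
  have hm0 : (0 : ℝ) ≤ m := Nat.cast_nonneg _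
  have hn0 : (0 : ℝ) ≤ n := Nat.cast_nonneg _
  have b1 : ((m + n + 2 : ℤ) : ℝ) < (2 * s).re := by rw [hre]; push_cast; linarith
  have b2 : ((m - n : ℤ) : ℝ) < (2 * s).re := by rw [hre]; push_cast; linarith
  have b3 : ((n - m : ℤ) : ℝ) < (2 * s).re := by rw [hre]; push_cast; linarith
  have b4 : ((-(m + n + 2) : ℤ) : ℝ) < (2 * s).re := by rw [hre]; push_cast; linarith
  have i2 : Integrable (fun p => t (m + n + 2) (m - n) p - t (m - n) (m + n + 2) p) _ :=
    (h_int _ (m - n) b1).sub (h_int _ (m + n + 2) b2)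
  have i3 : Integrable (fun p => t (m + n + 2) (m - n) p - t (m - n) (m + n + 2) p -
    t (n - m) (-(m + n + 2)) p) _ := i2.sub (h_int _ (-(m + n + 2)) b3)
  rw [hcongr, integral_add i3 (h_int _ _ b4), integral_sub i2 (h_int _ _ b3),
    integral_sub (h_int _ _ b1) (h_int _ _ b2), hval _ _ b1, hval _ _ b2, hval _ _ b3, hval _ _ b4]
  push_cast
  ring

theorem integral_exp_int_mul_I (a : ℤ) (ha : a ≠ 0) {x y : ℝ} (hxy : x ≤ y) :
    ∫ θ in Ioc x y, Complex.exp ((a : ℂ) * (θ * Complex.I)) =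
      (Complex.exp (a * (y * Complex.I)) - Complex.exp (a * (x * Complex.I))) /
        (a * Complex.I) := by
  have hc : (a * Complex.I : ℂ) ≠ 0 := mul_ne_zero (by exact_mod_cast ha) Complex.I_ne_zero
  have h := integral_exp_mul_complex (a := x) (b := y) hc
  rw [intervalIntegral.integral_of_le hxy] at h
  have hcomm : ∀ t : ℂ, (a : ℂ) * (t * Complex.I) = a * Complex.I * t := fun t => by ring
  simp only [hcomm]
  exact h

theorem exp_int_mul_pi_mul_I (a : ℤ) :
    Complex.exp (a * ((π : ℂ) * Complex.I)) = (-1) ^ a := by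
  rw [Complex.exp_int_mul, Complex.exp_pi_mul_I]

/-- Integration over the angle keeps only frequency zero. The frequencies `±(m + n + 2)` are never
zero, and `±(m - n)` vanish exactly when `m = n`. With `k = m + 1` the two surviving terms add up to
`2π (1 / (2s - 2k) + 1 / (2s + 2k))`. -/
theorem integral_wcheb_mul_wcheb_conj {s : ℂ} {m n : ℕ} (hm : (m : ℝ) + 1 < s.re)
    (hn : (n : ℝ) + 1 < s.re) :
    ∫ β, wcheb s m β * wcheb s n (starRingEnd ℂ β) =
      if m = n then 2 * π * (s / (s ^ 2 - ((m + 1 : ℕ) : ℂ) ^ 2)) else 0 := by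
  have hΘ : ∀ a : ℤ, ∫ θ in Ioo (-π) π, (1 : ℂ) * Complex.exp ((a : ℂ) * (θ * Complex.I)) =
      if a = 0 then 2 * (π : ℂ) else 0 := by
    intro a
    rw [← integral_Ioc_eq_integral_Ioo]
    simp only [one_mul]
    split_ifs with ha
    · subst ha
      simp [Measure.real, Real.pi_pos.le]
      ring
    · rw [integral_exp_int_mul_I a ha (by linarith [Real.pi_pos]), exp_int_mul_pi_mul_I]
      have : Complex.exp (a * (((-π : ℝ) : ℂ) * Complex.I)) = (-1) ^ a := by
        rw [show (a * (((-π : ℝ) : ℂ) * Complex.I) : ℂ) = ((-a : ℤ) : ℂ) * (π * Complex.I) by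
          push_cast; ring, exp_int_mul_pi_mul_I, zpow_neg, ← inv_zpow]
        norm_num
      rw [this]
      simp
  have h := integral_plane_wcheb (s := s) (m := m) (n := n) (by linarith) (fun _ => 1)
    (fun _ => 1) (fun _ _ => rfl) (fun a => ?_) _ hΘ
  · simp only [one_mul] at h
    rw [h]
    have e1 : ((m : ℤ) + n + 2) ≠ 0 := by positivity
    have e2 : -((m : ℤ) + n + 2) ≠ 0 := neg_ne_zero.2 e1
    simp only [e1, e2, if_false, sub_eq_zero, Nat.cast_inj]
    split_ifs with h1 h2 h2
    · subst h1
      have n1 : s - (m + 1) ≠ 0 := by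
        intro h0
        have := congrArg Complex.re h0
        simp at this
        linarith
      have n2 : s + (m + 1) ≠ 0 := by
        intro h0
        have := congrArg Complex.re h0
        have hm0 : (0 : ℝ) ≤ m := Nat.cast_nonneg _
        simp at this
        linarith
      rw [show s ^ 2 - ((m + 1 : ℕ) : ℂ) ^ 2 = (s - (m + 1)) * (s + (m + 1)) by push_cast; ring,
        show 2 * s - (m + m + 2) = 2 * (s - (m + 1)) by ring,
        show 2 * s + (m + m + 2) = 2 * (s + (m + 1)) by ring]
      field_simp
      ring
    · exact absurd h1.symm h2
    · exact absurd h2.symm h1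
    · ring
  · simp only [one_mul]
    have : Continuous fun θ : ℝ => Complex.exp ((a : ℂ) * (θ * Complex.I)) := by fun_prop
    exact (this.integrableOn_Icc (a := -π) (b := π)).mono_set Ioo_subset_Icc_self

/-- The phase of a pair of roots. -/
def pairPhase (x y : ℂ) : ℂ := starRingEnd ℂ (y - x) / ‖y - x‖

theorem norm_pairPhase_le (x y : ℂ) : ‖pairPhase x y‖ ≤ 1 := by
  rw [pairPhase, norm_div, RCLike.norm_conj, Complex.norm_real, norm_norm]
  exact div_self_le_one _

theorem measurable_pairPhase : Measurable fun p : ℂ × ℂ => pairPhase p.1 p.2 := by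
  unfold pairPhase
  exact (Complex.continuous_conj.measurable.comp (measurable_snd.sub measurable_fst)).div
    (Complex.measurable_ofReal.comp (measurable_norm.comp (measurable_snd.sub measurable_fst)))

theorem pairPhase_swap (x y : ℂ) : pairPhase y x = -pairPhase x y := by
  rw [pairPhase, pairPhase, ← norm_neg (x - y), neg_sub, ← neg_div, ← map_neg, neg_sub]

/-- For a conjugate pair the phase depends only on the half-plane containing `z`. In the coordinate
`α = r * exp (i θ)` this is the half-plane of `θ`, so the phase is an angular factor as required by
`integral_plane_wcheb`. -/
theorem pairPhase_conj_self (z : ℂ) :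
    pairPhase z (starRingEnd ℂ z) = Complex.I * (Real.sign z.im : ℂ) := by
  have h : starRingEnd ℂ z - z = ((-2 * z.im : ℝ) : ℂ) * Complex.I := by
    apply Complex.ext <;> simp
    ring
  rw [pairPhase, h, map_mul, Complex.conj_ofReal, Complex.conj_I, norm_mul, Complex.norm_real,
    Complex.norm_I, mul_one, Real.norm_eq_abs, abs_mul]
  rcases lt_trichotomy z.im 0 with h0 | h0 | h0
  · rw [Real.sign_of_neg h0, abs_of_neg h0]
    have : (z.im : ℂ) ≠ 0 := by exact_mod_cast h0.ne
    norm_num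
    field_simp
  · simp [h0]
  · rw [Real.sign_of_pos h0, abs_of_pos h0]
    have : (z.im : ℂ) ≠ 0 := by exact_mod_cast h0.ne'
    norm_num
    field_simp

theorem sign_im_joukowski {p : ℝ × ℝ} (hp : p ∈ Ioi (1 : ℝ) ×ˢ Ioo (-π) π) :
    Real.sign (polarPoint p + (polarPoint p)⁻¹).im = Real.sign p.2 := by
  obtain ⟨r, θ⟩ := p
  obtain ⟨hr, hθ⟩ := hp
  have hr1 : (1 : ℝ) < r := hr
  have hr0 : (0 : ℝ) < r := one_pos.trans hr1
  have him : (polarPoint (r, θ) + (polarPoint (r, θ))⁻¹).im = (r - r⁻¹) * Real.sin θ := by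
    have h1 : (polarPoint (r, θ)).im = r * Real.sin θ := by
      simp [polarPoint, Complex.exp_ofReal_mul_I_im]
    have h2 : (polarPoint (r, θ))⁻¹.im = -(r⁻¹ * Real.sin θ) := by
      rw [Complex.inv_im, h1, Complex.normSq_eq_norm_sq, norm_polarPoint hr0.le]
      field_simp
    rw [Complex.add_im, h1, h2]
    ring
  have hpos : 0 < r - r⁻¹ := sub_pos.2 ((inv_lt_one_of_one_lt₀ hr1).trans hr1)
  rw [him]
  rcases lt_trichotomy θ 0 with h0 | h0 | h0
  · rw [Real.sign_of_neg h0, Real.sign_of_neg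
      (mul_neg_of_pos_of_neg hpos (Real.sin_neg_of_neg_of_neg_pi_lt h0 hθ.1))]
  · simp [h0]
  · rw [Real.sign_of_pos h0, Real.sign_of_pos
      (mul_pos hpos (Real.sin_pos_of_pos_of_lt_pi h0 hθ.2))]

/-- The angular integral `∫ i sgn(θ) exp(i a θ)`. -/
def angular (a : ℤ) : ℂ := 2 * ((-1) ^ a - 1) / a

theorem integral_sign_exp (a : ℤ) :
    IntegrableOn (fun θ : ℝ => Complex.I * (Real.sign θ : ℂ) *
      Complex.exp ((a : ℂ) * (θ * Complex.I))) (Ioo (-π) π) ∧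
    ∫ θ in Ioo (-π) π, Complex.I * (Real.sign θ : ℂ) *
      Complex.exp ((a : ℂ) * (θ * Complex.I)) = angular a := by
  have hcont : Continuous fun θ : ℝ => Complex.exp ((a : ℂ) * (θ * Complex.I)) := by fun_prop
  have hpi := Real.pi_pos
  have hneg : EqOn (fun θ : ℝ => Complex.I * (Real.sign θ : ℂ) *
      Complex.exp ((a : ℂ) * (θ * Complex.I)))
      (fun θ => (-Complex.I) * Complex.exp ((a : ℂ) * (θ * Complex.I))) (Ioo (-π) 0) := by
    intro θ hθ
    simp [Real.sign_of_neg hθ.2]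
  have hposi : EqOn (fun θ : ℝ => Complex.I * (Real.sign θ : ℂ) *
      Complex.exp ((a : ℂ) * (θ * Complex.I)))
      (fun θ => Complex.I * Complex.exp ((a : ℂ) * (θ * Complex.I))) (Ioo 0 π) := by
    intro θ hθ
    simp [Real.sign_of_pos hθ.1]
  have i1 : IntegrableOn (fun θ : ℝ => Complex.I * (Real.sign θ : ℂ) *
      Complex.exp ((a : ℂ) * (θ * Complex.I))) (Ioo (-π) 0) :=
    (((continuous_const.mul hcont).integrableOn_Icc (a := -π) (b := 0)).mono_set
      Ioo_subset_Icc_self).congr_fun hneg.symm measurableSet_Ioo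
  have i2 : IntegrableOn (fun θ : ℝ => Complex.I * (Real.sign θ : ℂ) *
      Complex.exp ((a : ℂ) * (θ * Complex.I))) (Ioo 0 π) :=
    (((continuous_const.mul hcont).integrableOn_Icc (a := 0) (b := π)).mono_set
      Ioo_subset_Icc_self).congr_fun hposi.symm measurableSet_Ioo
  have i1' := (integrableOn_Ioc_iff_integrableOn_Ioo enorm_ne_top).2 i1
  have i2' := (integrableOn_Ioc_iff_integrableOn_Ioo enorm_ne_top).2 i2
  have hun : Ioc (-π) 0 ∪ Ioc 0 π = Ioc (-π) π := Ioc_union_Ioc_eq_Ioc (by linarith) hpi.le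
  refine ⟨(integrableOn_Ioc_iff_integrableOn_Ioo enorm_ne_top).1 (hun ▸ i1'.union i2'), ?_⟩
  rw [← integral_Ioc_eq_integral_Ioo, ← hun,
    setIntegral_union (Ioc_disjoint_Ioc_of_le le_rfl) measurableSet_Ioc i1' i2',
    integral_Ioc_eq_integral_Ioo, integral_Ioc_eq_integral_Ioo,
    setIntegral_congr_fun measurableSet_Ioo hneg, setIntegral_congr_fun measurableSet_Ioo hposi,
    integral_const_mul, integral_const_mul, ← integral_Ioc_eq_integral_Ioo,
    ← integral_Ioc_eq_integral_Ioo, angular]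
  -- At `a = 0` the definition of `angular` divides by zero and returns `0`, which is the right
  -- value because the integrand is then odd.
  rcases eq_or_ne a 0 with rfl | ha
  · simp [Measure.real, hpi.le]
  · rw [integral_exp_int_mul_I a ha (by linarith), integral_exp_int_mul_I a ha hpi.le,
      exp_int_mul_pi_mul_I]
    have h1 : Complex.exp (a * (((-π : ℝ) : ℂ) * Complex.I)) = (-1) ^ a := by
      rw [show (a * (((-π : ℝ) : ℂ) * Complex.I) : ℂ) = ((-a : ℤ) : ℂ) * (π * Complex.I) by
        push_cast; ring, exp_int_mul_pi_mul_I, zpow_neg, ← inv_zpow]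
      norm_num
    have h2 : (a : ℂ) ≠ 0 := by exact_mod_cast ha
    rw [h1]
    simp only [Complex.ofReal_zero, zero_mul, mul_zero, Complex.exp_zero]
    field_simp
    ring

theorem integral_pairPhase_plane {s : ℂ} {m n : ℕ} (h : (m : ℝ) + n + 2 < 2 * s.re) :
    ∫ β, pairPhase β (starRingEnd ℂ β) * (wcheb s m β * wcheb s n (starRingEnd ℂ β)) =
      1 / (2 * s - (m + n + 2)) * angular (m - n) - 1 / (2 * s - (m - n)) * angular (m + n + 2)
      - 1 / (2 * s - (n - m)) * angular (-(m + n + 2)) +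
        1 / (2 * s + (m + n + 2)) * angular (n - m) :=
  integral_plane_wcheb h (fun β => pairPhase β (starRingEnd ℂ β))
    (fun θ => Complex.I * (Real.sign θ : ℂ))
    (fun p hp => by rw [pairPhase_conj_self, sign_im_joukowski hp])
    (fun a => (integral_sign_exp a).1) angular fun a => (integral_sign_exp a).2

end Plane

/-! ### Integrals over the real line -/

section Line

open Set Real

theorem image_add_inv_Ioi {a : ℝ} (ha : 1 ≤ a) :
    (fun r : ℝ => r + r⁻¹) '' Ioi a = Ioi (a + a⁻¹) := by
  have ha0 : 0 < a := one_pos.trans_le ha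
  have key : ∀ x y : ℝ, 0 < x → 0 < y → (x + x⁻¹) - (y + y⁻¹) = (x - y) * (x * y - 1) / (x * y) := by
    intro x y hx hy
    field_simp
    ring
  ext y
  constructor
  · rintro ⟨r, hr, rfl⟩
    have hr' : a < r := hr
    have hr0 : 0 < r := ha0.trans hr'
    have h1 : 1 < r * a := by nlinarith
    have h2 : 0 < (r + r⁻¹) - (a + a⁻¹) := by
      rw [key r a hr0 ha0]
      have := sub_pos.2 hr'
      have := sub_pos.2 h1
      positivity
    change a + a⁻¹ < r + r⁻¹
    linarith
  · intro hy
    have hy' : a + a⁻¹ < y := hy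
    have h2 : 2 ≤ a + a⁻¹ := by
      have : a + a⁻¹ - 2 = (a - 1) ^ 2 / a := by field_simp; ring
      have h3 : 0 ≤ (a - 1) ^ 2 / a := by positivity
      linarith
    have hd : 0 ≤ y ^ 2 - 4 := by nlinarith
    set w := √(y ^ 2 - 4)
    have hw : w ^ 2 = y ^ 2 - 4 := Real.sq_sqrt hd
    have hw0 : 0 ≤ w := Real.sqrt_nonneg _
    set r := (y + w) / 2
    have hr1 : 1 < r := by simp only [r]; linarith
    have hr0 : 0 < r := one_pos.trans hr1
    have hinv : r⁻¹ = (y - w) / 2 := by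
      apply inv_eq_of_mul_eq_one_right
      simp only [r]
      linear_combination (-1 / 4) * hw
    have hry : r + r⁻¹ = y := by rw [hinv]; simp only [r]; ring
    refine ⟨r, ?_, hry⟩
    by_contra hle
    have hle' : r ≤ a := not_lt.1 hle
    have h4 := key a r ha0 hr0
    have h5 : 0 ≤ (a - r) * (a * r - 1) / (a * r) := by
      have h6 : 0 ≤ a - r := sub_nonneg.2 hle'
      have h7 : 0 ≤ a * r - 1 := by nlinarith
      positivity
    rw [hry] at h4
    linarith

theorem injOn_add_inv_Ioi {a : ℝ} (ha : 1 ≤ a) : InjOn (fun r : ℝ => r + r⁻¹) (Ioi a) := by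
  intro x hx y hy h
  have hx1 : 1 < x := ha.trans_lt hx
  have hy1 : 1 < y := ha.trans_lt hy
  have h1 : (x - y) * (x * y - 1) = 0 := by
    simp only at h
    have hx0 : x ≠ 0 := by positivity
    have hy0 : y ≠ 0 := by positivity
    field_simp at h
    linear_combination h
  rcases mul_eq_zero.1 h1 with h2 | h2
  · linarith
  · nlinarith

/-- Integration over a half-line in the coordinate `x = r + r⁻¹`. -/
theorem setIntegral_Ioi_add_inv {a : ℝ} (ha : 1 ≤ a) (s : ℂ) (n : ℕ) (K : ℝ → ℂ) :
    ∫ x in Ioi (a + a⁻¹), wcheb s n x * K x =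
      ∫ r in Ioi a, ((r : ℂ) ^ (-s - 1 + ((n + 1 : ℤ) : ℂ)) -
        (r : ℂ) ^ (-s - 1 + ((-(n + 1) : ℤ) : ℂ))) * K (r + r⁻¹) := by
  have hd : ∀ r ∈ Ioi a, HasDerivWithinAt (fun r : ℝ => r + r⁻¹) (1 - (r ^ 2)⁻¹) (Ioi a) r := by
    intro r hr
    have hr0 : r ≠ 0 := (one_pos.trans_le (ha.trans (le_of_lt hr))).ne'
    exact (((hasDerivAt_id' r).fun_add (hasDerivAt_inv hr0)).congr_deriv
      (by ring)).hasDerivWithinAt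
  rw [← image_add_inv_Ioi ha, integral_image_eq_integral_abs_deriv_smul measurableSet_Ioi hd
    (injOn_add_inv_Ioi ha)]
  refine setIntegral_congr_fun measurableSet_Ioi fun r hr => ?_
  have hr1 : 1 < r := ha.trans_lt hr
  have hr0 : 0 < r := one_pos.trans hr1
  have hrc : (r : ℂ) ≠ 0 := by exact_mod_cast hr0.ne'
  have habs : |1 - (r ^ 2)⁻¹| = 1 - (r ^ 2)⁻¹ := by
    apply abs_of_nonneg
    rw [sub_nonneg]
    exact inv_le_one_of_one_le₀ (one_le_pow₀ hr1.le)
  have hlm : linMeasure ((r : ℂ) + (r : ℂ)⁻¹) = r := by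
    rw [linMeasure_add_inv] <;> simp [abs_of_pos hr0, hr1.le]
  have hR : ∀ b : ℤ, (r : ℂ) ^ (-s - 1 + (b : ℂ)) =
      (r : ℂ) ^ (-s) * (r : ℂ)⁻¹ * (r : ℂ) ^ b := by
    intro b
    rw [Complex.cpow_add _ _ hrc, Complex.cpow_sub _ _ hrc, Complex.cpow_one,
      Complex.cpow_intCast, div_eq_mul_inv]
  have hS := sub_inv_mul_chebS_eval hrc n
  have hz : (r : ℂ) ^ ((n : ℤ) + 1) = (r : ℂ) ^ (n + 1) := by
    rw [← zpow_natCast]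
    push_cast
    rfl
  simp only [habs, hR, Complex.real_smul, wcheb]
  push_cast
  rw [inv_pow] at hS
  rw [hlm, zpow_neg, hz]
  have h1 : (1 - ((r : ℂ) ^ 2)⁻¹) = (r : ℂ)⁻¹ * (r - (r : ℂ)⁻¹) := by
    field_simp
  rw [h1]
  linear_combination (r : ℂ) ^ (-s) * (r : ℂ)⁻¹ * K (r + r⁻¹) * hS

theorem two_cos_eq (θ : ℝ) :
    ((2 * cos θ : ℝ) : ℂ) = Complex.exp (θ * Complex.I) + (Complex.exp (θ * Complex.I))⁻¹ := by
  rw [← Complex.exp_neg]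
  push_cast
  rw [Complex.cos]
  ring_nf

theorem linMeasure_two_cos (θ : ℝ) : linMeasure ((2 * cos θ : ℝ) : ℂ) = 1 := by
  rw [two_cos_eq, linMeasure_add_inv] <;> simp [Complex.norm_exp_ofReal_mul_I]

/-- On `[-2, 2]` the weight is identically `1`, and the sine from `dx = -2 sin θ dθ` turns the
Chebyshev value into `sin ((n + 1) θ)`. -/
theorem chebS_two_cos_mul_sin (n : ℕ) (θ : ℝ) :
    (chebS n).eval ((2 * cos θ : ℝ) : ℂ) * (sin θ : ℂ) = (sin ((n + 1 : ℕ) * θ) : ℂ) := by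
  have h := sub_inv_mul_chebS_eval (Complex.exp_ne_zero (θ * Complex.I)) n
  rw [← two_cos_eq] at h
  have h1 : ∀ t : ℂ, Complex.exp (t * Complex.I) - (Complex.exp (t * Complex.I))⁻¹ =
      2 * Complex.I * Complex.sin t := by
    intro t
    rw [← Complex.exp_neg, Complex.sin, neg_mul]
    linear_combination
      (Complex.exp (t * Complex.I) - Complex.exp (-(t * Complex.I))) * Complex.I_sq
  rw [h1, inv_pow, ← Complex.exp_nat_mul, ← mul_assoc, h1] at h
  have h2 : (2 * Complex.I : ℂ) ≠ 0 := mul_ne_zero two_ne_zero Complex.I_ne_zero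
  apply mul_left_cancel₀ h2
  push_cast at h ⊢
  linear_combination h

/-- Integration over a subinterval of `[-2, 2]` in the coordinate `x = 2 cos θ`. -/
theorem setIntegral_Ioo_two_cos {θ₀ : ℝ} (h0 : 0 ≤ θ₀) (hπ : θ₀ ≤ π) (s : ℂ) (n : ℕ)
    (K : ℝ → ℂ) :
    ∫ x in Ioo (2 * cos θ₀) 2, wcheb s n x * K x =
      ∫ θ in Ioo 0 θ₀, 2 * (sin ((n + 1 : ℕ) * θ) : ℂ) * K (2 * cos θ) := by
  have hanti : StrictAntiOn (fun θ : ℝ => 2 * cos θ) (Icc 0 θ₀) := by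
    intro x hx y hy hxy
    have := Real.strictAntiOn_cos ⟨hx.1, hx.2.trans hπ⟩ ⟨hy.1, hy.2.trans hπ⟩ hxy
    simp only
    linarith
  have him : (fun θ : ℝ => 2 * cos θ) '' Ioo 0 θ₀ = Ioo (2 * cos θ₀) 2 := by
    ext y
    constructor
    · rintro ⟨θ, hθ, rfl⟩
      have h1 := hanti (left_mem_Icc.2 h0) (Ioo_subset_Icc_self hθ) hθ.1
      have h2 := hanti (Ioo_subset_Icc_self hθ) (right_mem_Icc.2 h0) hθ.2
      simp only [cos_zero, mul_one] at h1 h2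
      exact ⟨h2, h1⟩
    · intro hy
      have hc : ContinuousOn (fun θ : ℝ => 2 * cos θ) (Icc 0 θ₀) := by fun_prop
      have := intermediate_value_Ioo' h0 hc
      simp only [cos_zero, mul_one] at this
      exact this hy
  have hd : ∀ θ ∈ Ioo 0 θ₀, HasDerivWithinAt (fun θ : ℝ => 2 * cos θ) (2 * -sin θ) (Ioo 0 θ₀) θ :=
    fun θ _ => ((Real.hasDerivAt_cos θ).const_mul 2).hasDerivWithinAt
  rw [← him, integral_image_eq_integral_abs_deriv_smul measurableSet_Ioo hd
    (hanti.injOn.mono Ioo_subset_Icc_self)]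
  refine setIntegral_congr_fun measurableSet_Ioo fun θ hθ => ?_
  have hsin : 0 < sin θ := Real.sin_pos_of_pos_of_lt_pi hθ.1 (hθ.2.trans_le hπ)
  have habs : |2 * -sin θ| = 2 * sin θ := by
    rw [mul_neg, abs_neg, abs_of_pos (by positivity)]
  simp only [habs, wcheb, linMeasure_two_cos, Complex.real_smul, Complex.ofReal_one,
    Complex.one_cpow, one_mul]
  rw [← chebS_two_cos_mul_sin]
  push_cast
  ring

theorem integral_Ioi_cpow_sub {z : ℂ} {a : ℤ} (h : (a : ℝ) < z.re) {c : ℝ} (hc : 0 < c) :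
    ∫ r in Ioi c, (r : ℂ) ^ (-z - 1 + a) = (c : ℂ) ^ (-z + a) / (z - a) := by
  have hre : (-z - 1 + a : ℂ).re < -1 := by
    simp
    linarith
  rw [integral_Ioi_cpow_of_lt hre hc,
    show (-z - 1 + a + 1 : ℂ) = -(z - a) by ring, neg_div_neg_eq,
    show -(z - (a : ℂ)) = -z + a by ring]

theorem integral_tail_wcheb {s : ℂ} {n : ℕ} (h : (n : ℝ) + 1 < s.re) {a : ℝ} (ha : 1 ≤ a) :
    ∫ x in Ioi (a + a⁻¹), wcheb s n x =
      (a : ℂ) ^ (-s + ((n + 1 : ℤ) : ℂ)) / (s - (n + 1)) -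
        (a : ℂ) ^ (-s + ((-(n + 1) : ℤ) : ℂ)) / (s + (n + 1)) := by
  have ha0 : 0 < a := one_pos.trans_le ha
  have hn0 : (0 : ℝ) ≤ n := Nat.cast_nonneg _
  have b1 : ((n + 1 : ℤ) : ℝ) < s.re := by push_cast; linarith
  have b2 : ((-(n + 1) : ℤ) : ℝ) < s.re := by push_cast; linarith
  have h1 := setIntegral_Ioi_add_inv ha s n (fun _ => 1)
  simp only [mul_one] at h1
  rw [h1, integral_sub, integral_Ioi_cpow_sub b1 ha0, integral_Ioi_cpow_sub b2 ha0]
  · push_cast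
    ring
  · exact integrableOn_Ioi_cpow_of_lt (by simp; linarith) ha0
  · exact integrableOn_Ioi_cpow_of_lt (by simp; linarith) ha0

theorem integral_sin_mul_Ioo {a : ℝ} (ha : a ≠ 0) {θ₀ : ℝ} (h0 : 0 ≤ θ₀) :
    ∫ θ in Ioo 0 θ₀, sin (a * θ) = (1 - cos (a * θ₀)) / a := by
  rw [← integral_Ioc_eq_integral_Ioo, ← intervalIntegral.integral_of_le h0,
    intervalIntegral.integral_comp_mul_left (fun x => sin x) ha]
  simp
  field_simp

/-- The half-line is cut at `2`. With `k = n + 1`, the arc contributes `2 (1 - cos (k θ₀)) / k` and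
the tail `2 k / (s² - k²)`; the parts free of `θ₀` combine to `2 s² / (k (s² - k²))`. -/
theorem integral_wcheb_Ioi_two_cos {s : ℂ} {n : ℕ} (h : (n : ℝ) + 1 < s.re) {θ₀ : ℝ}
    (h0 : 0 ≤ θ₀) (hπ : θ₀ ≤ π) :
    ∫ x in Ioi (2 * cos θ₀), wcheb s n x =
      2 * s ^ 2 / ((n + 1) * (s ^ 2 - (n + 1) ^ 2)) -
        2 * (cos ((n + 1 : ℕ) * θ₀) : ℂ) / (n + 1) := by
  have h_int := integrable_wcheb_real h
  have hle : 2 * cos θ₀ ≤ 2 := by linarith [cos_le_one θ₀]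
  rw [← Ioc_union_Ioi_eq_Ioi hle, setIntegral_union (Ioc_disjoint_Ioi le_rfl) measurableSet_Ioi
    h_int.integrableOn h_int.integrableOn, integral_Ioc_eq_integral_Ioo]
  have h1 := setIntegral_Ioo_two_cos h0 hπ s n (fun _ => 1)
  have h2 := integral_tail_wcheb h le_rfl
  simp only [mul_one] at h1
  norm_num at h2
  rw [h1, h2]
  have hn : ((n + 1 : ℕ) : ℝ) ≠ 0 := by positivity
  have h3 := integral_sin_mul_Ioo hn h0
  rw [integral_const_mul, integral_complex_ofReal, h3]
  have hn0 : (0 : ℝ) ≤ n := Nat.cast_nonneg _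
  have n1 : s - (n + 1) ≠ 0 := by
    intro h0
    have := congrArg Complex.re h0
    simp at this
    linarith
  have n2 : s + (n + 1) ≠ 0 := by
    intro h0
    have := congrArg Complex.re h0
    simp at this
    linarith
  have n3 : (n + 1 : ℂ) ≠ 0 := by exact_mod_cast hn
  rw [show s ^ 2 - ((n : ℂ) + 1) ^ 2 = (s - (n + 1)) * (s + (n + 1)) by ring]
  push_cast
  field_simp
  ring

theorem wcheb_neg (s : ℂ) (n : ℕ) (x : ℂ) : wcheb s n (-x) = (-1) ^ n * wcheb s n x := by
  rw [wcheb, wcheb, linMeasure_neg, chebS_eval_neg]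
  ring

theorem integral_eq_two_mul_of_even {F : ℝ → ℂ} (hF : Integrable F) (he : ∀ x, F (-x) = F x) :
    ∫ x, F x = 2 * ∫ x in Ioi (0 : ℝ), F x := by
  rw [← intervalIntegral.integral_Iic_add_Ioi (b := 0) hF.integrableOn hF.integrableOn]
  have h := integral_comp_neg_Iic 0 F
  simp only [he, neg_zero] at h
  rw [h]
  ring

theorem integral_eq_zero_of_odd {F : ℝ → ℂ} (ho : ∀ x, F (-x) = -F x) : ∫ x, F x = 0 := by
  have h := integral_neg_eq_self F volume
  simp only [ho, integral_neg] at h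
  exact self_eq_neg.1 h.symm

theorem cos_odd_mul_pi_div_two {j : ℕ} (hj : Odd j) : cos (j * (π / 2)) = 0 := by
  obtain ⟨i, rfl⟩ := hj
  rw [Real.cos_eq_zero_iff]
  exact ⟨i, by push_cast; ring⟩

theorem integral_wcheb_of_even {s : ℂ} {n : ℕ} (h : (n : ℝ) + 1 < s.re) (hn : Even n) :
    ∫ x : ℝ, wcheb s n x = 4 * s ^ 2 / ((n + 1) * (s ^ 2 - (n + 1) ^ 2)) := by
  have h_int := integrable_wcheb_real h
  rw [integral_eq_two_mul_of_even h_int]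
  · have h1 := integral_wcheb_Ioi_two_cos h (θ₀ := π / 2) (by positivity)
      (by linarith [Real.pi_pos])
    rw [cos_odd_mul_pi_div_two hn.add_one] at h1
    simp only [cos_pi_div_two, mul_zero] at h1
    rw [h1]
    simp
    ring
  · intro x
    rw [Complex.ofReal_neg, wcheb_neg, hn.neg_one_pow, one_mul]

theorem integral_wcheb_of_odd {s : ℂ} {n : ℕ} (hn : Odd n) : ∫ x : ℝ, wcheb s n x = 0 := by
  apply integral_eq_zero_of_odd
  intro x
  rw [Complex.ofReal_neg, wcheb_neg, hn.neg_one_pow, neg_one_mul]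

theorem pairPhase_ofReal_of_lt {x y : ℝ} (h : x < y) : pairPhase x y = 1 := by
  have h' : 0 < y - x := sub_pos.2 h
  have hc : ((y - x : ℝ) : ℂ) ≠ 0 := by exact_mod_cast h'.ne'
  rw [pairPhase, ← Complex.ofReal_sub, Complex.conj_ofReal, Complex.norm_real,
    Real.norm_of_nonneg h'.le, div_self hc]

theorem pairPhase_ofReal_of_gt {x y : ℝ} (h : y < x) : pairPhase x y = -1 := by
  rw [← neg_eq_iff_eq_neg, ← pairPhase_swap, pairPhase_ofReal_of_lt h]

/-- On the line the phase is the sign of `y - x`, so the integral is the mass to the right of `x`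
minus the mass to the left, and these are opposite when the total is zero. -/
theorem integral_pairPhase_mul {g : ℝ → ℂ} (hg : Integrable g) (h0 : ∫ y, g y = 0) (x : ℝ) :
    ∫ y : ℝ, pairPhase x y * g y = 2 * ∫ y in Ioi x, g y := by
  have hi : Integrable fun y : ℝ => pairPhase x y * g y := by
    refine hg.bdd_mul (c := 1) ?_ (Filter.Eventually.of_forall fun y => norm_pairPhase_le _ _)
    exact (measurable_pairPhase.comp
      (measurable_const.prodMk Complex.measurable_ofReal)).aestronglyMeasurable
  rw [← intervalIntegral.integral_Iic_add_Ioi (b := x) hi.integrableOn hi.integrableOn,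
    integral_Iic_eq_integral_Iio,
    setIntegral_congr_fun (g := fun y => -g y) measurableSet_Iio
      (fun y hy => by simp only [pairPhase_ofReal_of_gt hy]; ring),
    setIntegral_congr_fun (s := Ioi x) (g := g) measurableSet_Ioi
      (fun y hy => by simp only [pairPhase_ofReal_of_lt hy]; ring),
    integral_neg, ← integral_Iic_eq_integral_Iio]
  have h1 := intervalIntegral.integral_Iic_add_Ioi (b := x) hg.integrableOn hg.integrableOn
  rw [h0] at h1
  linear_combination -h1

theorem integrable_pairPhase_mul_wcheb {s : ℂ} {m n : ℕ} (hm : (m : ℝ) + 1 < s.re)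
    (hn : (n : ℝ) + 1 < s.re) :
    Integrable fun p : ℝ × ℝ => pairPhase p.1 p.2 * (wcheb s m p.1 * wcheb s n p.2) := by
  refine Integrable.bdd_mul (c := 1) ?_ ?_
    (Filter.Eventually.of_forall fun y => norm_pairPhase_le _ _)
  · exact (integrable_wcheb_real hm).mul_prod (integrable_wcheb_real hn)
  · exact (measurable_pairPhase.comp
      ((Complex.measurable_ofReal.comp measurable_fst).prodMk
        (Complex.measurable_ofReal.comp measurable_snd))).aestronglyMeasurable

theorem integral_sin_mul_cos_Ioo {j k : ℕ} (hj : Odd j) (hk : Even k) :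
    ∫ θ in Ioo 0 (π / 2), sin (j * θ) * cos (k * θ) = j / ((j : ℝ) ^ 2 - (k : ℝ) ^ 2) := by
  have hpi := Real.pi_pos
  have hjk : (j : ℝ) - k ≠ 0 := by
    intro h
    have : j = k := by exact_mod_cast sub_eq_zero.1 h
    exact (Nat.not_even_iff_odd.2 hj) (this ▸ hk)
  have hjk' : (j : ℝ) + k ≠ 0 := by
    have : 0 < j := hj.pos
    positivity
  have e : ∀ θ : ℝ, sin (j * θ) * cos (k * θ) =
      (1 / 2) * (sin ((j + k) * θ) + sin ((j - k) * θ)) := by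
    intro θ
    rw [add_mul, sub_mul, sin_add, sin_sub]
    ring
  have hi : ∀ a : ℝ, IntegrableOn (fun θ : ℝ => sin (a * θ)) (Ioo 0 (π / 2)) := by
    intro a
    have hc : Continuous fun θ : ℝ => sin (a * θ) := by fun_prop
    exact (hc.integrableOn_Icc (a := 0) (b := π / 2)).mono_set Ioo_subset_Icc_self
  simp_rw [e]
  rw [integral_const_mul, integral_add (hi _) (hi _), integral_sin_mul_Ioo hjk' (by positivity),
    integral_sin_mul_Ioo hjk (by positivity)]
  have c1 : cos ((j + k) * (π / 2)) = 0 := by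
    have := cos_odd_mul_pi_div_two (hj.add_even hk)
    push_cast at this
    exact this
  have c2 : cos ((j - k) * (π / 2)) = 0 := by
    have h1 := cos_odd_mul_pi_div_two hj
    obtain ⟨i, rfl⟩ := hk
    have h2 : sin (((i + i : ℕ) : ℝ) * (π / 2)) = 0 := by
      rw [show ((i + i : ℕ) : ℝ) * (π / 2) = i * π by push_cast; ring, Real.sin_nat_mul_pi]
    rw [sub_mul, cos_sub, h1, h2]
    ring
  rw [c1, c2, show (j : ℝ) ^ 2 - (k : ℝ) ^ 2 = (j + k) * (j - k) by ring]
  field_simp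
  ring

/-- Since `n` is odd, the `y`-integral is twice the tail `H x`, an even function. Since `m` is even,
the `x`-integral is twice the one over the positive half-line, whence the factor `4`. The cut at `2`
separates an arc, with trigonometric integrals, from a tail, with powers of `r`. -/
theorem integral_pairPhase_line {s : ℂ} {m n : ℕ} (hm : (m : ℝ) + 1 < s.re)
    (hn : (n : ℝ) + 1 < s.re) (hme : Even m) (hno : Odd n) {j k : ℂ} (hj : j = m + 1)
    (hk : k = n + 1) :
    ∫ p : ℝ × ℝ, pairPhase p.1 p.2 * (wcheb s m p.1 * wcheb s n p.2) =
      4 * (2 * (2 * s ^ 2 / (k * (s ^ 2 - k ^ 2))) / j - 4 / k * (j / (j ^ 2 - k ^ 2)) +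
        ((1 / (2 * s - (j + k)) - 1 / (2 * s - (k - j))) / (s - k) -
        (1 / (2 * s - (j - k)) - 1 / (2 * s + (j + k))) / (s + k))) := by
  have hpi := Real.pi_pos
  have hm0 : (0 : ℝ) ≤ m := Nat.cast_nonneg _
  have hn0 : (0 : ℝ) ≤ n := Nat.cast_nonneg _
  have hfi := integrable_wcheb_real hm
  have hgi := integrable_wcheb_real hn
  have h_int := integrable_pairPhase_mul_wcheb hm hn
  set H : ℝ → ℂ := fun x => ∫ y in Ioi x, wcheb s n y with hH
  have hinner : ∀ x : ℝ, ∫ y : ℝ, pairPhase x y * (wcheb s m x * wcheb s n y) =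
      2 * (wcheb s m x * H x) := by
    intro x
    have h1 := integral_pairPhase_mul hgi (integral_wcheb_of_odd hno) x
    simp_rw [mul_left_comm _ (wcheb s m x)]
    rw [integral_const_mul, h1]
  have hfH : Integrable fun x : ℝ => wcheb s m x * H x := by
    have h1 := h_int.integral_prod_left
    simp only [hinner] at h1
    have h2 := h1.const_mul (1 / 2)
    refine h2.congr (Filter.Eventually.of_forall fun x => ?_)
    simp only
    ring
  have hHeven : ∀ x, H (-x) = H x := by
    intro x
    have h1 := integral_comp_neg_Iic x (fun y : ℝ => wcheb s n y)
    have h2 := intervalIntegral.integral_Iic_add_Ioi (b := x) hgi.integrableOn hgi.integrableOn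
    rw [integral_wcheb_of_odd hno] at h2
    simp only [Complex.ofReal_neg, wcheb_neg, hno.neg_one_pow, neg_one_mul, integral_neg] at h1
    simp only [hH]
    rw [← h1]
    linear_combination -h2
  rw [Measure.volume_eq_prod, integral_prod _ h_int]
  simp only [hinner]
  rw [integral_const_mul, integral_eq_two_mul_of_even hfH (fun x => by
    rw [Complex.ofReal_neg, wcheb_neg, hme.neg_one_pow, one_mul, hHeven]),
    ← Ioc_union_Ioi_eq_Ioi (zero_le_two : (0 : ℝ) ≤ 2),
    setIntegral_union (Ioc_disjoint_Ioi le_rfl) measurableSet_Ioi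
    hfH.integrableOn hfH.integrableOn, integral_Ioc_eq_integral_Ioo]
  have harc : ∫ x in Ioo (0 : ℝ) 2, wcheb s m x * H x =
      2 * (2 * s ^ 2 / (k * (s ^ 2 - k ^ 2))) / j - 4 / k * (j / (j ^ 2 - k ^ 2)) := by
    have h1 := setIntegral_Ioo_two_cos (θ₀ := π / 2) (by positivity) (by linarith) s m H
    simp only [cos_pi_div_two, mul_zero] at h1
    rw [h1]
    have h2 : ∀ θ ∈ Ioo (0 : ℝ) (π / 2), 2 * (sin ((m + 1 : ℕ) * θ) : ℂ) * H (2 * cos θ) =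
        (2 * (2 * s ^ 2 / (k * (s ^ 2 - k ^ 2)))) * (sin ((m + 1 : ℕ) * θ) : ℂ) -
          4 / k * ((sin ((m + 1 : ℕ) * θ) * cos ((n + 1 : ℕ) * θ) : ℝ) : ℂ) := by
      intro θ hθ
      simp only [hH]
      rw [integral_wcheb_Ioi_two_cos hn hθ.1.le (by linarith [hθ.2]), ← hk]
      push_cast
      ring
    have hi : ∀ f : ℝ → ℝ, Continuous f →
        IntegrableOn (fun θ : ℝ => (f θ : ℂ)) (Ioo 0 (π / 2)) := by
      intro f hf
      exact ((Complex.continuous_ofReal.comp hf).integrableOn_Icc (a := 0) (b := π / 2)).mono_set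
        Ioo_subset_Icc_self
    have hj0 : ((m + 1 : ℕ) : ℝ) ≠ 0 := by positivity
    rw [setIntegral_congr_fun measurableSet_Ioo h2, integral_sub
      ((hi (fun θ => sin ((m + 1 : ℕ) * θ)) (by fun_prop)).const_mul _)
      ((hi (fun θ => sin ((m + 1 : ℕ) * θ) * cos ((n + 1 : ℕ) * θ)) (by fun_prop)).const_mul _),
      integral_const_mul, integral_const_mul, integral_complex_ofReal, integral_complex_ofReal,
      integral_sin_mul_Ioo hj0 (by positivity), integral_sin_mul_cos_Ioo hme.add_one hno.add_one,
      cos_odd_mul_pi_div_two hme.add_one]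
    rw [hj, hk]
    push_cast
    ring
  have htail : ∫ x in Ioi (2 : ℝ), wcheb s m x * H x =
      (1 / (2 * s - (j + k)) - 1 / (2 * s - (k - j))) / (s - k) -
        (1 / (2 * s - (j - k)) - 1 / (2 * s + (j + k))) / (s + k) := by
    have h1 := setIntegral_Ioi_add_inv le_rfl s m H
    rw [show (1 : ℝ) + 1⁻¹ = 2 by norm_num] at h1
    rw [h1]
    have hpw : ∀ r : ℝ, 0 < r → ∀ a b : ℤ, (r : ℂ) ^ (-s - 1 + (a : ℂ)) * (r : ℂ) ^ (-s + (b : ℂ))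
        = (r : ℂ) ^ (-(2 * s) - 1 + ((a + b : ℤ) : ℂ)) := by
      intro r hr a b
      have hrc : (r : ℂ) ≠ 0 := by exact_mod_cast hr.ne'
      rw [← Complex.cpow_add _ _ hrc]
      congr 1
      push_cast
      ring
    have h2 : ∀ r ∈ Ioi (1 : ℝ), ((r : ℂ) ^ (-s - 1 + ((m + 1 : ℤ) : ℂ)) -
        (r : ℂ) ^ (-s - 1 + ((-(m + 1) : ℤ) : ℂ))) * H (r + r⁻¹) =
        (1 / (s - k)) * ((r : ℂ) ^ (-(2 * s) - 1 + (((m + 1) + (n + 1) : ℤ) : ℂ)) -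
          (r : ℂ) ^ (-(2 * s) - 1 + ((-(m + 1) + (n + 1) : ℤ) : ℂ))) -
        (1 / (s + k)) * ((r : ℂ) ^ (-(2 * s) - 1 + (((m + 1) + -(n + 1) : ℤ) : ℂ)) -
          (r : ℂ) ^ (-(2 * s) - 1 + ((-(m + 1) + -(n + 1) : ℤ) : ℂ))) := by
      intro r hr
      have hr1 : (1 : ℝ) < r := hr
      have hr0 : (0 : ℝ) < r := one_pos.trans hr1
      simp only [hH]
      rw [integral_tail_wcheb hn hr1.le, ← hk, ← hpw r hr0, ← hpw r hr0, ← hpw r hr0, ← hpw r hr0]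
      ring
    have hre : (2 * s).re = 2 * s.re := by simp
    have b1 : (((m + 1) + (n + 1) : ℤ) : ℝ) < (2 * s).re := by rw [hre]; push_cast; linarith
    have b2 : ((-(m + 1) + (n + 1) : ℤ) : ℝ) < (2 * s).re := by rw [hre]; push_cast; linarith
    have b3 : (((m + 1) + -(n + 1) : ℤ) : ℝ) < (2 * s).re := by rw [hre]; push_cast; linarith
    have b4 : ((-(m + 1) + -(n + 1) : ℤ) : ℝ) < (2 * s).re := by rw [hre]; push_cast; linarith
    obtain ⟨i1, v1⟩ := integral_Ioi_one_cpow_sub b1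
    obtain ⟨i2, v2⟩ := integral_Ioi_one_cpow_sub b2
    obtain ⟨i3, v3⟩ := integral_Ioi_one_cpow_sub b3
    obtain ⟨i4, v4⟩ := integral_Ioi_one_cpow_sub b4
    have i12 : IntegrableOn (fun r : ℝ => (r : ℂ) ^ (-(2 * s) - 1 + (((m + 1) + (n + 1) : ℤ) : ℂ)) -
          (r : ℂ) ^ (-(2 * s) - 1 + ((-(m + 1) + (n + 1) : ℤ) : ℂ))) (Ioi 1) := i1.sub i2
    have i34 : IntegrableOn (fun r : ℝ => (r : ℂ) ^ (-(2 * s) - 1 + (((m + 1) + -(n + 1) : ℤ) : ℂ)) -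
          (r : ℂ) ^ (-(2 * s) - 1 + ((-(m + 1) + -(n + 1) : ℤ) : ℂ))) (Ioi 1) := i3.sub i4
    rw [setIntegral_congr_fun measurableSet_Ioi h2, integral_sub (i12.const_mul _)
      (i34.const_mul _), integral_const_mul, integral_const_mul, integral_sub i1 i2,
      integral_sub i3 i4, v1, v2, v3, v4, hj, hk]
    push_cast
    ring
  rw [harc, htail]
  ring

theorem integral_pairPhase_line_swap (s : ℂ) (m n : ℕ) :
    ∫ p : ℝ × ℝ, pairPhase p.1 p.2 * (wcheb s n p.1 * wcheb s m p.2) =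
      -∫ p : ℝ × ℝ, pairPhase p.1 p.2 * (wcheb s m p.1 * wcheb s n p.2) := by
  rw [Measure.volume_eq_prod, ← integral_prod_swap, ← integral_neg]
  refine integral_congr_ae (Filter.Eventually.of_forall fun p => ?_)
  simp only [Prod.fst_swap, Prod.snd_swap]
  rw [pairPhase_swap]
  ring

/-- Replacing `p` by `-p` reverses the phase and multiplies the weights by `(-1) ^ (m + n) = 1`. -/
theorem integral_pairPhase_line_of_even {s : ℂ} {m n : ℕ} (h : Even (m + n)) :
    ∫ p : ℝ × ℝ, pairPhase p.1 p.2 * (wcheb s m p.1 * wcheb s n p.2) = 0 := by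
  have h1 := integral_neg_eq_self (fun p : ℝ × ℝ =>
    pairPhase p.1 p.2 * (wcheb s m p.1 * wcheb s n p.2)) volume
  have h2 : ∀ p : ℝ × ℝ, pairPhase ((-p).1 : ℝ) ((-p).2 : ℝ) *
      (wcheb s m ((-p).1 : ℝ) * wcheb s n ((-p).2 : ℝ)) =
      -(pairPhase p.1 p.2 * (wcheb s m p.1 * wcheb s n p.2)) := by
    intro p
    have e1 : pairPhase ((-p).1 : ℝ) ((-p).2 : ℝ) = -pairPhase p.1 p.2 := by
      rw [← pairPhase_swap, pairPhase, pairPhase]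
      simp only [Prod.fst_neg, Prod.snd_neg, Complex.ofReal_neg]
      rw [neg_sub_neg]
    have e2 : ((-1 : ℂ)) ^ m * (-1) ^ n = 1 := by rw [← pow_add, h.neg_one_pow]
    rw [e1]
    simp only [Prod.fst_neg, Prod.snd_neg, Complex.ofReal_neg, wcheb_neg]
    linear_combination (-pairPhase p.1 p.2 * (wcheb s m p.1 * wcheb s n p.2)) * e2
  simp only [h2, integral_neg] at h1
  exact self_eq_neg.1 h1.symm

end Line

/-! ### The skew pairing of Chebyshev polynomials -/

section PairIntegral

/-- The two roots parametrized by `p`: two real numbers, or a pair of complex conjugates. -/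
def pairPt (b : Bool) (p : ℝ × ℝ) : ℂ × ℂ :=
  if b then (p.1 + p.2 * Complex.I, p.1 - p.2 * Complex.I) else (p.1, p.2)

/-- The absolute Jacobian determinant of `pairPt`. -/
def pairWeight (b : Bool) : ℝ := if b then 2 else 1

/-- The contribution of a pair of roots to the signed count. -/
def pairTerm (s : ℂ) (b : Bool) (m n : ℕ) (p : ℝ × ℝ) : ℂ :=
  pairWeight b * (pairPhase (pairPt b p).1 (pairPt b p).2 *
    (wcheb s m (pairPt b p).1 * wcheb s n (pairPt b p).2))

/-- The skew-symmetric pairing of Chebyshev polynomials. -/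
def pairInt (s : ℂ) (m n : ℕ) : ℂ := ∑ b, ∫ p, pairTerm s b m n p

theorem pairTerm_true_eq (s : ℂ) (m n : ℕ) (p : ℝ × ℝ) :
    pairTerm s true m n p = (fun β : ℂ => 2 * (pairPhase β (starRingEnd ℂ β) *
      (wcheb s m β * wcheb s n (starRingEnd ℂ β)))) (Complex.measurableEquivRealProd.symm p) := by
  have h : Complex.measurableEquivRealProd.symm p = p.1 + p.2 * Complex.I := by
    rw [← Complex.mk_eq_add_mul_I]
    rfl
  simp [pairTerm, pairPt, pairWeight, h, sub_eq_add_neg]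

theorem integrable_pairTerm {s : ℂ} {m n : ℕ} (hm : (m : ℝ) + 1 < s.re) (hn : (n : ℝ) + 1 < s.re)
    (b : Bool) : Integrable (pairTerm s b m n) := by
  cases b with
  | false =>
    convert integrable_pairPhase_mul_wcheb hm hn using 1
    ext p
    simp [pairTerm, pairPt, pairWeight]
  | true =>
    have h : pairTerm s true m n = (fun β : ℂ => 2 * (pairPhase β (starRingEnd ℂ β) *
        (wcheb s m β * wcheb s n (starRingEnd ℂ β)))) ∘ Complex.measurableEquivRealProd.symm :=
      funext fun p => pairTerm_true_eq s m n p
    rw [h, (Complex.volume_preserving_equiv_real_prod.symm _).integrable_comp_emb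
      (MeasurableEquiv.measurableEmbedding _)]
    refine Integrable.const_mul (Integrable.bdd_mul (c := 1)
      (integrable_wcheb_mul_wcheb_conj (by linarith)) ?_
      (Filter.Eventually.of_forall fun y => norm_pairPhase_le _ _)) _
    exact (measurable_pairPhase.comp
      (measurable_id.prodMk Complex.continuous_conj.measurable)).aestronglyMeasurable

theorem pairInt_eq_add (s : ℂ) (m n : ℕ) :
    pairInt s m n = 2 * (∫ β, pairPhase β (starRingEnd ℂ β) *
      (wcheb s m β * wcheb s n (starRingEnd ℂ β))) +
      ∫ p : ℝ × ℝ, pairPhase p.1 p.2 * (wcheb s m p.1 * wcheb s n p.2) := by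
  rw [pairInt, Fintype.sum_bool]
  congr 1
  · simp_rw [pairTerm_true_eq]
    rw [(Complex.volume_preserving_equiv_real_prod.symm _).integral_comp'
      (g := fun β : ℂ => 2 * (pairPhase β (starRingEnd ℂ β) *
      (wcheb s m β * wcheb s n (starRingEnd ℂ β)))), integral_const_mul]
  · simp [pairTerm, pairPt, pairWeight]

theorem integral_pairPhase_plane_swap (s : ℂ) (m n : ℕ) :
    ∫ β, pairPhase β (starRingEnd ℂ β) * (wcheb s n β * wcheb s m (starRingEnd ℂ β)) =
      -∫ β, pairPhase β (starRingEnd ℂ β) * (wcheb s m β * wcheb s n (starRingEnd ℂ β)) := by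
  have h := (LinearIsometryEquiv.measurePreserving Complex.conjLIE).integral_comp
    Complex.conjLIE.toHomeomorph.measurableEmbedding
    (fun β => pairPhase β (starRingEnd ℂ β) * (wcheb s n β * wcheb s m (starRingEnd ℂ β)))
  rw [← h, ← integral_neg]
  refine integral_congr_ae (Filter.Eventually.of_forall fun β => ?_)
  simp only [Complex.conjLIE_apply, Complex.conj_conj]
  rw [pairPhase_swap]
  ring

theorem pairInt_swap (s : ℂ) (m n : ℕ) : pairInt s n m = -pairInt s m n := by
  rw [pairInt_eq_add, pairInt_eq_add, integral_pairPhase_plane_swap,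
    integral_pairPhase_line_swap]
  ring

theorem angular_of_even {a : ℤ} (h : Even a) : angular a = 0 := by
  rw [angular, h.neg_one_zpow]
  simp

theorem angular_of_odd {a : ℤ} (h : Odd a) : angular a = -4 / a := by
  rw [angular, h.neg_one_zpow]
  ring

/-- The real part vanishes by the symmetry `p ↦ -p`. In the complex part all four frequencies have
the parity of `m + n`, and `angular` vanishes at even integers. -/
theorem pairInt_of_even {s : ℂ} {m n : ℕ} (hm : (m : ℝ) + 1 < s.re) (hn : (n : ℝ) + 1 < s.re)
    (h : Even (m + n)) : pairInt s m n = 0 := by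
  have h' : Even ((m : ℤ) + n) := by exact_mod_cast h
  rw [pairInt_eq_add, integral_pairPhase_line_of_even h,
    integral_pairPhase_plane (by linarith), angular_of_even, angular_of_even, angular_of_even,
    angular_of_even]
  · simp
  all_goals grind

theorem natCast_sq_ne_of_lt_re {s : ℂ} {k : ℕ} (h : (k : ℝ) < s.re) :
    s - k ≠ 0 ∧ s + k ≠ 0 ∧ s ^ 2 - (k : ℂ) ^ 2 ≠ 0 := by
  have hk : (0 : ℝ) ≤ k := Nat.cast_nonneg k
  have h1 : s - k ≠ 0 := fun h0 => by
    have := congrArg Complex.re h0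
    simp at this
    linarith
  have h2 : s + k ≠ 0 := fun h0 => by
    have := congrArg Complex.re h0
    simp at this
    linarith
  refine ⟨h1, h2, ?_⟩
  rw [sq_sub_sq]
  exact mul_ne_zero h2 h1

/-- Real pairs and conjugate pairs each contribute poles where `2 * s` equals `±j ± k`. They cancel
in the sum, and what is left is a factor in `j`, a factor in `k` and the Cauchy kernel `1 / (k² -
j²)`. -/
theorem pairInt_identity {s j k : ℂ} (hj : j ≠ 0) (hk : k ≠ 0) (hjk : j - k ≠ 0) (hjk' : j + k ≠ 0)
    (h1 : s - k ≠ 0) (h2 : s + k ≠ 0) (h3 : 2 * s - (j + k) ≠ 0) (h4 : 2 * s - (k - j) ≠ 0)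
    (h5 : 2 * s - (j - k) ≠ 0) (h6 : 2 * s + (j + k) ≠ 0) :
    2 * (1 / (2 * s - (j + k)) * (-4 / (j - k)) - 1 / (2 * s - (j - k)) * (-4 / (j + k))
      - 1 / (2 * s - (k - j)) * (-4 / (-(j + k))) + 1 / (2 * s + (j + k)) * (-4 / (k - j))) +
      4 * (2 * (2 * s ^ 2 / (k * (s ^ 2 - k ^ 2))) / j - 4 / k * (j / (j ^ 2 - k ^ 2)) +
        ((1 / (2 * s - (j + k)) - 1 / (2 * s - (k - j))) / (s - k) -
          (1 / (2 * s - (j - k)) - 1 / (2 * s + (j + k))) / (s + k))) =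
      16 * k * s ^ 2 / (j * (k ^ 2 - j ^ 2) * (s ^ 2 - k ^ 2)) := by
  rw [sq_sub_sq s k, sq_sub_sq j k, sq_sub_sq k j, ← neg_sub j k, add_comm k j]
  have h4' : 2 * s - -(j - k) ≠ 0 := by rwa [neg_sub]
  field_simp
  ring

theorem pairInt_of_even_of_odd {s : ℂ} {m n : ℕ} (hm : (m : ℝ) + 1 < s.re)
    (hn : (n : ℝ) + 1 < s.re) (hme : Even m) (hno : Odd n) {j k : ℂ} (hj : j = m + 1)
    (hk : k = n + 1) :
    pairInt s m n = 16 * k * s ^ 2 / (j * (k ^ 2 - j ^ 2) * (s ^ 2 - k ^ 2)) := by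
  have hodd : Odd ((m : ℤ) - n) := by
    have h1 : Even (m : ℤ) := by exact_mod_cast hme
    have h2 : Odd (n : ℤ) := by exact_mod_cast hno
    exact h1.sub_odd h2
  have hm0 : (0 : ℝ) ≤ m := Nat.cast_nonneg m
  have hn0 : (0 : ℝ) ≤ n := Nat.cast_nonneg n
  have aux : ∀ z : ℂ, z.re ≠ 0 → z ≠ 0 := fun z h h0 => h (by rw [h0, Complex.zero_re])
  rw [pairInt_eq_add, integral_pairPhase_line hm hn hme hno hj hk,
    integral_pairPhase_plane (by linarith), angular_of_odd hodd, angular_of_odd (by grind),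
    angular_of_odd (by grind), angular_of_odd (by grind)]
  rw [← pairInt_identity (j := j) (k := k)]
  · rw [hj, hk]
    push_cast
    ring_nf
  · rw [hj]
    exact Nat.cast_add_one_ne_zero m
  · rw [hk]
    exact Nat.cast_add_one_ne_zero n
  · rw [hj, hk]
    have : (m : ℂ) - n ≠ 0 := by
      rw [sub_ne_zero]
      intro h
      have : m = n := by exact_mod_cast h
      subst this
      simp at hodd
    simpa using this
  all_goals
    rw [hk]
    try rw [hj]
    apply aux
    simp
    linarith

end PairIntegral

/-! ### Fibres of the root map and integrability on the coefficient side -/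

section Fibers

variable {ι : Type*} [Fintype ι] {N : ℕ}

theorem roots_rootPoly (r : ι → ℂ) : (rootPoly r).roots = Finset.univ.val.map r := by
  rw [← roots_multiset_prod_X_sub_C (Finset.univ.val.map r), Multiset.map_map]
  rfl

theorem rootPoly_eq_rootPoly_iff {r r₀ : ι → ℂ} (h₀ : Function.Injective r₀) :
    rootPoly r = rootPoly r₀ ↔
      Function.Injective r ∧ ∀ i, r i ∈ Finset.univ.image r₀ := by
  classical
  constructor
  · intro h
    have hm : Finset.univ.val.map r = Finset.univ.val.map r₀ := by
      rw [← roots_rootPoly, h, roots_rootPoly]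
    constructor
    · have hn : (Finset.univ.val.map r).Nodup := by
        rw [hm]
        exact Finset.univ.nodup.map h₀
      intro a b hab
      exact (Multiset.nodup_map_iff_inj_on Finset.univ.nodup).1 hn a (Finset.mem_univ a) b
        (Finset.mem_univ b) hab
    · intro i
      have : r i ∈ Finset.univ.val.map r₀ := by
        rw [← hm]
        exact Multiset.mem_map_of_mem _ (Finset.mem_univ i)
      simpa using this
  · rintro ⟨h, hi⟩
    have hS : Finset.univ.image r = Finset.univ.image r₀ := by
      apply Finset.eq_of_subset_of_card_le
      · intro x hx
        obtain ⟨i, -, rfl⟩ := Finset.mem_image.1 hx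
        exact hi i
      · rw [Finset.card_image_of_injective _ h, Finset.card_image_of_injective _ h₀]
    have : ∀ q : ι → ℂ, Function.Injective q →
        rootPoly q = ∏ x ∈ Finset.univ.image q, (X - C x) := by
      intro q hq
      rw [Finset.prod_image hq.injOn, rootPoly]
    rw [this r h, this r₀ h₀, hS]

/-- Root vectors of a separable polynomial are the injective labellings of its root set. -/
theorem card_rootPoly_eq {r₀ : ι → ℂ} (h₀ : Function.Injective r₀) :
    Nat.card {r : ι → ℂ // rootPoly r = rootPoly r₀} = (Fintype.card ι).factorial := by
  classical
  have e : {r : ι → ℂ // rootPoly r = rootPoly r₀} ≃ (ι ↪ Finset.univ.image r₀) :=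
    { toFun := fun r => ⟨fun i => ⟨r.1 i, ((rootPoly_eq_rootPoly_iff h₀).1 r.2).2 i⟩,
        fun a b hab => ((rootPoly_eq_rootPoly_iff h₀).1 r.2).1 (congrArg Subtype.val hab)⟩
      invFun := fun f => ⟨fun i => (f i).1, (rootPoly_eq_rootPoly_iff h₀).2
        ⟨fun a b hab => f.injective (Subtype.ext hab), fun i => (f i).2⟩⟩
      left_inv := fun r => rfl
      right_inv := fun f => rfl }
  rw [Nat.card_congr e, Nat.card_eq_fintype_card, Fintype.card_embedding_eq, Fintype.card_coe,
    Finset.card_image_of_injective _ h₀, Finset.card_univ, Nat.descFactorial_self]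

theorem prod_linMeasure_cpow (r : ι → ℂ) (s : ℂ) :
    ((reciprocalMahlerMeasure (rootPoly r) : ℝ) : ℂ) ^ s = ∏ i, (linMeasure (r i) : ℂ) ^ s := by
  rw [reciprocalMahlerMeasure_rootPoly]
  generalize (Finset.univ : Finset ι) = t
  classical
  induction t using Finset.induction_on with
  | empty => simp
  | insert a t ha ih =>
    rw [Finset.prod_insert ha, Finset.prod_insert ha, ← ih, Complex.ofReal_mul,
      Complex.mul_cpow_ofReal_nonneg (linMeasure_pos _).le
        (Finset.prod_nonneg fun i _ => (linMeasure_pos _).le)]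

variable [DecidableEq ι]

theorem rootPoly_eq_coeffPoly_rootMap (κ : ι ≃ Fin N) (r : ι → ℂ) :
    coeffPoly κ (rootMap κ r) = rootPoly r :=
  ((rootPoly_eq_coeffPoly_iff κ r _).2 rfl).symm

theorem continuous_det_vand (κ : ι ≃ Fin N) : Continuous fun r : ι → ℂ => (vand κ r).det := by
  apply Continuous.matrix_det
  exact continuous_matrix fun i j => (continuous_apply i).pow _

theorem norm_det_rootMapDeriv (κ : ι ≃ Fin N) (r : ι → ℂ) :
    ‖(rootMapDeriv κ r).det‖ = ‖(vand κ r).det‖ := by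
  rw [det_rootMapDeriv, norm_mul, norm_vandSign, one_mul]

/-- Leibniz expansion of the weighted Vandermonde determinant in Chebyshev polynomials. -/
theorem prod_cpow_mul_det_vand (κ : ι ≃ Fin N) (s : ℂ) (r : ι → ℂ) :
    (∏ i, (linMeasure (r i) : ℂ) ^ (-s)) * (vand κ r).det =
      ∑ σ : Equiv.Perm ι, ((Equiv.Perm.sign σ : ℤ) : ℂ) * ∏ i, wcheb s (κ (σ i)) (r i) := by
  rw [det_vand_eq_det_chebS, ← Matrix.det_mul_column, ← Matrix.det_transpose, Matrix.det_apply']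
  rfl

theorem integrable_of_abs_det {V : Type*} [NormedAddCommGroup V] [NormedSpace ℝ V]
    [FiniteDimensional ℝ V] [MeasurableSpace V] [BorelSpace V] (μ : Measure V)
    [μ.IsAddHaarMeasure] {T : Type*} [Fintype T] {f : T → V → V}
    {f' : T → V → V →L[ℝ] V} (hf' : ∀ t x, HasFDerivAt (f t) (f' t x) x)
    (hdet : ∀ t, Measurable fun x => (f' t x).det) {g : V → ℂ} (hg : Measurable g)
    (hcov : ∀ᵐ y ∂μ, ∃ t x, f t x = y ∧ (f' t x).det ≠ 0)
    (h_int : ∀ t, Integrable (fun x => |(f' t x).det| • g (f t x)) μ) : Integrable g μ := by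
  refine ⟨hg.aestronglyMeasurable, ?_⟩
  rw [hasFiniteIntegral_def]
  refine (lintegral_le_sum_lintegral_abs_det μ hf' hdet (fun y => ‖g y‖ₑ) hg.enorm hcov).trans_lt ?_
  refine ENNReal.sum_lt_top.2 fun t _ => ?_
  have := (h_int t).hasFiniteIntegral
  rw [hasFiniteIntegral_def] at this
  convert this using 3 with x
  rw [enorm_smul, ← Real.enorm_of_nonneg (abs_nonneg _)]

end Fibers

/-! ### The complex moment -/

section ComplexMoment

set_option linter.unusedSectionVars false

variable {ι : Type*} [Fintype ι] [DecidableEq ι] {N : ℕ}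

theorem det_rootMap_restrictScalars (κ : ι ≃ Fin N) (r : ι → ℂ) :
    ((Matrix.toLin' (rootMapDeriv κ r)).toContinuousLinearMap.restrictScalars ℝ).det =
      ‖(vand κ r).det‖ ^ 2 := by
  rw [ContinuousLinearMap.det, ContinuousLinearMap.coe_restrictScalars,
    LinearMap.det_restrictScalars, LinearMap.coe_toContinuousLinearMap, LinearMap.det_toLin',
    Algebra.norm_complex_apply, Complex.normSq_eq_norm_sq, norm_det_rootMapDeriv]

/-- Both `V` and its conjugate, the Vandermonde determinant at the conjugate roots, receive the same
weight with exponent `-s`, because `linMeasure` is invariant under conjugation. The exponent itself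
is never conjugated, so the identity holds for complex `s`. -/
theorem sq_norm_det_vand_mul_cpow (κ : ι ≃ Fin N) (s : ℂ) (r : ι → ℂ) :
    |‖(vand κ r).det‖ ^ 2| • ((reciprocalMahlerMeasure (rootPoly r) : ℝ) : ℂ) ^ (-(2 * s)) =
      ∑ σ : Equiv.Perm ι, ∑ τ : Equiv.Perm ι,
        (((Equiv.Perm.sign σ : ℤ) : ℂ) * ((Equiv.Perm.sign τ : ℤ) : ℂ)) *
          ∏ i, (wcheb s (κ (σ i)) (r i) * wcheb s (κ (τ i)) (starRingEnd ℂ (r i))) := by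
  have h1 := prod_cpow_mul_det_vand κ s r
  have h2 := prod_cpow_mul_det_vand κ s (fun i => starRingEnd ℂ (r i))
  have h3 : (vand κ fun i => starRingEnd ℂ (r i)).det = starRingEnd ℂ (vand κ r).det := by
    rw [RingHom.map_det]
    congr 1
    ext i j
    simp [vand]
  rw [h3] at h2
  simp only [linMeasure_conj] at h2
  have h4 : ∀ i, (linMeasure (r i) : ℂ) ^ (-(2 * s)) =
      (linMeasure (r i) : ℂ) ^ (-s) * (linMeasure (r i) : ℂ) ^ (-s) := by
    intro i
    rw [← Complex.cpow_add _ _ (by exact_mod_cast (linMeasure_pos (r i)).ne')]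
    ring_nf
  rw [prod_linMeasure_cpow, Finset.prod_congr rfl fun i _ => h4 i, Finset.prod_mul_distrib,
    abs_of_nonneg (sq_nonneg _), Complex.real_smul, Complex.ofReal_pow, ← Complex.mul_conj']
  calc _ = ((∏ i, (linMeasure (r i) : ℂ) ^ (-s)) * (vand κ r).det) *
        ((∏ i, (linMeasure (r i) : ℂ) ^ (-s)) * starRingEnd ℂ (vand κ r).det) := by ring
    _ = _ := by
      rw [h1, h2, Finset.sum_mul_sum]
      refine Finset.sum_congr rfl fun σ _ => Finset.sum_congr rfl fun τ _ => ?_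
      rw [Finset.prod_mul_distrib]
      ring

theorem wcheb_pair_condition {s : ℂ} (hs : (N : ℝ) < s.re) (a b : Fin N) :
    ((a : ℕ) : ℝ) + ((b : ℕ) : ℝ) + 2 < 2 * s.re := by
  have ha : ((a : ℕ) : ℝ) + 1 ≤ N := by exact_mod_cast a.2
  have hb : ((b : ℕ) : ℝ) + 1 ≤ N := by exact_mod_cast b.2
  linarith

theorem integrable_prod_wcheb_conj (κ : ι ≃ Fin N) {s : ℂ} (hs : (N : ℝ) < s.re)
    (σ τ : Equiv.Perm ι) : Integrable fun r : ι → ℂ =>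
      ∏ i, (wcheb s (κ (σ i)) (r i) * wcheb s (κ (τ i)) (starRingEnd ℂ (r i))) :=
  Integrable.fintype_prod (f := fun i z => wcheb s (κ (σ i)) z *
    wcheb s (κ (τ i)) (starRingEnd ℂ z)) fun _ =>
    integrable_wcheb_mul_wcheb_conj (wcheb_pair_condition hs _ _)

theorem integral_prod_wcheb_conj (κ : ι ≃ Fin N) {s : ℂ} (hs : (N : ℝ) < s.re)
    (σ τ : Equiv.Perm ι) : ∫ r : ι → ℂ,
      ∏ i, (wcheb s (κ (σ i)) (r i) * wcheb s (κ (τ i)) (starRingEnd ℂ (r i))) =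
      if σ = τ then ∏ i : Fin N, (2 * (Real.pi : ℂ) * (s / (s ^ 2 - (((i : ℕ) + 1 : ℕ) : ℂ) ^ 2)))
      else 0 := by
  rw [integral_fintype_prod_volume_eq_prod (fun i z => wcheb s (κ (σ i)) z *
    wcheb s (κ (τ i)) (starRingEnd ℂ z))]
  have hlt : ∀ a : Fin N, ((a : ℕ) : ℝ) + 1 < s.re := fun a =>
    lt_of_le_of_lt (by exact_mod_cast a.2) hs
  rw [Finset.prod_congr rfl fun i _ => integral_wcheb_mul_wcheb_conj (hlt _) (hlt _)]
  split_ifs with h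
  · subst h
    simp only [if_true]
    exact (σ.trans κ).prod_comp
      (fun i : Fin N => 2 * (Real.pi : ℂ) * (s / (s ^ 2 - (((i : ℕ) + 1 : ℕ) : ℂ) ^ 2)))
  · obtain ⟨i, hi⟩ : ∃ i, σ i ≠ τ i := by
      by_contra! h'
      exact h (Equiv.ext h')
    refine Finset.prod_eq_zero (Finset.mem_univ i) (if_neg fun h' => hi ?_)
    exact κ.injective (Fin.ext h')

theorem ae_exists_rootMap_eq (κ : ι ≃ Fin N) : ∀ᵐ c : ι → ℂ, ∃ r : ι → ℂ,
    rootPoly r = coeffPoly κ c ∧ Function.Injective r := by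
  filter_upwards [ae_injective_of_rootPoly_eq (RingHom.id ℂ) continuous_id κ] with c hc
  obtain ⟨r, hr⟩ := exists_rootPoly_eq_coeffPoly κ c
  exact ⟨r, hr, hc r hr⟩

/-- The complex moment of the reciprocal Mahler measure, for any labelling of the coefficients. -/
theorem integral_complex_reciprocalMahlerMeasure (κ : ι ≃ Fin N) {s : ℂ} (hs : (N : ℝ) < s.re) :
    Integrable (fun c : ι → ℂ => (reciprocalMahlerMeasure (coeffPoly κ c) : ℂ) ^ (-(2 * s))) ∧
    ∫ c : ι → ℂ, (reciprocalMahlerMeasure (coeffPoly κ c) : ℂ) ^ (-(2 * s)) =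
      ∏ i : Fin N, (2 * (Real.pi : ℂ) * (s / (s ^ 2 - (((i : ℕ) + 1 : ℕ) : ℂ) ^ 2))) := by
  set g : (ι → ℂ) → ℂ := fun c => (reciprocalMahlerMeasure (coeffPoly κ c) : ℂ) ^ (-(2 * s))
    with hgdef
  have hg : Measurable g :=
    (Complex.measurable_ofReal.comp (measurable_reciprocalMahlerMeasure_coeffPoly κ)).pow_const _
  -- The area formula is stated for a family of maps; here the family has one member.
  set f : Unit → (ι → ℂ) → (ι → ℂ) := fun _ => rootMap κ
  set f' : Unit → (ι → ℂ) → (ι → ℂ) →L[ℝ] (ι → ℂ) := fun _ r =>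
    (Matrix.toLin' (rootMapDeriv κ r)).toContinuousLinearMap.restrictScalars ℝ
  have hf' : ∀ t x, HasFDerivAt (f t) (f' t x) x := fun _ r =>
    (hasFDerivAt_rootMap κ r).restrictScalars ℝ
  have hdeteq : ∀ t r, (f' t r).det = ‖(vand κ r).det‖ ^ 2 := fun _ r =>
    det_rootMap_restrictScalars κ r
  have hdet : ∀ t, Measurable fun x => (f' t x).det := fun t => by
    simp only [hdeteq]
    exact ((continuous_det_vand κ).norm.pow 2).measurable
  have hae := ae_exists_rootMap_eq κ
  have hterm : ∀ t r, |(f' t r).det| • g (f t r) = ∑ σ : Equiv.Perm ι, ∑ τ : Equiv.Perm ι,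
        (((Equiv.Perm.sign σ : ℤ) : ℂ) * ((Equiv.Perm.sign τ : ℤ) : ℂ)) *
          ∏ i, (wcheb s (κ (σ i)) (r i) * wcheb s (κ (τ i)) (starRingEnd ℂ (r i))) := by
    intro t r
    rw [hdeteq (), ← sq_norm_det_vand_mul_cpow]
    simp only [hgdef, f, rootPoly_eq_coeffPoly_rootMap]
  have h_int : ∀ t, Integrable (fun r => |(f' t r).det| • g (f t r)) := by
    intro t
    simp only [hterm]
    exact integrable_finsetSum _ fun σ _ => integrable_finsetSum _ fun τ _ =>
      (integrable_prod_wcheb_conj κ hs σ τ).const_mul _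
  have hgi : Integrable g := by
    refine integrable_of_abs_det volume hf' hdet hg ?_ h_int
    filter_upwards [hae] with c ⟨r, hr, hinj⟩
    refine ⟨(), r, (rootPoly_eq_coeffPoly_iff κ r c).1 hr, ?_⟩
    rw [hdeteq ()]
    exact pow_ne_zero 2 (norm_ne_zero_iff.2 ((det_vand_ne_zero_iff κ r).2 hinj))
  refine ⟨hgi, ?_⟩
  have harea := sum_integral_abs_det_smul_eq_integral_tsum_fiber volume hf' hdet
    (fun t r => g (f t r)) h_int
  have hfib : ∀ᵐ c : ι → ℂ, ∑' q : {q : Unit × (ι → ℂ) // f q.1 q.2 = c ∧ (f' q.1 q.2).det ≠ 0},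
      g (f q.1.1 q.1.2) = ((Fintype.card ι).factorial : ℂ) * g c := by
    filter_upwards [hae] with c ⟨r₀, hr₀, hinj⟩
    have h1 : ∀ q : {q : Unit × (ι → ℂ) // f q.1 q.2 = c ∧ (f' q.1 q.2).det ≠ 0},
      g (f q.1.1 q.1.2) = g c := fun q => by rw [q.2.1]
    have hkey : ∀ r : ι → ℂ, rootPoly r = rootPoly r₀ ↔ (rootMap κ r = c) := by
      intro r
      rw [hr₀, rootPoly_eq_coeffPoly_iff]
    have e : {q : Unit × (ι → ℂ) // f q.1 q.2 = c ∧ (f' q.1 q.2).det ≠ 0} ≃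
        {r : ι → ℂ // rootPoly r = rootPoly r₀} :=
      { toFun := fun q => ⟨q.1.2, (hkey _).2 q.2.1⟩
        invFun := fun r => ⟨((), r.1), (hkey _).1 r.2, by
          rw [hdeteq ()]
          exact pow_ne_zero 2 (norm_ne_zero_iff.2 ((det_vand_ne_zero_iff κ r.1).2
            ((rootPoly_eq_rootPoly_iff hinj).1 r.2).1))⟩
        left_inv := fun q => rfl
        right_inv := fun r => rfl }
    rw [tsum_congr h1, tsum_const, Nat.card_congr e, card_rootPoly_eq hinj, nsmul_eq_mul]
  rw [integral_congr_ae hfib, integral_const_mul] at harea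
  simp only [Finset.univ_unique, Finset.sum_singleton, hterm] at harea
  rw [integral_finsetSum _ fun σ _ => integrable_finsetSum _ fun τ _ =>
      (integrable_prod_wcheb_conj κ hs σ τ).const_mul _,
    Finset.sum_congr rfl fun σ _ => integral_finsetSum _ fun τ _ =>
      (integrable_prod_wcheb_conj κ hs σ τ).const_mul _] at harea
  simp only [integral_const_mul, integral_prod_wcheb_conj κ hs, mul_ite, mul_zero,
    Finset.sum_ite_eq, Finset.mem_univ, if_true] at harea
  have hsign : ∀ σ : Equiv.Perm ι, ((Equiv.Perm.sign σ : ℤ) : ℂ) * ((Equiv.Perm.sign σ : ℤ) : ℂ)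
      = 1 := by
    intro σ
    rw [← Int.cast_mul, ← Units.val_mul, Int.units_mul_self]
    simp
  simp only [hsign, one_mul, Finset.sum_const, Finset.card_univ, Fintype.card_perm,
    nsmul_eq_mul] at harea
  -- The factorial appears on both sides: as the size of the fibre, and as the number of diagonal
  -- terms `σ = τ`.
  exact (mul_left_cancel₀ (by exact_mod_cast (Nat.factorial_pos _).ne') harea).symm

end ComplexMoment

/-! ### Signed count of fillings by a conjugation-invariant set -/

section SignedCount

open Finset

/-- The phase `z / |z|` of a complex number. -/
def phase (z : ℂ) : ℂ := z / ‖z‖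

theorem phase_zero : phase 0 = 0 := by simp [phase]

theorem phase_conj (z : ℂ) : phase (starRingEnd ℂ z) = starRingEnd ℂ (phase z) := by
  simp [phase]

theorem phase_mul_conj {z : ℂ} (h : z ≠ 0) : phase z * starRingEnd ℂ (phase z) = 1 := by
  have : (‖z‖ : ℂ) ≠ 0 := by simpa using h
  rw [phase, map_div₀, Complex.conj_ofReal, div_mul_div_comm, Complex.mul_conj']
  field_simp

theorem phase_neg (z : ℂ) : phase (-z) = -phase z := by simp [phase, neg_div]

theorem phase_ofReal_pos {x : ℝ} (h : 0 < x) : phase x = 1 := by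
  have : (x : ℂ) ≠ 0 := by exact_mod_cast h.ne'
  rw [phase, Complex.norm_real, Real.norm_of_nonneg h.le, div_self this]

theorem phase_ofReal_neg {x : ℝ} (h : x < 0) : phase x = -1 := by
  have h1 := phase_ofReal_pos (neg_pos.2 h)
  rw [Complex.ofReal_neg, phase_neg] at h1
  exact neg_eq_iff_eq_neg.1 h1

theorem phase_mul_self_of_conj {z : ℂ} (h : z ≠ 0) (hz : starRingEnd ℂ z = z) :
    phase z * phase z = 1 := by
  have h1 := phase_mul_conj h
  rwa [← phase_conj, hz] at h1

theorem pairPhase_mul_phase {x y : ℂ} (h : x ≠ y) : pairPhase x y * phase (y - x) = 1 := by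
  have h1 := phase_mul_conj (sub_ne_zero.2 h.symm)
  rw [mul_comm, ← h1]
  simp [phase, pairPhase]

/-- The term of `x` is `-1` to the number of elements above `x`, so the sum alternates. A new
maximum contributes `1` and flips all other terms. -/
theorem sum_prod_phase_ofReal (A : Finset ℝ) :
    ∑ x ∈ A, ∏ w ∈ A.erase x, phase ((x : ℂ) - w) = if Odd #A then 1 else 0 := by
  induction A using Finset.induction_on_max with
  | empty => simp
  | insert a A hA ih =>
    have ha : a ∉ A := fun h => lt_irrefl _ (hA a h)
    have h1 : ∏ w ∈ (insert a A).erase a, phase ((a : ℂ) - w) = 1 := by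
      rw [erase_insert ha]
      refine prod_eq_one fun w hw => ?_
      rw [← Complex.ofReal_sub, phase_ofReal_pos (sub_pos.2 (hA w hw))]
    have h2 : ∀ x ∈ A, ∏ w ∈ (insert a A).erase x, phase ((x : ℂ) - w) =
        -∏ w ∈ A.erase x, phase ((x : ℂ) - w) := by
      intro x hx
      rw [erase_insert_of_ne (hA x hx).ne', prod_insert (fun h => ha (mem_of_mem_erase h)),
        ← Complex.ofReal_sub, phase_ofReal_neg (sub_neg.2 (hA x hx)), neg_one_mul]
    rw [sum_insert ha, h1, sum_congr rfl h2, sum_neg_distrib, ih, card_insert_of_notMem ha]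
    by_cases h : Odd #A
    · simp [h, Nat.odd_add_one]
    · simp [h, Nat.odd_add_one]

theorem prod_phase_pair_eq_one {S : Finset ℂ} (hS : ∀ x ∈ S, starRingEnd ℂ x ∈ S)
    (f : ℂ → ℂ) (hreal : ∀ x ∈ S, starRingEnd ℂ x = x → f x = 1)
    (hf : ∀ x ∈ S, f x * f (starRingEnd ℂ x) = 1) : ∏ x ∈ S, f x = 1 :=
  prod_involution (fun x _ => starRingEnd ℂ x) hf (fun x hx h h' => h (hreal x hx h'))
    (fun x hx => hS x hx) (fun x _ => Complex.conj_conj x)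

/-- The weight of a pair of slots: it vanishes unless both entries are real or they are complex
conjugates. -/
def slotPair (x y : ℂ) : ℂ :=
  open Classical in
  if (starRingEnd ℂ x = x ∧ starRingEnd ℂ y = y) ∨ y = starRingEnd ℂ x then pairPhase x y else 0

/-- The indicator of a real number. -/
def slotSingle (x : ℂ) : ℂ :=
  open Classical in if starRingEnd ℂ x = x then 1 else 0

variable {S : Finset ℂ}

/-- The factor of a real `w` is the phase of `|w - x|²`, and the factors of `w` and its conjugate
are conjugate to each other; so everything cancels to `1`. -/
theorem prod_phase_conj_pair (hS : ∀ x ∈ S, starRingEnd ℂ x ∈ S) {x : ℂ} :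
    ∏ w ∈ (S.erase x).erase (starRingEnd ℂ x),
      (phase (w - x) * phase (w - starRingEnd ℂ x)) = 1 := by
  have hmem : ∀ w, w ∈ (S.erase x).erase (starRingEnd ℂ x) ↔
      w ≠ starRingEnd ℂ x ∧ w ≠ x ∧ w ∈ S := by simp
  apply prod_phase_pair_eq_one
  · intro w hw
    rw [hmem] at hw ⊢
    refine ⟨fun h => hw.2.1 ?_, fun h => hw.1 ?_, hS w hw.2.2⟩
    · simpa using congrArg (starRingEnd ℂ) h
    · rw [← h, Complex.conj_conj]
  · intro w hw hreal
    rw [hmem] at hw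
    have : phase (w - starRingEnd ℂ x) = starRingEnd ℂ (phase (w - x)) := by
      rw [← phase_conj, map_sub, hreal]
    rw [this, phase_mul_conj (sub_ne_zero.2 hw.2.1)]
  · intro w hw
    rw [hmem] at hw
    have h1 : phase (starRingEnd ℂ w - starRingEnd ℂ x) = starRingEnd ℂ (phase (w - x)) := by
      rw [← phase_conj, map_sub]
    have h2 : phase (starRingEnd ℂ w - x) = starRingEnd ℂ (phase (w - starRingEnd ℂ x)) := by
      rw [← phase_conj, map_sub, Complex.conj_conj]
    rw [h1, h2]
    linear_combination (phase (w - starRingEnd ℂ x) *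
      starRingEnd ℂ (phase (w - starRingEnd ℂ x))) * phase_mul_conj (sub_ne_zero.2 hw.2.1) +
      phase_mul_conj (sub_ne_zero.2 hw.1)

/-- Non-real `w` cancel against their conjugates, so only signs from real points remain. The minus
sign is `phase (x - y) * phase (y - x)`, which the two products on the right contain in addition. -/
theorem prod_phase_real_pair (hS : ∀ x ∈ S, starRingEnd ℂ x ∈ S) {x y : ℂ} (hxS : x ∈ S)
    (hyS : y ∈ S) (hx : starRingEnd ℂ x = x) (hy : starRingEnd ℂ y = y) (hxy : x ≠ y)
    {R : Finset ℂ} (hR : ∀ w, w ∈ R ↔ w ∈ S ∧ starRingEnd ℂ w = w) :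
    ∏ w ∈ (S.erase x).erase y, (phase (w - x) * phase (w - y)) =
      -((∏ w ∈ R.erase x, phase (x - w)) * ∏ w ∈ R.erase y, phase (y - w)) := by
  classical
  rw [← prod_filter_mul_prod_filter_not _ (fun w => starRingEnd ℂ w = w)]
  have h1 : ∏ w ∈ ((S.erase x).erase y).filter (fun w => ¬starRingEnd ℂ w = w),
      (phase (w - x) * phase (w - y)) = 1 := by
    apply prod_phase_pair_eq_one
    · intro w hw
      simp only [mem_filter, mem_erase] at hw ⊢
      refine ⟨⟨fun h => hw.1.1 ?_, fun h => hw.1.2.1 ?_, hS w hw.1.2.2⟩, fun h => hw.2 ?_⟩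
      · rw [← hy, ← h, Complex.conj_conj]
      · rw [← hx, ← h, Complex.conj_conj]
      · simpa using h.symm
    · intro w hw h
      exact absurd h (mem_filter.1 hw).2
    · intro w hw
      simp only [mem_filter, mem_erase] at hw
      have h1 : phase (starRingEnd ℂ w - x) = starRingEnd ℂ (phase (w - x)) := by
        rw [← phase_conj, map_sub, hx]
      have h2 : phase (starRingEnd ℂ w - y) = starRingEnd ℂ (phase (w - y)) := by
        rw [← phase_conj, map_sub, hy]
      rw [h1, h2]
      linear_combination (phase (w - y) * starRingEnd ℂ (phase (w - y))) *
        phase_mul_conj (sub_ne_zero.2 hw.1.2.1) + phase_mul_conj (sub_ne_zero.2 hw.1.1)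
  have h2 : ((S.erase x).erase y).filter (fun w => starRingEnd ℂ w = w) =
      (R.erase x).erase y := by
    ext w
    simp only [mem_filter, mem_erase, hR]
    tauto
  have hyR : y ∈ R.erase x := by simp [hR, hyS, hy, hxy.symm]
  have hxR : x ∈ R.erase y := by simp [hR, hxS, hx, hxy]
  have h3 : phase (x - y) * phase (y - x) = -1 := by
    rw [← neg_sub x y, phase_neg, mul_neg,
      phase_mul_self_of_conj (sub_ne_zero.2 hxy) (by rw [map_sub, hx, hy])]
  rw [h1, h2, mul_one, ← mul_prod_erase _ _ hyR, ← mul_prod_erase _ _ hxR,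
    Finset.erase_right_comm (a := y), prod_mul_distrib]
  have h4 : ∀ z : ℂ, ∏ w ∈ (R.erase x).erase y, phase (z - w) =
      (∏ w ∈ (R.erase x).erase y, (-1)) * ∏ w ∈ (R.erase x).erase y, phase (w - z) := by
    intro z
    rw [← prod_mul_distrib]
    refine prod_congr rfl fun w _ => ?_
    rw [← neg_sub, phase_neg, neg_one_mul]
  have h5 : (∏ w ∈ (R.erase x).erase y, (-1 : ℂ)) * (∏ w ∈ (R.erase x).erase y, (-1)) = 1 := by
    rw [← prod_mul_distrib]
    simp
  rw [h4, h4]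
  linear_combination ((∏ w ∈ (R.erase x).erase y, phase (w - x)) *
    ∏ w ∈ (R.erase x).erase y, phase (w - y)) * (phase (x - y) * phase (y - x) * h5 + h3)

/-- The signed count of the ordered pairs that may fill a pair of slots. -/
theorem sum_slotPair (hS : ∀ x ∈ S, starRingEnd ℂ x ∈ S) :
    ∑ x ∈ S, ∑ y ∈ S, slotPair x y * phase (y - x) *
      ∏ w ∈ (S.erase x).erase y, (phase (w - x) * phase (w - y)) = (2 * (#S / 2) : ℕ) := by
  classical
  set R := S.filter fun w => starRingEnd ℂ w = w with hRdef
  have hR : ∀ w, w ∈ R ↔ w ∈ S ∧ starRingEnd ℂ w = w := fun w => mem_filter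
  set u : ℂ → ℂ := fun x => ∏ w ∈ R.erase x, phase (x - w) with hu
  -- Two distinct real points contribute `-(u x * u y)`, a non-real point with its conjugate
  -- contributes `1`, and every other pair contributes `0`.
  have hterm : ∀ x ∈ S, ∀ y ∈ S, slotPair x y * phase (y - x) *
      ∏ w ∈ (S.erase x).erase y, (phase (w - x) * phase (w - y)) =
      (if x ∈ R then (if y ∈ R then (if x = y then 0 else -(u x * u y)) else 0) else 0) +
      (if x ∈ R then 0 else if y = starRingEnd ℂ x then 1 else 0) := by
    intro x hx y hy
    by_cases hxy : x = y
    · subst hxy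
      have h0 : phase (x - x) = 0 := by rw [sub_self, phase_zero]
      simp only [h0, mul_zero, zero_mul, if_true, ite_self, zero_add]
      by_cases hxr : x ∈ R
      · simp [hxr]
      · have : ¬ x = starRingEnd ℂ x := fun h => hxr ((hR x).2 ⟨hx, h.symm⟩)
        simp [hxr, this]
    by_cases hxr : x ∈ R
    · by_cases hyr : y ∈ R
      · have h1 := (hR x).1 hxr
        have h2 := (hR y).1 hyr
        rw [slotPair, if_pos (Or.inl ⟨h1.2, h2.2⟩), pairPhase_mul_phase hxy,
          prod_phase_real_pair hS hx hy h1.2 h2.2 hxy hR]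
        simp [hxr, hyr, hxy, hu]
      · have h1 := (hR x).1 hxr
        rw [slotPair, if_neg]
        · simp [hxr, hyr]
        · rintro (⟨-, h⟩ | h)
          · exact hyr ((hR y).2 ⟨hy, h⟩)
          · exact hxy (by rw [h, h1.2])
    · have h1 : ¬ starRingEnd ℂ x = x := fun h => hxr ((hR x).2 ⟨hx, h⟩)
      by_cases hyx : y = starRingEnd ℂ x
      · rw [slotPair, if_pos (Or.inr hyx), pairPhase_mul_phase hxy]
        subst hyx
        rw [prod_phase_conj_pair hS]
        simp [hxr]
      · rw [slotPair, if_neg (by tauto)]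
        simp [hxr, hyx]
  rw [sum_congr rfl fun x hx => sum_congr rfl fun y hy => hterm x hx y hy]
  simp only [sum_add_distrib]
  have hu2 : ∀ x ∈ R, u x * u x = 1 := by
    intro x hx
    simp only [hu]
    rw [← prod_mul_distrib]
    refine prod_eq_one fun w hw => phase_mul_self_of_conj ?_ ?_
    · exact sub_ne_zero.2 (ne_of_mem_erase hw).symm
    · rw [map_sub, ((hR x).1 hx).2, ((hR w).1 (mem_of_mem_erase hw)).2]
  have husum : ∑ x ∈ R, u x = if Odd #R then 1 else 0 := by
    set A : Finset ℝ := R.image Complex.re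
    have hRA : R = A.image (fun a : ℝ => (a : ℂ)) := by
      rw [image_image]
      conv_lhs => rw [← image_id (s := R)]
      refine image_congr fun x hx => ?_
      exact (Complex.conj_eq_iff_re.1 ((hR x).1 hx).2).symm
    have hinj : Function.Injective fun a : ℝ => (a : ℂ) := Complex.ofReal_injective
    have hcard : #R = #A := by rw [hRA, card_image_of_injective _ hinj]
    rw [hcard, ← sum_prod_phase_ofReal A]
    conv_lhs => rw [hRA]
    rw [sum_image hinj.injOn]
    refine sum_congr rfl fun x _ => ?_
    simp only [hu]
    rw [hRA, ← image_erase hinj, prod_image hinj.injOn]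
  -- Over distinct real points the sum is `∑ u² - (∑ u)²`; each `u x` is a sign, and `∑ u` is `1` or
  -- `0` according to the parity of `#R`.
  have hfirst : ∑ x ∈ S, ∑ y ∈ S,
      (if x ∈ R then (if y ∈ R then (if x = y then 0 else -(u x * u y)) else 0) else 0) =
      (#R : ℂ) - if Odd #R then 1 else 0 := by
    have hsub : R ⊆ S := filter_subset _ _
    have h1 : ∀ x ∈ S, ∑ y ∈ S,
      (if x ∈ R then (if y ∈ R then (if x = y then 0 else -(u x * u y)) else 0) else 0) =
      if x ∈ R then (1 - u x * ∑ y ∈ R, u y) else 0 := by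
      intro x hx
      by_cases hxr : x ∈ R
      · simp only [hxr, if_true]
        rw [← sum_filter, filter_mem_eq_inter, inter_eq_right.2 hsub]
        have h2 : ∀ y ∈ R, (if x = y then 0 else -(u x * u y)) =
            (if x = y then u x * u y else 0) - u x * u y := by
          intro y _
          split_ifs <;> ring
        rw [sum_congr rfl h2, sum_sub_distrib, sum_ite_eq, if_pos hxr, hu2 x hxr, mul_sum]
      · simp [hxr]
    rw [sum_congr rfl h1, ← sum_filter, filter_mem_eq_inter, inter_eq_right.2 hsub,
      sum_sub_distrib, ← sum_mul, husum]
    split_ifs <;> simp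
  have hnonreal : Even #(S.filter fun w => ¬starRingEnd ℂ w = w) := by
    have h1 : ∏ w ∈ S.filter (fun w => ¬starRingEnd ℂ w = w), (-1 : ℂ) = 1 := by
      apply prod_phase_pair_eq_one (f := fun _ => -1)
      · intro w hw
        simp only [mem_filter] at hw ⊢
        exact ⟨hS w hw.1, fun h => hw.2 (by simpa using h.symm)⟩
      · intro w hw h
        exact absurd h (mem_filter.1 hw).2
      · simp
    rw [prod_const] at h1
    by_contra hodd
    rw [Nat.not_even_iff_odd] at hodd
    rw [hodd.neg_one_pow] at h1
    norm_num at h1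
  have hsecond : ∑ x ∈ S, ∑ y ∈ S,
      (if x ∈ R then (0 : ℂ) else if y = starRingEnd ℂ x then 1 else 0) =
      #(S.filter fun w => ¬starRingEnd ℂ w = w) := by
    rw [card_filter, Nat.cast_sum]
    refine sum_congr rfl fun x hx => ?_
    by_cases hxr : starRingEnd ℂ x = x
    · simp [hR, hxr, hx]
    · simp [hR, hxr, hS x hx]
  rw [hfirst, hsecond]
  have hcard : #R + #(S.filter fun w => ¬starRingEnd ℂ w = w) = #S :=
    card_filter_add_card_filter_not _
  obtain ⟨k, hk⟩ := hnonreal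
  rw [hk] at hcard ⊢
  split_ifs with ho
  · obtain ⟨l, hl⟩ := ho
    have : #S / 2 = l + k := by omega
    rw [this, hl]
    push_cast
    ring
  · obtain ⟨l, hl⟩ := Nat.not_odd_iff_even.1 ho
    have : #S / 2 = l + k := by omega
    rw [this, hl]
    push_cast
    ring

/-- The weight of a filling of `N` slots, grouped into consecutive pairs and possibly a last single
slot. -/
def slotProd : (N : ℕ) → (Fin N → ℂ) → ℂ
  | 0, _ => 1
  | 1, r => slotSingle (r 0)
  | N + 2, r => slotPair (r 0) (r 1) * slotProd N fun i => r i.succ.succ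

/-- The phase of the Vandermonde determinant. -/
def vandPhase {N : ℕ} (r : Fin N → ℂ) : ℂ := ∏ i, ∏ j ∈ Ioi i, phase (r j - r i)

theorem vandPhase_cons {N : ℕ} (x : ℂ) (r : Fin N → ℂ) :
    vandPhase (Fin.cons x r : Fin (N + 1) → ℂ) = (∏ j, phase (r j - x)) * vandPhase r := by
  simp [vandPhase, Fin.prod_univ_succ, Fin.prod_Ioi_succ]

theorem vandPhase_eq_zero {N : ℕ} {r : Fin N → ℂ} (h : ¬Function.Injective r) :
    vandPhase r = 0 := by
  obtain ⟨i, j, hij, hne⟩ : ∃ i j, r i = r j ∧ i < j := by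
    simp only [Function.Injective] at h
    push Not at h
    obtain ⟨i, j, hij, hne⟩ := h
    rcases lt_or_gt_of_ne hne with h | h
    · exact ⟨i, j, hij, h⟩
    · exact ⟨j, i, hij.symm, h⟩
  refine prod_eq_zero (mem_univ i) (prod_eq_zero (mem_Ioi.2 hne) ?_)
  rw [hij, sub_self, phase_zero]

theorem sum_piFinset_succ {N : ℕ} (S : Finset ℂ) (f : (Fin (N + 1) → ℂ) → ℂ) :
    ∑ r ∈ Fintype.piFinset fun _ : Fin (N + 1) => S, f r =
      ∑ x ∈ S, ∑ r ∈ Fintype.piFinset fun _ : Fin N => S, f (Fin.cons x r) := by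
  rw [← sum_product']
  refine sum_nbij' (fun r => (r 0, Fin.tail r)) (fun p => Fin.cons p.1 p.2) ?_ ?_ ?_ ?_ ?_
  · intro r hr
    rw [Fintype.mem_piFinset] at hr
    simp only [mem_product, Fintype.mem_piFinset]
    exact ⟨hr 0, fun i => hr i.succ⟩
  · intro p hp
    simp only [mem_product, Fintype.mem_piFinset] at hp
    rw [Fintype.mem_piFinset]
    intro i
    refine Fin.cases ?_ (fun j => ?_) i
    · simpa using hp.1
    · simpa using hp.2 j
  · intro r _
    exact Fin.cons_self_tail r
  · intro p _
    simp
  · intro r _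
    simp [Fin.cons_self_tail]

/-- The signed count of the fillings of the slots by a conjugation-invariant set. -/
theorem sum_slotProd_mul_vandPhase (N : ℕ) (S : Finset ℂ) (hS : ∀ x ∈ S, starRingEnd ℂ x ∈ S)
    (hcard : #S = N) :
    ∑ r ∈ Fintype.piFinset fun _ : Fin N => S, slotProd N r * vandPhase r =
      (2 ^ (N / 2) * (N / 2).factorial : ℕ) := by
  induction N using Nat.twoStepInduction generalizing S with
  | zero => simp [slotProd, vandPhase]
  | one =>
    obtain ⟨x, rfl⟩ := card_eq_one.1 hcard
    have hx : starRingEnd ℂ x = x := by simpa using hS x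
    have hx' : slotSingle x = 1 := if_pos hx
    rw [sum_piFinset_succ]
    simp [slotProd, vandPhase, hx']
  | more N ih _ =>
    -- With `x` and `y` in the first pair of slots, the phase of the Vandermonde determinant kills
    -- every filling that reuses a point, so the remaining slots are filled by `S` without `x` and
    -- `y`, to which the induction hypothesis applies.
    have hterm : ∀ x ∈ S, ∀ y ∈ S,
        ∑ r ∈ Fintype.piFinset fun _ : Fin N => S,
          slotProd (N + 2) (Fin.cons x (Fin.cons y r : Fin (N + 1) → ℂ)) *
            vandPhase (Fin.cons x (Fin.cons y r : Fin (N + 1) → ℂ) : Fin (N + 2) → ℂ) =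
        (slotPair x y * phase (y - x) *
          ∏ w ∈ (S.erase x).erase y, (phase (w - x) * phase (w - y))) *
          (2 ^ (N / 2) * (N / 2).factorial : ℕ) := by
      intro x hx y hy
      have hexp : ∀ r : Fin N → ℂ,
          slotProd (N + 2) (Fin.cons x (Fin.cons y r : Fin (N + 1) → ℂ)) *
            vandPhase (Fin.cons x (Fin.cons y r : Fin (N + 1) → ℂ) : Fin (N + 2) → ℂ) =
          (slotPair x y * phase (y - x)) *
            ((∏ k, (phase (r k - x) * phase (r k - y))) * (slotProd N r * vandPhase r)) := by
        intro r
        rw [vandPhase_cons, vandPhase_cons, Fin.prod_univ_succ, prod_mul_distrib]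
        simp only [slotProd, Fin.cons_zero, Fin.cons_succ]
        have : (Fin.cons x (Fin.cons y r : Fin (N + 1) → ℂ) : Fin (N + 2) → ℂ) 1 = y := rfl
        rw [this]
        ring
      rw [sum_congr rfl fun r _ => hexp r, ← mul_sum, mul_assoc (slotPair x y * phase (y - x))]
      by_cases hxy : x = y
      · simp [hxy, phase_zero]
      -- Admissibility of the pair is what makes the remaining set closed under conjugation; for
      -- other pairs both sides vanish.
      by_cases hadm : (starRingEnd ℂ x = x ∧ starRingEnd ℂ y = y) ∨ y = starRingEnd ℂ x
      swap
      · simp [slotPair, hadm]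
      congr 1
      set T := (S.erase x).erase y with hT
      have hTmem : ∀ w, w ∈ T ↔ w ≠ y ∧ w ≠ x ∧ w ∈ S := by simp [hT]
      have hTc : ∀ w ∈ T, starRingEnd ℂ w ∈ T := by
        intro w hw
        rw [hTmem] at hw ⊢
        have hcc : ∀ a b : ℂ, starRingEnd ℂ a = b → a = starRingEnd ℂ b := fun a b h => by
          rw [← h, Complex.conj_conj]
        rcases hadm with ⟨h1, h2⟩ | h
        · exact ⟨fun h => hw.1 (by rw [hcc w y h, h2]), fun h => hw.2.1 (by rw [hcc w x h, h1]),
            hS w hw.2.2⟩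
        · exact ⟨fun h' => hw.2.1 (by rw [hcc w y h', h, Complex.conj_conj]),
            fun h' => hw.1 (by rw [hcc w x h', h]), hS w hw.2.2⟩
      have hTcard : #T = N := by
        rw [hT, card_erase_of_mem (mem_erase.2 ⟨fun h => hxy h.symm, hy⟩),
          card_erase_of_mem hx, hcard]
        rfl
      rw [← ih T hTc hTcard, mul_sum]
      symm
      have hsub : (Fintype.piFinset fun _ : Fin N => T) ⊆ Fintype.piFinset fun _ : Fin N => S :=
        Fintype.piFinset_subset _ _ fun _ w hw => ((hTmem w).1 hw).2.2
      rw [← sum_subset hsub]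
      · refine sum_congr rfl fun r hr => ?_
        by_cases hinj : Function.Injective r
        · have himg : univ.image r = T := by
            apply eq_of_subset_of_card_le
            · intro w hw
              obtain ⟨i, -, rfl⟩ := mem_image.1 hw
              exact Fintype.mem_piFinset.1 hr i
            · rw [card_image_of_injective _ hinj, hTcard]
              simp
          rw [← himg, prod_image hinj.injOn]
        · rw [vandPhase_eq_zero hinj]
          ring
      · intro r hr hrT
        obtain ⟨k, hk⟩ : ∃ k, r k ∉ T := by
          by_contra! h
          exact hrT (Fintype.mem_piFinset.2 h)
        have hrk := Fintype.mem_piFinset.1 hr k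
        rw [prod_eq_zero (mem_univ k), zero_mul]
        by_cases h1 : r k = y
        · rw [h1, sub_self, phase_zero, mul_zero]
        · have h2 : r k = x := by
            by_contra h2
            exact hk ((hTmem _).2 ⟨h1, h2, hrk⟩)
          rw [h2, sub_self, phase_zero, zero_mul]
    rw [sum_piFinset_succ, sum_congr rfl fun x _ => sum_piFinset_succ S _,
      sum_congr rfl fun x hx => sum_congr rfl fun y hy => hterm x hx y hy]
    simp only [← sum_mul]
    rw [sum_slotPair hS, hcard, ← Nat.cast_mul]
    have : (N + 2) / 2 = N / 2 + 1 := by omega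
    rw [this, Nat.factorial_succ]
    congr 1
    ring

end SignedCount

/-! ### Parametrization of real polynomials by pairs of roots -/

section Slots

/-- Labels of the roots: first entries of `M` pairs, `e` single roots, second entries of the
pairs. -/
abbrev Slots (M e : ℕ) : Type := (Fin M ⊕ Fin e) ⊕ Fin M

variable {M e : ℕ}

/-- The position of a slot in the ordering which lists the pairs first. -/
def slotIndex : Slots M e → Fin (2 * M + e)
  | Sum.inl (Sum.inl m) => ⟨2 * m, by omega⟩
  | Sum.inl (Sum.inr k) => ⟨2 * M + k, by omega⟩
  | Sum.inr m => ⟨2 * m + 1, by omega⟩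

theorem slotIndex_injective : Function.Injective (slotIndex (M := M) (e := e)) := by
  rintro ((⟨a, ha⟩ | ⟨a, ha⟩) | ⟨a, ha⟩) ((⟨b, hb⟩ | ⟨b, hb⟩) | ⟨b, hb⟩) h <;>
    simp only [slotIndex, Fin.mk.injEq] at h <;> first | (exfalso; omega) | skip
  all_goals
    have : a = b := by omega
    subst this
    rfl

/-- `slotIndex` as an equivalence. -/
def slotEquiv (M e : ℕ) : Slots M e ≃ Fin (2 * M + e) :=
  Equiv.ofBijective slotIndex ((Fintype.bijective_iff_injective_and_card _).2
    ⟨slotIndex_injective, by simp; ring⟩)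

theorem slotEquiv_apply (i : Slots M e) : slotEquiv M e i = slotIndex i := rfl

/-- The matrix expressing the roots through their real parameters; the pairs `m` with `t m` are
complex conjugates. -/
def slotMatrix (e : ℕ) (t : Fin M → Bool) : Matrix (Slots M e) (Slots M e) ℂ :=
  Matrix.fromBlocks 1
    (Matrix.of fun i m => if i = Sum.inl m ∧ t m then Complex.I else 0 :
      Matrix (Fin M ⊕ Fin e) (Fin M) ℂ)
    (Matrix.of fun m i => if i = Sum.inl m ∧ t m then 1 else 0 :
      Matrix (Fin M) (Fin M ⊕ Fin e) ℂ)
    (Matrix.diagonal fun m => if t m then -Complex.I else 1)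

/-- The roots with given real parameters. -/
def slotRoots (t : Fin M → Bool) (z : Slots M e → ℝ) : Slots M e → ℂ :=
  (slotMatrix e t).mulVec fun i => (z i : ℂ)

theorem slotRoots_first (t : Fin M → Bool) (z : Slots M e → ℝ) (m : Fin M) :
    slotRoots t z (Sum.inl (Sum.inl m)) =
      (pairPt (t m) (z (Sum.inl (Sum.inl m)), z (Sum.inr m))).1 := by
  simp only [slotRoots, slotMatrix, Matrix.mulVec, dotProduct, Fintype.sum_sum_type,
    Matrix.fromBlocks_apply₁₁, Matrix.fromBlocks_apply₁₂, Matrix.one_apply, Matrix.of_apply,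
    Sum.inl.injEq, zero_mul, ite_mul, one_mul, ite_and, Finset.sum_ite_eq, Finset.mem_univ,
    if_true, pairPt]
  cases t m <;> simp [mul_comm]

theorem slotRoots_second (t : Fin M → Bool) (z : Slots M e → ℝ) (m : Fin M) :
    slotRoots t z (Sum.inr m) =
      (pairPt (t m) (z (Sum.inl (Sum.inl m)), z (Sum.inr m))).2 := by
  simp only [slotRoots, slotMatrix, Matrix.mulVec, dotProduct, Fintype.sum_sum_type,
    Matrix.fromBlocks_apply₂₁, Matrix.fromBlocks_apply₂₂, Matrix.of_apply, Matrix.diagonal_apply,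
    zero_mul, ite_mul, one_mul, ite_and, Finset.sum_ite_eq, Finset.sum_ite_eq', Finset.mem_univ,
    if_true, pairPt]
  cases t m <;> simp [mul_comm, sub_eq_add_neg]

theorem slotRoots_single (t : Fin M → Bool) (z : Slots M e → ℝ) (k : Fin e) :
    slotRoots t z (Sum.inl (Sum.inr k)) = z (Sum.inl (Sum.inr k)) := by
  simp [slotRoots, slotMatrix, Matrix.mulVec, dotProduct, Fintype.sum_sum_type, Matrix.one_apply]

/-- The upper left block is the identity, so the determinant is that of the Schur complement, which
is diagonal with entry `-2i` for each conjugate pair. -/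
theorem norm_det_slotMatrix (t : Fin M → Bool) :
    ‖(slotMatrix e t).det‖ = ∏ m, pairWeight (t m) := by
  have h : (Matrix.diagonal fun m => if t m then -Complex.I else 1) -
      (Matrix.of fun m i => if i = Sum.inl m ∧ t m then 1 else 0 :
        Matrix (Fin M) (Fin M ⊕ Fin e) ℂ) *
      (Matrix.of fun i m => if i = Sum.inl m ∧ t m then Complex.I else 0 :
        Matrix (Fin M ⊕ Fin e) (Fin M) ℂ) =
      Matrix.diagonal fun m => if t m then -(2 * Complex.I) else 1 := by
    ext m m'
    simp only [Matrix.sub_apply, Matrix.mul_apply, Matrix.of_apply, Sum.inl.injEq, zero_mul,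
      Matrix.diagonal_apply, ite_mul, one_mul, ite_and, Finset.sum_ite_eq', Finset.mem_univ,
      if_true]
    by_cases hm : m = m'
    · subst hm
      cases t m
      · simp
      · simp
        ring
    · simp [hm]
  rw [slotMatrix, Matrix.det_fromBlocks_one₁₁, h, Matrix.det_diagonal, norm_prod]
  refine Finset.prod_congr rfl fun m _ => ?_
  rw [pairWeight]
  split_ifs <;> simp

theorem conj_pairPt (b : Bool) (p : ℝ × ℝ) :
    ((X - C (starRingEnd ℂ (pairPt b p).1)) * (X - C (starRingEnd ℂ (pairPt b p).2)) : ℂ[X]) =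
      (X - C (pairPt b p).1) * (X - C (pairPt b p).2) := by
  cases b
  · simp [pairPt]
  · simp only [pairPt, if_true, map_add, map_sub, map_mul, Complex.conj_ofReal, Complex.conj_I,
      map_neg]
    ring

theorem rootPoly_slotRoots (t : Fin M → Bool) (z : Slots M e → ℝ) :
    rootPoly (slotRoots t z) =
      (∏ m, ((X - C (slotRoots t z (Sum.inl (Sum.inl m)))) * (X - C (slotRoots t z (Sum.inr m))))) *
        ∏ k, (X - C (slotRoots t z (Sum.inl (Sum.inr k)))) := by
  rw [rootPoly, Fintype.prod_sum_type, Fintype.prod_sum_type, Finset.prod_mul_distrib]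
  ring

theorem map_conj_rootPoly_slotRoots (t : Fin M → Bool) (z : Slots M e → ℝ) :
    (rootPoly (slotRoots t z)).map (starRingEnd ℂ) = rootPoly (slotRoots t z) := by
  rw [rootPoly_slotRoots, Polynomial.map_mul, Polynomial.map_prod, Polynomial.map_prod]
  congr 1
  · refine Finset.prod_congr rfl fun m _ => ?_
    simp only [Polynomial.map_mul, Polynomial.map_sub, map_X, map_C]
    rw [slotRoots_first, slotRoots_second, conj_pairPt]
  · refine Finset.prod_congr rfl fun k _ => ?_
    simp [slotRoots_single]

variable {N : ℕ} (κ : Slots M e ≃ Fin N)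

theorem rootMap_slotRoots_im (t : Fin M → Bool) (z : Slots M e → ℝ) (i : Slots M e) :
    (rootMap κ (slotRoots t z) i).im = 0 := by
  rw [← Complex.conj_eq_iff_im, rootMap]
  conv_rhs => rw [← map_conj_rootPoly_slotRoots]
  rw [coeff_map]

/-- The coefficients of the real polynomial with given root parameters. -/
def slotMap (t : Fin M → Bool) (z : Slots M e → ℝ) (i : Slots M e) : ℝ :=
  (rootMap κ (slotRoots t z) i).re

theorem ofReal_slotMap (t : Fin M → Bool) (z : Slots M e → ℝ) :
    (fun i => (slotMap κ t z i : ℂ)) = rootMap κ (slotRoots t z) := by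
  ext i
  apply Complex.ext
  · simp [slotMap]
  · simp [rootMap_slotRoots_im]

/-- The complexified Jacobian matrix of `slotMap`. -/
def slotJacobian (t : Fin M → Bool) (z : Slots M e → ℝ) : Matrix (Slots M e) (Slots M e) ℂ :=
  rootMapDeriv κ (slotRoots t z) * slotMatrix e t

theorem hasFDerivAt_rootMap_slotRoots (t : Fin M → Bool) (z : Slots M e → ℝ) (i : Slots M e) :
    HasFDerivAt (fun z => rootMap κ (slotRoots t z) i)
      (∑ j, (slotJacobian κ t z i j) • (Complex.ofRealCLM.comp
        (ContinuousLinearMap.proj j : (Slots M e → ℝ) →L[ℝ] ℝ))) z := by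
  have h1 : HasFDerivAt (fun z : Slots M e → ℝ => slotRoots t z)
      (((Matrix.toLin' (slotMatrix e t)).toContinuousLinearMap.restrictScalars ℝ).comp
        (ContinuousLinearMap.pi fun j => Complex.ofRealCLM.comp
          (ContinuousLinearMap.proj j : (Slots M e → ℝ) →L[ℝ] ℝ))) z :=
    (((Matrix.toLin' (slotMatrix e t)).toContinuousLinearMap.restrictScalars ℝ).comp
        (ContinuousLinearMap.pi fun j => Complex.ofRealCLM.comp
          (ContinuousLinearMap.proj j : (Slots M e → ℝ) →L[ℝ] ℝ))).hasFDerivAt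
  have h2 := ((hasFDerivAt_rootMap κ (slotRoots t z)).restrictScalars ℝ).comp z h1
  refine ((hasFDerivAt_pi'.1 h2) i).congr_fderiv ?_
  ext v
  simp only [ContinuousLinearMap.comp_apply, ContinuousLinearMap.proj_apply,
    ContinuousLinearMap.coe_restrictScalars', LinearMap.coe_toContinuousLinearMap',
    Matrix.toLin'_apply, Matrix.mulVec_mulVec, slotJacobian, sum_apply,
    smul_apply, Matrix.mulVec, dotProduct, ContinuousLinearMap.pi_apply,
    smul_eq_mul]

/-- The imaginary part of each coefficient is identically zero in the real parameters, hence so is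
its derivative. The Jacobian is thus a real matrix, and its determinant can be computed from the
complex factorization. -/
theorem slotJacobian_im (t : Fin M → Bool) (z : Slots M e → ℝ) (i j : Slots M e) :
    (slotJacobian κ t z i j).im = 0 := by
  have h1 := Complex.imCLM.hasFDerivAt.comp z (hasFDerivAt_rootMap_slotRoots κ t z i)
  have h2 : HasFDerivAt (Complex.imCLM ∘ fun z => rootMap κ (slotRoots t z) i)
      (0 : (Slots M e → ℝ) →L[ℝ] ℝ) z := by
    have : (Complex.imCLM ∘ fun z => rootMap κ (slotRoots t z) i) = fun _ => (0 : ℝ) := by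
      ext z
      exact rootMap_slotRoots_im κ t z i
    rw [this]
    exact hasFDerivAt_const _ _
  have h3 := DFunLike.congr_fun (h1.unique h2) (Pi.single j 1)
  rw [ContinuousLinearMap.comp_apply, sum_apply, Finset.sum_eq_single j] at h3
  · simpa using h3
  · intro k _ hk
    simp [hk]
  · simp

/-- The derivative of `slotMap`. -/
def slotMapDeriv (t : Fin M → Bool) (z : Slots M e → ℝ) :
    (Slots M e → ℝ) →L[ℝ] (Slots M e → ℝ) :=
  (Matrix.toLin' ((slotJacobian κ t z).map Complex.re)).toContinuousLinearMap

theorem hasFDerivAt_slotMap (t : Fin M → Bool) (z : Slots M e → ℝ) :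
    HasFDerivAt (slotMap κ t) (slotMapDeriv κ t z) z := by
  rw [hasFDerivAt_pi']
  intro i
  refine (Complex.reCLM.hasFDerivAt.comp z
    (hasFDerivAt_rootMap_slotRoots κ t z i)).congr_fderiv ?_
  ext v
  simp [slotMapDeriv, Matrix.mulVec, dotProduct]

theorem abs_det_slotMapDeriv (t : Fin M → Bool) (z : Slots M e → ℝ) :
    |(slotMapDeriv κ t z).det| =
      ‖(vand κ (slotRoots t z)).det‖ * ∏ m, pairWeight (t m) := by
  have h : ((slotJacobian κ t z).map Complex.re).map Complex.ofRealHom = slotJacobian κ t z := by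
    ext i j
    exact Complex.ext (by simp) (by simp [slotJacobian_im])
  rw [slotMapDeriv, ContinuousLinearMap.det, LinearMap.coe_toContinuousLinearMap,
    LinearMap.det_toLin', ← Real.norm_eq_abs, ← Complex.norm_real]
  change ‖Complex.ofRealHom _‖ = _
  rw [RingHom.map_det, RingHom.mapMatrix_apply, h, slotJacobian, Matrix.det_mul, norm_mul,
    norm_det_rootMapDeriv, norm_det_slotMatrix]

theorem pairWeight_pos (b : Bool) : 0 < pairWeight b := by cases b <;> simp [pairWeight]

theorem det_slotMapDeriv_ne_zero_iff (t : Fin M → Bool) (z : Slots M e → ℝ) :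
    (slotMapDeriv κ t z).det ≠ 0 ↔ Function.Injective (slotRoots t z) := by
  rw [← abs_ne_zero, abs_det_slotMapDeriv, ← det_vand_ne_zero_iff κ, mul_ne_zero_iff,
    norm_ne_zero_iff, and_iff_left]
  exact (Finset.prod_pos fun m _ => pairWeight_pos _).ne'

theorem continuous_slotRoots (t : Fin M → Bool) :
    Continuous (slotRoots t : (Slots M e → ℝ) → Slots M e → ℂ) := by
  unfold slotRoots
  fun_prop

end Slots

/-! ### Fibres of the real parametrization -/

section RealFibers

variable {M e : ℕ}

/-- Unrolls the recursion. A function on all of `ℕ` makes the shift by two slots compatible with the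
induction, and the truncated `N - 1` is only read when `N` is odd. -/
theorem slotProd_natCast (N : ℕ) (g : ℕ → ℂ) :
    slotProd N (fun i => g i) = (∏ m ∈ Finset.range (N / 2), slotPair (g (2 * m)) (g (2 * m + 1))) *
      if N % 2 = 1 then slotSingle (g (N - 1)) else 1 := by
  induction N using Nat.twoStepInduction generalizing g with
  | zero => simp [slotProd]
  | one => simp [slotProd]
  | more N ih _ =>
    have h1 : (N + 2) / 2 = N / 2 + 1 := by omega
    have h2 : (N + 2) % 2 = N % 2 := by omega
    have h3 := ih fun k => g (k + 2)
    rw [h1, h2, Finset.prod_range_succ', slotProd]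
    have h4 : (fun i : Fin N => g (i.succ.succ : Fin (N + 2))) =
        fun i : Fin N => g ((i : ℕ) + 2) := by
      ext i
      simp
    rw [h4, h3]
    have h5 : (if N % 2 = 1 then slotSingle (g (N - 1 + 2)) else 1) =
        if N % 2 = 1 then slotSingle (g (N + 2 - 1)) else 1 := by
      split_ifs with h
      · rw [show N - 1 + 2 = N + 2 - 1 by omega]
      · rfl
    rw [h5]
    have h6 : ∀ m, 2 * (m + 1) = 2 * m + 2 := fun m => by ring
    simp only [h6, mul_zero, zero_add, Fin.val_zero, Fin.val_one, add_right_comm _ 2 1]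
    ring

theorem slotProd_slotEquiv (he : e ≤ 1) (r : Slots M e → ℂ) :
    slotProd (2 * M + e) (r ∘ (slotEquiv M e).symm) =
      (∏ m, slotPair (r (Sum.inl (Sum.inl m))) (r (Sum.inr m))) *
        ∏ k, slotSingle (r (Sum.inl (Sum.inr k))) := by
  set g : ℕ → ℂ := fun k => if h : k < 2 * M + e then r ((slotEquiv M e).symm ⟨k, h⟩) else 0
    with hg
  have h1 : r ∘ (slotEquiv M e).symm = fun i : Fin (2 * M + e) => g i := by
    ext i
    simp [hg]
  have h2 : ∀ i : Slots M e, g (slotIndex i : ℕ) = r i := by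
    intro i
    simp only [hg, Fin.is_lt, dif_pos, Fin.eta]
    rw [← slotEquiv_apply, Equiv.symm_apply_apply]
  have h3 : (2 * M + e) / 2 = M := by omega
  rw [h1, slotProd_natCast, h3, ← Fin.prod_univ_eq_prod_range
    (fun m => slotPair (g (2 * m)) (g (2 * m + 1)))]
  congr 1
  · refine Finset.prod_congr rfl fun m _ => ?_
    rw [← h2 (Sum.inl (Sum.inl m)), ← h2 (Sum.inr m)]
    rfl
  · obtain rfl | rfl : e = 0 ∨ e = 1 := by omega
    · simp
    · have : (2 * M + 1) % 2 = 1 := by omega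
      rw [if_pos this, Fin.prod_univ_one, ← h2]
      rfl

theorem pairPt_admissible (b : Bool) (p : ℝ × ℝ) :
    (starRingEnd ℂ (pairPt b p).1 = (pairPt b p).1 ∧ starRingEnd ℂ (pairPt b p).2 = (pairPt b p).2)
      ∨ (pairPt b p).2 = starRingEnd ℂ (pairPt b p).1 := by
  cases b
  · left
    simp [pairPt]
  · right
    simp [pairPt, sub_eq_add_neg]

/-- The type of a pair of distinct roots can be read off from the first root. -/
theorem pairPt_type_iff {b : Bool} {p : ℝ × ℝ} (h : (pairPt b p).1 ≠ (pairPt b p).2) :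
    b = true ↔ (pairPt b p).1.im ≠ 0 := by
  cases b
  · simp [pairPt]
  · simp only [pairPt, if_true, true_iff]
    intro h0
    apply h
    have : p.2 = 0 := by simpa using h0
    simp [pairPt, this]

theorem pairPt_re_fst (b : Bool) (p : ℝ × ℝ) : (pairPt b p).1.re = p.1 := by
  cases b <;> simp [pairPt]

theorem pairPt_snd (b : Bool) (p : ℝ × ℝ) :
    (if b then (pairPt b p).1.im else (pairPt b p).2.re) = p.2 := by
  cases b <;> simp [pairPt]

/-- Real and conjugate pairs overlap only when the two roots coincide, so for distinct roots the
type and the parameters are determined. -/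
theorem slotRoots_ext {t t' : Fin M → Bool} {z z' : Slots M e → ℝ}
    (hinj : Function.Injective (slotRoots t z)) (h : slotRoots t z = slotRoots t' z') :
    t = t' ∧ z = z' := by
  have hp : ∀ m, pairPt (t m) (z (Sum.inl (Sum.inl m)), z (Sum.inr m)) =
      pairPt (t' m) (z' (Sum.inl (Sum.inl m)), z' (Sum.inr m)) := by
    intro m
    apply Prod.ext
    · rw [← slotRoots_first, ← slotRoots_first, h]
    · rw [← slotRoots_second, ← slotRoots_second, h]
  have hne : ∀ m, (pairPt (t m) (z (Sum.inl (Sum.inl m)), z (Sum.inr m))).1 ≠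
      (pairPt (t m) (z (Sum.inl (Sum.inl m)), z (Sum.inr m))).2 := by
    intro m h'
    rw [← slotRoots_first, ← slotRoots_second] at h'
    simpa using hinj h'
  have ht : t = t' := by
    funext m
    have h1 := pairPt_type_iff (hne m)
    have h2 := pairPt_type_iff (b := t' m)
      (p := (z' (Sum.inl (Sum.inl m)), z' (Sum.inr m))) (by rw [← hp]; exact hne m)
    rw [Bool.eq_iff_iff, h1, h2, hp]
  refine ⟨ht, ?_⟩
  subst ht
  ext i
  rcases i with (m | k) | m
  · have h1 := pairPt_re_fst (t m) (z (Sum.inl (Sum.inl m)), z (Sum.inr m))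
    rw [hp, pairPt_re_fst] at h1
    exact h1.symm
  · have h1 := congrFun h (Sum.inl (Sum.inr k))
    rw [slotRoots_single, slotRoots_single] at h1
    exact_mod_cast h1
  · have h1 := pairPt_snd (t m) (z (Sum.inl (Sum.inl m)), z (Sum.inr m))
    rw [hp, pairPt_snd] at h1
    exact h1.symm

theorem exists_pairPt {x y : ℂ}
    (h : (starRingEnd ℂ x = x ∧ starRingEnd ℂ y = y) ∨ y = starRingEnd ℂ x) :
    ∃ b p, pairPt b p = (x, y) := by
  rcases h with ⟨h1, h2⟩ | h
  · refine ⟨false, (x.re, y.re), ?_⟩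
    simp [pairPt, Complex.conj_eq_iff_re.1 h1, Complex.conj_eq_iff_re.1 h2]
  · refine ⟨true, (x.re, x.im), ?_⟩
    simp only [pairPt, if_true, Prod.mk.injEq, Complex.re_add_im, true_and]
    rw [h]
    apply Complex.ext <;> simp

theorem exists_slotRoots_eq {r : Slots M e → ℂ}
    (hpair : ∀ m, (starRingEnd ℂ (r (Sum.inl (Sum.inl m))) = r (Sum.inl (Sum.inl m)) ∧
      starRingEnd ℂ (r (Sum.inr m)) = r (Sum.inr m)) ∨
        r (Sum.inr m) = starRingEnd ℂ (r (Sum.inl (Sum.inl m))))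
    (hsingle : ∀ k, starRingEnd ℂ (r (Sum.inl (Sum.inr k))) = r (Sum.inl (Sum.inr k))) :
    ∃ t z, slotRoots t z = r := by
  choose t p hp using fun m => exists_pairPt (hpair m)
  refine ⟨t, Sum.elim (Sum.elim (fun m => (p m).1) fun k => (r (Sum.inl (Sum.inr k))).re)
    fun m => (p m).2, ?_⟩
  ext i
  rcases i with (m | k) | m
  · rw [slotRoots_first]
    simp [hp]
  · rw [slotRoots_single]
    simp [Complex.conj_eq_iff_re.1 (hsingle k)]
  · rw [slotRoots_second]
    simp [hp]

/-- The phase attached to a real polynomial with parametrized roots. -/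
def slotPhase (t : Fin M → Bool) (z : Slots M e → ℝ) : ℂ :=
  (∏ m, pairPhase (slotRoots t z (Sum.inl (Sum.inl m))) (slotRoots t z (Sum.inr m))) *
    vandPhase (slotRoots t z ∘ (slotEquiv M e).symm)

theorem slotPhase_eq (he : e ≤ 1) (t : Fin M → Bool) (z : Slots M e → ℝ) :
    slotPhase t z = slotProd (2 * M + e) (slotRoots t z ∘ (slotEquiv M e).symm) *
      vandPhase (slotRoots t z ∘ (slotEquiv M e).symm) := by
  rw [slotPhase, slotProd_slotEquiv he]
  congr 1
  have h1 : ∀ k, slotSingle (slotRoots t z (Sum.inl (Sum.inr k))) = 1 := fun k =>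
    if_pos (by rw [slotRoots_single, Complex.conj_ofReal])
  rw [Finset.prod_congr rfl fun k _ => h1 k, Finset.prod_const_one, mul_one]
  refine Finset.prod_congr rfl fun m _ => ?_
  rw [slotPair, if_pos]
  rw [slotRoots_first, slotRoots_second]
  exact pairPt_admissible _ _

theorem map_conj_coeffPoly {ι : Type*} [Fintype ι] [DecidableEq ι] {N : ℕ} (κ : ι ≃ Fin N)
    (c : ι → ℝ) : (coeffPoly κ fun i => (c i : ℂ)).map (starRingEnd ℂ) =
      coeffPoly κ fun i => (c i : ℂ) := by
  simp [coeffPoly, Polynomial.map_sum]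

/-- The signed count of the parametrizations of a separable real polynomial. -/
theorem tsum_slotPhase (he : e ≤ 1) {c : Slots M e → ℝ} {r₀ : Slots M e → ℂ}
    (h₀ : Function.Injective r₀) (hr₀ : rootPoly r₀ = coeffPoly (slotEquiv M e) fun i => (c i : ℂ)) :
    ∑' q : {q : (Fin M → Bool) × (Slots M e → ℝ) // slotMap (slotEquiv M e) q.1 q.2 = c ∧
      (slotMapDeriv (slotEquiv M e) q.1 q.2).det ≠ 0}, slotPhase q.1.1 q.1.2 =
      (2 ^ M * M.factorial : ℕ) := by
  classical
  set κ := slotEquiv M e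
  set S := Finset.univ.image r₀ with hS
  have hcard : S.card = 2 * M + e := by
    rw [hS, Finset.card_image_of_injective _ h₀, Finset.card_univ, Fintype.card_congr κ,
      Fintype.card_fin]
  have hmemS : ∀ x, x ∈ S ↔ (coeffPoly κ fun i => (c i : ℂ)).IsRoot x := by
    intro x
    rw [← mem_roots (coeffPoly_monic κ _).ne_zero, ← hr₀, roots_rootPoly, hS]
    simp
  have hconj : ∀ x ∈ S, starRingEnd ℂ x ∈ S := by
    intro x hx
    rw [hmemS] at hx ⊢
    have := hx.map (f := starRingEnd ℂ)
    rwa [map_conj_coeffPoly] at this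
  -- A regular point of the fibre is the same as an injective filling by the root set `S`, which
  -- turns the analytic fibre into a combinatorial set.
  have hfiber : ∀ t z, (slotMap κ t z = c ∧ (slotMapDeriv κ t z).det ≠ 0) ↔
      (Function.Injective (slotRoots t z) ∧ ∀ i, slotRoots t z i ∈ S) := by
    intro t z
    rw [det_slotMapDeriv_ne_zero_iff, ← rootPoly_eq_rootPoly_iff h₀, hr₀,
      rootPoly_eq_coeffPoly_iff, ← ofReal_slotMap]
    constructor
    · rintro ⟨rfl, -⟩
      rfl
    · intro h
      have h1 : slotMap κ t z = c := by
        funext i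
        exact_mod_cast congrFun h i
      refine ⟨h1, ((rootPoly_eq_rootPoly_iff h₀).1 ?_).1⟩
      rw [hr₀, rootPoly_eq_coeffPoly_iff, ← ofReal_slotMap, h1]
  have hcount := sum_slotProd_mul_vandPhase (2 * M + e) S hconj hcard
  have hM : (2 * M + e) / 2 = M := by omega
  rw [hM] at hcount
  rw [← hcount]
  set P : (Fin (2 * M + e) → ℂ) → Prop := fun r => Function.Injective r ∧
    ∃ t z, slotRoots t z = r ∘ κ with hP
  -- A filling of nonzero weight has distinct entries and admissible pairs and singles, so it comes
  -- from real parameters; all other fillings can be dropped from the signed count.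
  have hvanish : ∀ r ∈ Fintype.piFinset (fun _ : Fin (2 * M + e) => S),
      slotProd (2 * M + e) r * vandPhase r ≠ 0 → P r := by
    intro r hr hne
    rw [mul_ne_zero_iff] at hne
    refine ⟨by_contra fun h => hne.2 (vandPhase_eq_zero h), ?_⟩
    have h1 : slotProd (2 * M + e) ((r ∘ κ) ∘ κ.symm) ≠ 0 := by
      convert hne.1 using 2
      ext i
      simp
    rw [slotProd_slotEquiv he, mul_ne_zero_iff, Finset.prod_ne_zero_iff,
      Finset.prod_ne_zero_iff] at h1
    apply exists_slotRoots_eq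
    · intro m
      by_contra h
      exact h1.1 m (Finset.mem_univ m) (if_neg h)
    · intro k
      by_contra h
      exact h1.2 k (Finset.mem_univ k) (if_neg h)
  rw [← Finset.sum_filter_of_ne hvanish, ← Finset.tsum_subtype]
  set W := (Fintype.piFinset fun _ : Fin (2 * M + e) => S).filter P
  have hmem : ∀ q : {q : (Fin M → Bool) × (Slots M e → ℝ) // slotMap κ q.1 q.2 = c ∧
      (slotMapDeriv κ q.1 q.2).det ≠ 0}, slotRoots q.1.1 q.1.2 ∘ κ.symm ∈ W := by
    rintro ⟨⟨t, z⟩, hq⟩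
    have h1 := (hfiber t z).1 hq
    refine Finset.mem_filter.2 ⟨Fintype.mem_piFinset.2 fun i => h1.2 _,
      h1.1.comp κ.symm.injective, t, z, ?_⟩
    ext i
    simp
  have hbij : Function.Bijective (fun q => (⟨_, hmem q⟩ : W)) := by
    constructor
    · rintro ⟨⟨t, z⟩, hq⟩ ⟨⟨t', z'⟩, hq'⟩ h
      have h1 : slotRoots t z = slotRoots t' z' := by
        have := congrArg Subtype.val h
        simp only at this
        ext i
        simpa using congrFun this (κ i)
      obtain ⟨rfl, rfl⟩ := slotRoots_ext ((hfiber t z).1 hq).1 h1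
      rfl
    · rintro ⟨r, hr⟩
      obtain ⟨hr1, hinj, t, z, htz⟩ := Finset.mem_filter.1 hr
      refine ⟨⟨(t, z), (hfiber t z).2 ⟨?_, fun i => ?_⟩⟩, ?_⟩
      · rw [htz]
        exact hinj.comp κ.injective
      · rw [htz]
        exact Fintype.mem_piFinset.1 hr1 _
      · apply Subtype.ext
        simp only [htz]
        ext i
        simp
  rw [← (Equiv.ofBijective _ hbij).tsum_eq]
  refine tsum_congr fun q => ?_
  rw [slotPhase_eq he]
  rfl

theorem vandPhase_mul_norm {ι : Type*} [Fintype ι] [DecidableEq ι] {N : ℕ} (κ : ι ≃ Fin N)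
    (r : ι → ℂ) : vandPhase (r ∘ κ.symm) * ‖(vand κ r).det‖ = (vand κ r).det := by
  rw [det_vand, vandPhase, norm_prod, Complex.ofReal_prod, ← Finset.prod_mul_distrib]
  refine Finset.prod_congr rfl fun i _ => ?_
  rw [norm_prod, Complex.ofReal_prod, ← Finset.prod_mul_distrib]
  refine Finset.prod_congr rfl fun j _ => ?_
  rw [phase]
  by_cases h : r (κ.symm j) - r (κ.symm i) = 0
  · simp [h]
  · have : (‖r (κ.symm j) - r (κ.symm i)‖ : ℂ) ≠ 0 := by simpa using h
    simp only [Function.comp_apply]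
    rw [div_mul_cancel₀ _ this]

end RealFibers

/-! ### The real moment as a signed sum over permutations -/

section RealMoment

variable {M e : ℕ}

/-- The parameters of the roots, grouped into pairs and single entries. -/
def slotParam (M e : ℕ) : ((Fin M → ℝ × ℝ) × (Fin e → ℝ)) ≃ᵐ (Slots M e → ℝ) where
  toFun p := Sum.elim (Sum.elim (fun m => (p.1 m).1) p.2) fun m => (p.1 m).2
  invFun z := (fun m => (z (Sum.inl (Sum.inl m)), z (Sum.inr m)), fun k => z (Sum.inl (Sum.inr k)))
  left_inv p := rfl
  right_inv z := by
    ext i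
    rcases i with (m | k) | m <;> rfl
  measurable_toFun := by
    refine measurable_pi_iff.2 fun i => ?_
    rcases i with (m | k) | m
    · exact ((measurable_pi_apply m).comp measurable_fst).fst
    · exact (measurable_pi_apply k).comp measurable_snd
    · exact ((measurable_pi_apply m).comp measurable_fst).snd
  measurable_invFun := by
    refine Measurable.prodMk (measurable_pi_iff.2 fun m => ?_) (measurable_pi_iff.2 fun k => ?_)
    · exact (measurable_pi_apply _).prodMk (measurable_pi_apply _)
    · exact measurable_pi_apply _

theorem measurePreserving_slotParam (M e : ℕ) : MeasurePreserving (slotParam M e) := by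
  refine ⟨(slotParam M e).measurable, ?_⟩
  symm
  refine Measure.pi_eq fun S hS => ?_
  rw [Measure.map_apply (slotParam M e).measurable (MeasurableSet.univ_pi hS)]
  have h : slotParam M e ⁻¹' Set.univ.pi S =
      (Set.univ.pi fun m => S (Sum.inl (Sum.inl m)) ×ˢ S (Sum.inr m)) ×ˢ
        (Set.univ.pi fun k => S (Sum.inl (Sum.inr k))) := by
    ext p
    simp only [Set.mem_preimage, Set.mem_pi, Set.mem_univ, forall_true_left, Set.mem_prod,
      Sum.forall]
    constructor
    · rintro ⟨⟨h1, h2⟩, h3⟩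
      exact ⟨fun m => ⟨h1 m, h3 m⟩, h2⟩
    · rintro ⟨h1, h2⟩
      exact ⟨⟨fun m => (h1 m).1, h2⟩, fun m => (h1 m).2⟩
  rw [h, Measure.volume_eq_prod, Measure.prod_prod, volume_pi_pi, volume_pi_pi,
    Fintype.prod_sum_type, Fintype.prod_sum_type]
  simp only [Measure.volume_eq_prod, Measure.prod_prod, Finset.prod_mul_distrib]
  ring

theorem integrable_slotParam {G : Fin M → ℝ × ℝ → ℂ} {H : Fin e → ℝ → ℂ}
    (hG : ∀ m, Integrable (G m)) (hH : ∀ k, Integrable (H k)) :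
    Integrable fun z : Slots M e → ℝ => (∏ m, G m (z (Sum.inl (Sum.inl m)), z (Sum.inr m))) *
      ∏ k, H k (z (Sum.inl (Sum.inr k))) := by
  rw [← (measurePreserving_slotParam M e).integrable_comp_emb
    (slotParam M e).measurableEmbedding]
  exact (Integrable.fintype_prod hG).mul_prod (Integrable.fintype_prod hH)

theorem integral_slotParam (G : Fin M → ℝ × ℝ → ℂ) (H : Fin e → ℝ → ℂ) :
    ∫ z : Slots M e → ℝ, (∏ m, G m (z (Sum.inl (Sum.inl m)), z (Sum.inr m))) *
      ∏ k, H k (z (Sum.inl (Sum.inr k))) = (∏ m, ∫ p, G m p) * ∏ k, ∫ x, H k x := by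
  rw [← (measurePreserving_slotParam M e).integral_comp (slotParam M e).measurableEmbedding,
    ← integral_fintype_prod_volume_eq_prod, ← integral_fintype_prod_volume_eq_prod,
    ← integral_prod_mul]
  rfl

theorem norm_pairPhase_of_ne {x y : ℂ} (h : x ≠ y) : ‖pairPhase x y‖ = 1 := by
  have : ‖y - x‖ ≠ 0 := norm_ne_zero_iff.2 (sub_ne_zero.2 h.symm)
  rw [pairPhase, norm_div, RCLike.norm_conj, Complex.norm_real, norm_norm, div_self this]

theorem norm_slotPhase {t : Fin M → Bool} {z : Slots M e → ℝ}
    (h : Function.Injective (slotRoots t z)) : ‖slotPhase t z‖ = 1 := by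
  have h1 := (det_vand_ne_zero_iff (slotEquiv M e) (slotRoots t z)).2 h
  have h2 := congrArg norm (vandPhase_mul_norm (slotEquiv M e) (slotRoots t z))
  rw [norm_mul, Complex.norm_real, norm_norm] at h2
  have h3 := mul_eq_right₀ (norm_ne_zero_iff.2 h1) |>.1 h2
  rw [slotPhase, norm_mul, h3, mul_one, norm_prod]
  exact Finset.prod_eq_one fun m _ => norm_pairPhase_of_ne (h.ne (by simp))

theorem continuous_slotMapDeriv_det {N : ℕ} (κ : Slots M e ≃ Fin N) (t : Fin M → Bool) :
    Continuous fun z => (slotMapDeriv κ t z).det := by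
  have h1 : Continuous fun r : Slots M e → ℂ => rootMapDeriv κ r := by
    refine continuous_matrix fun i j => Continuous.neg ?_
    exact continuous_iff_continuousAt.2 fun r =>
      (hasFDerivAt_coeff_prod_X_sub_C _ _ r).continuousAt
  have h2 : Continuous fun z => slotJacobian κ t z :=
    (h1.comp (continuous_slotRoots t)).matrix_mul continuous_const
  have h3 : ∀ z, (slotMapDeriv κ t z).det = ((slotJacobian κ t z).map Complex.re).det := by
    intro z
    rw [slotMapDeriv, ContinuousLinearMap.det, LinearMap.coe_toContinuousLinearMap,
      LinearMap.det_toLin']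
  simp only [h3]
  exact (h2.matrix_map Complex.continuous_re).matrix_det

/-- The weighted signed integrand expands into products over pairs and single slots. -/
theorem abs_det_mul_slotPhase_mul_cpow (s : ℂ) (t : Fin M → Bool) (z : Slots M e → ℝ) :
    |(slotMapDeriv (slotEquiv M e) t z).det| • (slotPhase t z *
      ((reciprocalMahlerMeasure (rootPoly (slotRoots t z)) : ℝ) : ℂ) ^ (-s)) =
    ∑ σ : Equiv.Perm (Slots M e), ((Equiv.Perm.sign σ : ℤ) : ℂ) *
      ((∏ m, pairTerm s (t m) (slotIndex (σ (Sum.inl (Sum.inl m)))) (slotIndex (σ (Sum.inr m)))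
        (z (Sum.inl (Sum.inl m)), z (Sum.inr m))) *
      ∏ k, wcheb s (slotIndex (σ (Sum.inl (Sum.inr k)))) (z (Sum.inl (Sum.inr k)))) := by
  have h1 := prod_cpow_mul_det_vand (slotEquiv M e) s (slotRoots t z)
  have h2 := vandPhase_mul_norm (slotEquiv M e) (slotRoots t z)
  set r := slotRoots t z with hr
  have h3 : ∀ σ : Equiv.Perm (Slots M e),
      (∏ m, pairTerm s (t m) (slotIndex (σ (Sum.inl (Sum.inl m)))) (slotIndex (σ (Sum.inr m)))
        (z (Sum.inl (Sum.inl m)), z (Sum.inr m))) *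
      ∏ k, wcheb s (slotIndex (σ (Sum.inl (Sum.inr k)))) (z (Sum.inl (Sum.inr k))) =
      ((∏ m, (pairWeight (t m) : ℂ)) *
        (∏ m, pairPhase (r (Sum.inl (Sum.inl m))) (r (Sum.inr m)))) *
        ∏ i, wcheb s (slotEquiv M e (σ i)) (r i) := by
    intro σ
    rw [Fintype.prod_sum_type, Fintype.prod_sum_type]
    simp only [pairTerm, Finset.prod_mul_distrib, hr, slotRoots_first, slotRoots_second,
      slotRoots_single, slotEquiv_apply]
    ring
  rw [abs_det_slotMapDeriv, prod_linMeasure_cpow, slotPhase, Complex.real_smul, ← hr,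
    Finset.sum_congr rfl fun σ _ => by rw [h3 σ]]
  have h4 : ∀ σ : Equiv.Perm (Slots M e), ((Equiv.Perm.sign σ : ℤ) : ℂ) *
      (((∏ m, (pairWeight (t m) : ℂ)) *
        (∏ m, pairPhase (r (Sum.inl (Sum.inl m))) (r (Sum.inr m)))) *
        ∏ i, wcheb s (slotEquiv M e (σ i)) (r i)) =
      ((∏ m, (pairWeight (t m) : ℂ)) *
        (∏ m, pairPhase (r (Sum.inl (Sum.inl m))) (r (Sum.inr m)))) *
        (((Equiv.Perm.sign σ : ℤ) : ℂ) * ∏ i, wcheb s (slotEquiv M e (σ i)) (r i)) :=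
    fun σ => by ring
  rw [Finset.sum_congr rfl fun σ _ => h4 σ, ← Finset.mul_sum, ← h1]
  push_cast
  linear_combination ((∏ m, (pairWeight (t m) : ℂ)) *
    (∏ m, pairPhase (r (Sum.inl (Sum.inl m))) (r (Sum.inr m))) *
    ∏ i, (linMeasure (r i) : ℂ) ^ (-s)) * h2

theorem slotIndex_add_one_lt {s : ℂ} (hs : ((2 * M + e : ℕ) : ℝ) < s.re) (i : Slots M e) :
    ((slotIndex i : ℕ) : ℝ) + 1 < s.re :=
  lt_of_le_of_lt (by exact_mod_cast (slotIndex i).2) hs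

/-- The phase is chosen so that `|det|` times the phase is the Vandermonde determinant itself times
the phases of the pairs, which expands over permutations. On the coefficient side the phases sum to
the constant `2 ^ M * M!` over almost every fibre. -/
theorem integral_real_reciprocalMahlerMeasure (he : e ≤ 1) {s : ℂ}
    (hs : ((2 * M + e : ℕ) : ℝ) < s.re) :
    Integrable (fun c : Slots M e → ℝ =>
      (reciprocalMahlerMeasure (coeffPoly (slotEquiv M e) fun i => (c i : ℂ)) : ℂ) ^ (-s)) ∧
    ((2 ^ M * M.factorial : ℕ) : ℂ) * ∫ c : Slots M e → ℝ,
      (reciprocalMahlerMeasure (coeffPoly (slotEquiv M e) fun i => (c i : ℂ)) : ℂ) ^ (-s) =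
    ∑ σ : Equiv.Perm (Slots M e), ((Equiv.Perm.sign σ : ℤ) : ℂ) *
      ((∏ m, pairInt s (slotIndex (σ (Sum.inl (Sum.inl m)))) (slotIndex (σ (Sum.inr m)))) *
      ∏ k, ∫ x : ℝ, wcheb s (slotIndex (σ (Sum.inl (Sum.inr k)))) x) := by
  set κ := slotEquiv M e with hκ
  set g : (Slots M e → ℝ) → ℂ := fun c =>
    (reciprocalMahlerMeasure (coeffPoly κ fun i => (c i : ℂ)) : ℂ) ^ (-s) with hgdef
  have hofReal : Measurable fun (c : Slots M e → ℝ) i => (c i : ℂ) :=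
    measurable_pi_iff.2 fun i => Complex.measurable_ofReal.comp (measurable_pi_apply i)
  have hg : Measurable g := (Complex.measurable_ofReal.comp
    ((measurable_reciprocalMahlerMeasure_coeffPoly κ).comp hofReal)).pow_const _
  have hf' : ∀ t x, HasFDerivAt (slotMap κ t) (slotMapDeriv κ t x) x := hasFDerivAt_slotMap κ
  have hcont : ∀ t, Continuous (slotMap κ t) := fun t =>
    continuous_iff_continuousAt.2 fun x => (hf' t x).continuousAt
  have hdet : ∀ t, Measurable fun x => (slotMapDeriv κ t x).det := fun t =>
    (continuous_slotMapDeriv_det κ t).measurable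
  have hae : ∀ᵐ c : Slots M e → ℝ, ∃ r : Slots M e → ℂ,
      rootPoly r = coeffPoly κ (fun i => (c i : ℂ)) ∧ Function.Injective r := by
    filter_upwards [ae_injective_of_rootPoly_eq Complex.ofRealHom Complex.continuous_ofReal κ]
      with c hc
    obtain ⟨r, hr⟩ := exists_rootPoly_eq_coeffPoly κ fun i => (c i : ℂ)
    exact ⟨r, hr, hc r hr⟩
  have hgmap : ∀ t z, g (slotMap κ t z) =
      ((reciprocalMahlerMeasure (rootPoly (slotRoots t z)) : ℝ) : ℂ) ^ (-s) := by
    intro t z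
    simp only [hgdef]
    rw [ofReal_slotMap, rootPoly_eq_coeffPoly_rootMap]
  have hlt := fun i => slotIndex_add_one_lt (M := M) (e := e) hs i
  have hterm : ∀ σ : Equiv.Perm (Slots M e), ∀ t : Fin M → Bool,
      Integrable fun z : Slots M e → ℝ =>
      ((∏ m, pairTerm s (t m) (slotIndex (σ (Sum.inl (Sum.inl m)))) (slotIndex (σ (Sum.inr m)))
        (z (Sum.inl (Sum.inl m)), z (Sum.inr m))) *
      ∏ k, wcheb s (slotIndex (σ (Sum.inl (Sum.inr k)))) (z (Sum.inl (Sum.inr k)))) := by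
    intro σ t
    exact integrable_slotParam (G := fun m => pairTerm s (t m)
      (slotIndex (σ (Sum.inl (Sum.inl m)))) (slotIndex (σ (Sum.inr m))))
      (H := fun k x => wcheb s (slotIndex (σ (Sum.inl (Sum.inr k)))) (x : ℂ))
      (fun m => integrable_pairTerm (hlt _) (hlt _) _)
      (fun k => integrable_wcheb_real (hlt _))
  have hexp : ∀ t z, |(slotMapDeriv κ t z).det| • (slotPhase t z * g (slotMap κ t z)) =
      ∑ σ : Equiv.Perm (Slots M e), ((Equiv.Perm.sign σ : ℤ) : ℂ) *
      ((∏ m, pairTerm s (t m) (slotIndex (σ (Sum.inl (Sum.inl m)))) (slotIndex (σ (Sum.inr m)))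
        (z (Sum.inl (Sum.inl m)), z (Sum.inr m))) *
      ∏ k, wcheb s (slotIndex (σ (Sum.inl (Sum.inr k)))) (z (Sum.inl (Sum.inr k)))) := by
    intro t z
    rw [hgmap, ← abs_det_mul_slotPhase_mul_cpow]
  have h_int : ∀ t, Integrable fun z =>
      |(slotMapDeriv κ t z).det| • (slotPhase t z * g (slotMap κ t z)) := by
    intro t
    simp only [hexp]
    exact integrable_finsetSum _ fun σ _ => (hterm σ t).const_mul _
  -- The phase has modulus one wherever the Jacobian does not vanish, so the signed and unsigned
  -- integrands have the same norm.
  have h_int' : ∀ t, Integrable fun z => |(slotMapDeriv κ t z).det| • g (slotMap κ t z) := by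
    intro t
    refine (h_int t).mono ?_ (Filter.Eventually.of_forall fun z => ?_)
    · exact ((hdet t).norm.smul (hg.comp (hcont t).measurable)).aestronglyMeasurable
    · rw [norm_smul, norm_smul, norm_mul]
      by_cases h : (slotMapDeriv κ t z).det = 0
      · simp [h]
      · rw [norm_slotPhase ((det_slotMapDeriv_ne_zero_iff κ t z).1 h), one_mul]
  have hgi : Integrable g := by
    refine integrable_of_abs_det volume hf' hdet hg ?_ h_int'
    filter_upwards [hae] with c ⟨r, hr, hinj⟩
    have hsum := tsum_slotPhase he hinj hr
    -- An empty regular fibre would make the signed count zero, whereas it equals `2 ^ M * M!`;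
    -- hence almost every real polynomial is parametrized.
    by_contra hcon
    push Not at hcon
    have : IsEmpty {q : (Fin M → Bool) × (Slots M e → ℝ) // slotMap (slotEquiv M e) q.1 q.2 = c ∧
      (slotMapDeriv (slotEquiv M e) q.1 q.2).det ≠ 0} :=
      ⟨fun q => q.2.2 (hcon q.1.1 q.1.2 q.2.1)⟩
    rw [tsum_empty] at hsum
    have h0 : (2 ^ M * M.factorial : ℕ) ≠ 0 :=
      mul_ne_zero (pow_ne_zero _ two_ne_zero) (Nat.factorial_pos _).ne'
    exact h0 (by exact_mod_cast hsum.symm)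
  refine ⟨hgi, ?_⟩
  have harea := sum_integral_abs_det_smul_eq_integral_tsum_fiber volume hf' hdet
    (fun t z => slotPhase t z * g (slotMap κ t z)) h_int
  have hfib : ∀ᵐ c : Slots M e → ℝ, ∑' q : {q : (Fin M → Bool) × (Slots M e → ℝ) //
      slotMap κ q.1 q.2 = c ∧ (slotMapDeriv κ q.1 q.2).det ≠ 0},
      slotPhase q.1.1 q.1.2 * g (slotMap κ q.1.1 q.1.2) =
      ((2 ^ M * M.factorial : ℕ) : ℂ) * g c := by
    filter_upwards [hae] with c ⟨r, hr, hinj⟩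
    rw [← tsum_slotPhase he hinj hr, ← tsum_mul_right]
    exact tsum_congr fun q => by rw [q.2.1]
  rw [integral_congr_ae hfib, integral_const_mul] at harea
  rw [← harea]
  simp only [hexp]
  rw [Finset.sum_congr rfl fun t _ => integral_finsetSum _ fun σ _ => (hterm σ t).const_mul _,
    Finset.sum_comm]
  refine Finset.sum_congr rfl fun σ _ => ?_
  simp only [integral_const_mul]
  rw [← Finset.mul_sum]
  congr 1
  have hval : ∀ t : Fin M → Bool, ∫ z : Slots M e → ℝ,
      ((∏ m, pairTerm s (t m) (slotIndex (σ (Sum.inl (Sum.inl m)))) (slotIndex (σ (Sum.inr m)))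
        (z (Sum.inl (Sum.inl m)), z (Sum.inr m))) *
      ∏ k, wcheb s (slotIndex (σ (Sum.inl (Sum.inr k)))) (z (Sum.inl (Sum.inr k)))) =
      (∏ m, ∫ p, pairTerm s (t m) (slotIndex (σ (Sum.inl (Sum.inl m)))) (slotIndex (σ (Sum.inr m)))
        p) * ∏ k, ∫ x : ℝ, wcheb s (slotIndex (σ (Sum.inl (Sum.inr k)))) x := fun t =>
    integral_slotParam (fun m => pairTerm s (t m)
      (slotIndex (σ (Sum.inl (Sum.inl m)))) (slotIndex (σ (Sum.inr m))))
      (fun k x => wcheb s (slotIndex (σ (Sum.inl (Sum.inr k)))) (x : ℂ))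
  rw [Finset.sum_congr rfl fun t _ => hval t, ← Finset.sum_mul]
  congr 1
  -- Summing over all types `t` of a product over pairs gives the product over pairs of the two-term
  -- sums defining `pairInt`.
  simp only [pairInt]
  rw [Finset.prod_univ_sum, Fintype.piFinset_univ]

end RealMoment

/-! ### Collapse of the Pfaffian-type sum to a determinant -/

section PfaffianSum

variable {P E : Type*} [Fintype P] [Fintype E] [DecidableEq P] [DecidableEq E]

/-- Composing `σ` with the transposition of the two slots of the pair `m` reverses the sign and
exchanges the two terms of the difference, so both contribute equally. -/
theorem sum_sign_pair_succ (K : (P ⊕ E) ⊕ P → (P ⊕ E) ⊕ P → ℂ) (m : P)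
    (G : Equiv.Perm ((P ⊕ E) ⊕ P) → ℂ)
    (hG : ∀ σ, G (σ * Equiv.swap (Sum.inl (Sum.inl m)) (Sum.inr m)) = G σ) :
    ∑ σ : Equiv.Perm ((P ⊕ E) ⊕ P), ((Equiv.Perm.sign σ : ℤ) : ℂ) *
      ((K (σ (Sum.inl (Sum.inl m))) (σ (Sum.inr m)) - K (σ (Sum.inr m)) (σ (Sum.inl (Sum.inl m)))) *
        G σ) =
    2 * ∑ σ : Equiv.Perm ((P ⊕ E) ⊕ P), ((Equiv.Perm.sign σ : ℤ) : ℂ) *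
      (K (σ (Sum.inl (Sum.inl m))) (σ (Sum.inr m)) * G σ) := by
  set w : Equiv.Perm ((P ⊕ E) ⊕ P) := Equiv.swap (Sum.inl (Sum.inl m)) (Sum.inr m) with hw
  have h1 : ∑ σ : Equiv.Perm ((P ⊕ E) ⊕ P), ((Equiv.Perm.sign σ : ℤ) : ℂ) *
      (K (σ (Sum.inr m)) (σ (Sum.inl (Sum.inl m))) * G σ) =
      -∑ σ : Equiv.Perm ((P ⊕ E) ⊕ P), ((Equiv.Perm.sign σ : ℤ) : ℂ) *
      (K (σ (Sum.inl (Sum.inl m))) (σ (Sum.inr m)) * G σ) := by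
    rw [← Equiv.sum_comp (Equiv.mulRight w), ← Finset.sum_neg_distrib]
    refine Finset.sum_congr rfl fun σ _ => ?_
    have h2 : Equiv.Perm.sign w = -1 := Equiv.Perm.sign_swap (by simp)
    simp only [Equiv.coe_mulRight, hG, Equiv.Perm.mul_apply, Equiv.Perm.sign_mul, h2]
    rw [hw, Equiv.swap_apply_left, Equiv.swap_apply_right]
    simp
  have h3 : ∀ σ : Equiv.Perm ((P ⊕ E) ⊕ P), ((Equiv.Perm.sign σ : ℤ) : ℂ) *
      ((K (σ (Sum.inl (Sum.inl m))) (σ (Sum.inr m)) - K (σ (Sum.inr m)) (σ (Sum.inl (Sum.inl m)))) *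
        G σ) = ((Equiv.Perm.sign σ : ℤ) : ℂ) *
      (K (σ (Sum.inl (Sum.inl m))) (σ (Sum.inr m)) * G σ) - ((Equiv.Perm.sign σ : ℤ) : ℂ) *
      (K (σ (Sum.inr m)) (σ (Sum.inl (Sum.inl m))) * G σ) := fun σ => by ring
  rw [Finset.sum_congr rfl fun σ _ => h3 σ, Finset.sum_sub_distrib, h1]
  ring

theorem sum_sign_pair (K : (P ⊕ E) ⊕ P → (P ⊕ E) ⊕ P → ℂ) (J : (P ⊕ E) ⊕ P → ℂ)
    (U : Finset P) :
    ∑ σ : Equiv.Perm ((P ⊕ E) ⊕ P), ((Equiv.Perm.sign σ : ℤ) : ℂ) *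
      ((∏ m, if m ∈ U then K (σ (Sum.inl (Sum.inl m))) (σ (Sum.inr m)) -
        K (σ (Sum.inr m)) (σ (Sum.inl (Sum.inl m))) else
          K (σ (Sum.inl (Sum.inl m))) (σ (Sum.inr m))) * ∏ k, J (σ (Sum.inl (Sum.inr k)))) =
    2 ^ U.card * ∑ σ : Equiv.Perm ((P ⊕ E) ⊕ P), ((Equiv.Perm.sign σ : ℤ) : ℂ) *
      ((∏ m, K (σ (Sum.inl (Sum.inl m))) (σ (Sum.inr m))) *
        ∏ k, J (σ (Sum.inl (Sum.inr k)))) := by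
  induction U using Finset.induction_on with
  | empty => simp
  | insert a U ha ih =>
    set G : Equiv.Perm ((P ⊕ E) ⊕ P) → ℂ := fun σ =>
      (∏ m ∈ Finset.univ.erase a, if m ∈ U then K (σ (Sum.inl (Sum.inl m))) (σ (Sum.inr m)) -
        K (σ (Sum.inr m)) (σ (Sum.inl (Sum.inl m))) else
          K (σ (Sum.inl (Sum.inl m))) (σ (Sum.inr m))) * ∏ k, J (σ (Sum.inl (Sum.inr k))) with hGdef
    have hG : ∀ σ, G (σ * Equiv.swap (Sum.inl (Sum.inl a)) (Sum.inr a)) = G σ := by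
      intro σ
      simp only [hGdef, Equiv.Perm.mul_apply]
      congr 1
      refine Finset.prod_congr rfl fun m hm => ?_
      have hne : m ≠ a := Finset.ne_of_mem_erase hm
      rw [Equiv.swap_apply_of_ne_of_ne (by simpa using hne) (by simp),
        Equiv.swap_apply_of_ne_of_ne (by simp) (by simpa using hne)]
    have h1 : ∀ σ : Equiv.Perm ((P ⊕ E) ⊕ P),
        (∏ m, if m ∈ insert a U then K (σ (Sum.inl (Sum.inl m))) (σ (Sum.inr m)) -
        K (σ (Sum.inr m)) (σ (Sum.inl (Sum.inl m))) else
          K (σ (Sum.inl (Sum.inl m))) (σ (Sum.inr m))) * ∏ k, J (σ (Sum.inl (Sum.inr k))) =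
        (K (σ (Sum.inl (Sum.inl a))) (σ (Sum.inr a)) -
          K (σ (Sum.inr a)) (σ (Sum.inl (Sum.inl a)))) * G σ := by
      intro σ
      rw [← Finset.mul_prod_erase _ _ (Finset.mem_univ a), if_pos (Finset.mem_insert_self a U),
        mul_assoc]
      congr 2
      refine Finset.prod_congr rfl fun m hm => ?_
      simp [Finset.mem_insert, Finset.ne_of_mem_erase hm]
    have h2 : ∀ σ : Equiv.Perm ((P ⊕ E) ⊕ P),
        (∏ m, if m ∈ U then K (σ (Sum.inl (Sum.inl m))) (σ (Sum.inr m)) -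
        K (σ (Sum.inr m)) (σ (Sum.inl (Sum.inl m))) else
          K (σ (Sum.inl (Sum.inl m))) (σ (Sum.inr m))) * ∏ k, J (σ (Sum.inl (Sum.inr k))) =
        K (σ (Sum.inl (Sum.inl a))) (σ (Sum.inr a)) * G σ := by
      intro σ
      rw [← Finset.mul_prod_erase _ _ (Finset.mem_univ a), if_neg ha, mul_assoc]
    simp only [h1]
    rw [sum_sign_pair_succ K a G hG]
    simp only [h2] at ih
    rw [ih, Finset.card_insert_of_notMem ha]
    ring

/-- Only permutations preserving the left block survive, since a label of the right block in a first
or single slot gives zero. The permutation of the right block is absorbed by relabelling the pairs,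
with total sign `1`, so it contributes a factorial. -/
theorem sum_sign_blocks (K : (P ⊕ E) ⊕ P → (P ⊕ E) ⊕ P → ℂ) (J : (P ⊕ E) ⊕ P → ℂ)
    (hK : ∀ a b, K (Sum.inr a) b = 0) (hJ : ∀ a, J (Sum.inr a) = 0) :
    ∑ σ : Equiv.Perm ((P ⊕ E) ⊕ P), ((Equiv.Perm.sign σ : ℤ) : ℂ) *
      ((∏ m, K (σ (Sum.inl (Sum.inl m))) (σ (Sum.inr m))) *
        ∏ k, J (σ (Sum.inl (Sum.inr k)))) =
    ((Fintype.card P).factorial : ℂ) * (Matrix.of fun i j : P ⊕ E =>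
      Sum.elim (fun m => K (Sum.inl i) (Sum.inr m)) (fun _ => J (Sum.inl i)) j).det := by
  have hsum : ∑ p : Equiv.Perm (P ⊕ E) × Equiv.Perm P,
      ((Equiv.Perm.sign p.1 : ℤ) : ℂ) * ((Equiv.Perm.sign p.2 : ℤ) : ℂ) *
      ((∏ m, K (Sum.inl (p.1 (Sum.inl m))) (Sum.inr (p.2 m))) *
        ∏ k, J (Sum.inl (p.1 (Sum.inr k)))) =
    ∑ σ : Equiv.Perm ((P ⊕ E) ⊕ P), ((Equiv.Perm.sign σ : ℤ) : ℂ) *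
      ((∏ m, K (σ (Sum.inl (Sum.inl m))) (σ (Sum.inr m))) *
        ∏ k, J (σ (Sum.inl (Sum.inr k)))) := by
    refine Finset.sum_of_injOn (fun p => Equiv.Perm.sumCongr p.1 p.2)
      (Equiv.Perm.sumCongrHom_injective.injOn) (fun _ _ => by simp) ?_ ?_
    · intro σ _ hσ
      have hnot : ¬ ∀ i : P ⊕ E, ∃ j : P ⊕ E, σ (Sum.inl i) = Sum.inl j := by
        intro h
        apply hσ
        have hmaps : Set.MapsTo σ (Set.range (Sum.inl : P ⊕ E → (P ⊕ E) ⊕ P)) (Set.range Sum.inl) := by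
          rintro _ ⟨i, rfl⟩
          obtain ⟨j, hj⟩ := h i
          exact ⟨j, hj.symm⟩
        obtain ⟨p, hp⟩ := Equiv.Perm.mem_sumCongrHom_range_of_perm_mapsTo_inl hmaps
        exact ⟨p, by simp, hp⟩
      push Not at hnot
      obtain ⟨i, hi⟩ := hnot
      obtain ⟨b, hb⟩ : ∃ b, σ (Sum.inl i) = Sum.inr b := by
        rcases h : σ (Sum.inl i) with j | b
        · exact absurd h (hi j)
        · exact ⟨b, rfl⟩
      rcases i with m | k
      · rw [Finset.prod_eq_zero (Finset.mem_univ m) (by rw [hb, hK])]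
        ring
      · rw [Finset.prod_eq_zero (i := k) (f := fun k => J (σ (Sum.inl (Sum.inr k))))
          (Finset.mem_univ k) (by rw [hb, hJ])]
        ring
    · intro p _
      simp [Equiv.Perm.sign_sumCongr]
  rw [← hsum, Fintype.sum_prod_type_right]
  have hinner : ∀ τ : Equiv.Perm P, ∑ σ : Equiv.Perm (P ⊕ E),
      ((Equiv.Perm.sign σ : ℤ) : ℂ) * ((Equiv.Perm.sign τ : ℤ) : ℂ) *
      ((∏ m, K (Sum.inl (σ (Sum.inl m))) (Sum.inr (τ m))) *
        ∏ k, J (Sum.inl (σ (Sum.inr k)))) = (Matrix.of fun i j : P ⊕ E =>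
      Sum.elim (fun m => K (Sum.inl i) (Sum.inr m)) (fun _ => J (Sum.inl i)) j).det := by
    intro τ
    rw [Matrix.det_apply', ← Equiv.sum_comp (Equiv.mulRight (Equiv.Perm.sumCongr τ 1))]
    refine Finset.sum_congr rfl fun σ _ => ?_
    have hτ : ((Equiv.Perm.sign τ : ℤ) : ℂ) * ((Equiv.Perm.sign τ : ℤ) : ℂ) = 1 := by
      rw [← Int.cast_mul, ← Units.val_mul, Int.units_mul_self]
      simp
    rw [Fintype.prod_sum_type]
    simp only [Equiv.coe_mulRight, Equiv.Perm.mul_apply, Equiv.Perm.sign_mul,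
      Equiv.Perm.sign_sumCongr, Equiv.Perm.sign_one, Equiv.Perm.sumCongr_apply, Sum.map_inl,
      Sum.map_inr, Equiv.Perm.one_apply, Matrix.of_apply, Sum.elim_inl, Sum.elim_inr]
    rw [Equiv.prod_comp τ fun m => K (Sum.inl (σ (Sum.inl m))) (Sum.inr m)]
    push_cast
    linear_combination (((Equiv.Perm.sign σ : ℤ) : ℂ) *
      ((∏ m, K (Sum.inl (σ (Sum.inl m))) (Sum.inr m)) * ∏ k, J (Sum.inl (σ (Sum.inr k))))) * hτ
  rw [Finset.sum_congr rfl fun τ _ => hinner τ]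
  simp [Fintype.card_perm]

/-- The Pfaffian-type sum for a skew-symmetric kernel which vanishes on two diagonal blocks. -/
theorem sum_sign_skew (I : (P ⊕ E) ⊕ P → (P ⊕ E) ⊕ P → ℂ) (J : (P ⊕ E) ⊕ P → ℂ)
    (hskew : ∀ a b, I b a = -I a b) (hll : ∀ a b, I (Sum.inl a) (Sum.inl b) = 0)
    (hrr : ∀ a b, I (Sum.inr a) (Sum.inr b) = 0) (hJ : ∀ a, J (Sum.inr a) = 0) :
    ∑ σ : Equiv.Perm ((P ⊕ E) ⊕ P), ((Equiv.Perm.sign σ : ℤ) : ℂ) *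
      ((∏ m, I (σ (Sum.inl (Sum.inl m))) (σ (Sum.inr m))) *
        ∏ k, J (σ (Sum.inl (Sum.inr k)))) =
    2 ^ Fintype.card P * ((Fintype.card P).factorial : ℂ) * (Matrix.of fun i j : P ⊕ E =>
      Sum.elim (fun m => I (Sum.inl i) (Sum.inr m)) (fun _ => J (Sum.inl i)) j).det := by
  -- `K` is the half of `I` whose first argument lies in the left block, so that `I` is the
  -- antisymmetrization of `K`.
  set K : (P ⊕ E) ⊕ P → (P ⊕ E) ⊕ P → ℂ := fun a b =>
    Sum.elim (fun i => I (Sum.inl i) b) (fun _ => 0) a with hKdef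
  have hI : ∀ a b, I a b = K a b - K b a := by
    rintro (a | a) (b | b)
    · simp [hKdef, hll]
    · simp [hKdef]
    · simp [hKdef, hskew (Sum.inl b)]
    · simp [hKdef, hrr]
  have h1 := sum_sign_pair K J Finset.univ
  simp only [Finset.mem_univ, if_true, ← hI] at h1
  rw [h1, sum_sign_blocks K J (fun a b => rfl) hJ, Finset.card_univ, ← mul_assoc]
  rfl

end PfaffianSum

/-! ### The Cauchy determinant -/

section Cauchy

open Finset

/-- Multiplying row `k` of the Cauchy matrix by the product of all `x k - y l` gives the matrix of
`vand_mul_rootMapDeriv`, a product of two matrices of known determinant. -/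
theorem det_cauchy {ι : Type*} [Fintype ι] [DecidableEq ι] {N : ℕ} (κ : ι ≃ Fin N) {x y : ι → ℂ}
    (h : ∀ k l, x k ≠ y l) :
    (Matrix.of fun k l => 1 / (y l - x k)).det * ∏ k, ∏ l, (x k - y l) =
      vandSign N * (vand κ x).det * (vand κ y).det := by
  have h1 := congrArg Matrix.det (vand_mul_rootMapDeriv κ x y)
  rw [Matrix.det_mul, det_rootMapDeriv] at h1
  rw [mul_comm, ← Matrix.det_mul_column, mul_assoc, mul_left_comm, h1]
  congr 1
  ext k j
  simp only [Matrix.of_apply]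
  have h2 : x k - y j ≠ 0 := sub_ne_zero.2 (h k j)
  rw [← mul_prod_erase univ _ (mem_univ j), ← neg_sub (x k) (y j), one_div, inv_neg]
  field_simp

theorem det_vand_range {ι : Type*} [Fintype ι] [DecidableEq ι] {N : ℕ} (κ : ι ≃ Fin N)
    (g : ℕ → ℂ) :
    (vand κ fun i => g (κ i)).det = ∏ j ∈ range N, ∏ i ∈ range j, (g j - g i) := by
  rw [det_vand]
  simp only [Equiv.apply_symm_apply]
  rw [prod_comm' (t' := univ) (s' := fun j => Iio j) (by simp),
    ← Fin.prod_univ_eq_prod_range (fun j => ∏ i ∈ range j, (g j - g i))]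
  refine prod_congr rfl fun j _ => ?_
  rw [← Nat.Iio_eq_range, ← Fin.map_valEmbedding_Iio, prod_map]
  rfl

end Cauchy

/-! ### The real moment as a Cauchy determinant -/

section RealDet

variable {M e : ℕ}

/-- The left block carries exactly the even indices. With `e ≤ 1` the single slot, if present, has
index `2 * M`, in line with the first entries of the pairs. -/
theorem slotIndex_inl (he : e ≤ 1) (i : Fin M ⊕ Fin e) :
    (slotIndex (Sum.inl i : Slots M e) : ℕ) = 2 * (finSumFinEquiv i : ℕ) := by
  rcases i with m | k
  · simp [slotIndex]
  · have : (k : ℕ) = 0 := by omega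
    simp [slotIndex, this]

/-- The blocks are the parity classes of the indices, so the pairing vanishes on both diagonal
blocks and the single integrals vanish on the right one. The factor `2 ^ M * M!` of the collapsed
sum cancels the one from the signed count. -/
theorem real_moment_eq_det (he : e ≤ 1) {s : ℂ} (hs : ((2 * M + e : ℕ) : ℝ) < s.re) :
    ∫ c : Slots M e → ℝ,
      (reciprocalMahlerMeasure (coeffPoly (slotEquiv M e) fun i => (c i : ℂ)) : ℂ) ^ (-s) =
    (Matrix.of fun i j : Fin M ⊕ Fin e =>
      Sum.elim (fun m : Fin M => pairInt s (2 * (finSumFinEquiv i : ℕ)) (2 * (m : ℕ) + 1))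
        (fun _ => ∫ x : ℝ, wcheb s (2 * (finSumFinEquiv i : ℕ)) x) j).det := by
  have h := (integral_real_reciprocalMahlerMeasure he hs).2
  have hlt := fun i => slotIndex_add_one_lt (M := M) (e := e) hs i
  rw [sum_sign_skew (fun a b => pairInt s (slotIndex a) (slotIndex b))
    (fun a => ∫ x : ℝ, wcheb s (slotIndex a) x)] at h
  · have h0 : ((2 ^ M * M.factorial : ℕ) : ℂ) ≠ 0 := by
      exact_mod_cast mul_ne_zero (pow_ne_zero _ two_ne_zero) (Nat.factorial_pos _).ne'
    have h1 : (2 ^ Fintype.card (Fin M) * ((Fintype.card (Fin M)).factorial : ℂ)) =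
        ((2 ^ M * M.factorial : ℕ) : ℂ) := by simp
    rw [h1] at h
    rw [mul_left_cancel₀ h0 h]
    congr 1
    ext i j
    simp only [Matrix.of_apply, slotIndex_inl he]
    rfl
  · intro a b
    exact pairInt_swap s _ _
  · intro a b
    refine pairInt_of_even (hlt _) (hlt _) ?_
    rw [slotIndex_inl he, slotIndex_inl he, ← mul_add]
    exact even_two_mul _
  · intro a b
    refine pairInt_of_even (hlt _) (hlt _) ?_
    simp only [slotIndex]
    exact ⟨a + b + 1, by ring⟩
  · intro a
    exact integral_wcheb_of_odd ⟨a, rfl⟩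

/-- The squares of the even numbers `2, 4, …, 2 M`, followed by `s ^ 2`. -/
def columnNode (M : ℕ) (s : ℂ) (n : ℕ) : ℂ := if n < M then (2 * (n : ℂ) + 2) ^ 2 else s ^ 2

theorem columnNode_ne (he : e ≤ 1) {s : ℂ} (hs : ((2 * M + e : ℕ) : ℝ) < s.re) {i n : ℕ}
    (hi : i < M + e) : ((2 * (i : ℂ) + 1) ^ 2 : ℂ) ≠ columnNode M s n := by
  rw [columnNode]
  split_ifs with h
  · have h1 : (2 * i + 1) ^ 2 ≠ (2 * n + 2) ^ 2 := by
      intro h'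
      have := Nat.pow_left_injective two_ne_zero h'
      omega
    exact_mod_cast h1
  · have h2 : ((2 * i + 1 : ℕ) : ℝ) < s.re :=
      lt_of_le_of_lt (by exact_mod_cast (by omega : 2 * i + 1 ≤ 2 * M + e)) hs
    have h3 := (natCast_sq_ne_of_lt_re h2).2.2
    push_cast at h3
    exact (sub_ne_zero.1 h3).symm

/-- Each entry is a row factor `1 / (2 i + 1)` times a column factor times a Cauchy kernel. The
single integral fits the same pattern with node `s ^ 2` and column factor `4 * s ^ 2`. -/
theorem real_moment_mul_prod (he : e ≤ 1) {s : ℂ} (hs : ((2 * M + e : ℕ) : ℝ) < s.re) :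
    (∫ c : Slots M e → ℝ,
      (reciprocalMahlerMeasure (coeffPoly (slotEquiv M e) fun i => (c i : ℂ)) : ℂ) ^ (-s)) *
      ∏ i ∈ Finset.range (M + e), ∏ n ∈ Finset.range (M + e),
        ((2 * (i : ℂ) + 1) ^ 2 - columnNode M s n) =
    (∏ i ∈ Finset.range (M + e), (1 / (2 * (i : ℂ) + 1))) *
      ((∏ m ∈ Finset.range M, (16 * (2 * (m : ℂ) + 2) * (s ^ 2 / (s ^ 2 - (2 * (m : ℂ) + 2) ^ 2)))) *
        (4 * s ^ 2) ^ e) *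
      (vandSign (M + e) *
        (∏ j ∈ Finset.range (M + e), ∏ i ∈ Finset.range j,
          ((2 * (j : ℂ) + 1) ^ 2 - (2 * (i : ℂ) + 1) ^ 2)) *
        ∏ j ∈ Finset.range (M + e), ∏ i ∈ Finset.range j,
          (columnNode M s j - columnNode M s i)) := by
  rw [real_moment_eq_det he hs]
  set κ : Fin M ⊕ Fin e ≃ Fin (M + e) := finSumFinEquiv with hκ
  set w : Fin M ⊕ Fin e → ℂ := Sum.elim
    (fun m => 16 * (2 * (m : ℂ) + 2) * (s ^ 2 / (s ^ 2 - (2 * (m : ℂ) + 2) ^ 2)))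
    (fun _ => 4 * s ^ 2) with hw
  have hnode : ∀ (i : Fin M ⊕ Fin e) (j : Fin M ⊕ Fin e),
      (2 * ((κ i : ℕ) : ℂ) + 1) ^ 2 ≠ columnNode M s (κ j) := fun i j =>
    columnNode_ne he hs (κ i).2
  have hodd : ∀ i : Fin M ⊕ Fin e, (((2 * (κ i : ℕ) : ℕ) : ℝ)) + 1 < s.re := fun i =>
    lt_of_le_of_lt (by exact_mod_cast (by have := (κ i).2; omega : 2 * (κ i : ℕ) + 1 ≤ 2 * M + e)) hs
  have heven : ∀ m : Fin M, (((2 * (m : ℕ) + 1 : ℕ) : ℝ)) + 1 < s.re := fun m =>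
    lt_of_le_of_lt (by exact_mod_cast (by omega : 2 * (m : ℕ) + 1 + 1 ≤ 2 * M + e)) hs
  have hQ : (Matrix.of fun i j : Fin M ⊕ Fin e =>
      Sum.elim (fun m : Fin M => pairInt s (2 * (κ i : ℕ)) (2 * (m : ℕ) + 1))
        (fun _ => ∫ x : ℝ, wcheb s (2 * (κ i : ℕ)) x) j) =
      Matrix.of fun i j => (1 / (2 * ((κ i : ℕ) : ℂ) + 1)) * (Matrix.of fun i j => w j *
        (Matrix.of fun i j : Fin M ⊕ Fin e => 1 / (columnNode M s (κ j) -
          (2 * ((κ i : ℕ) : ℂ) + 1) ^ 2)) i j) i j := by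
    ext i j
    have hne := sub_ne_zero.2 (hnode i j).symm
    have hj0 : (2 * ((κ i : ℕ) : ℂ) + 1) ≠ 0 := by exact_mod_cast Nat.succ_ne_zero (2 * (κ i : ℕ))
    rcases j with m | k
    · have hcol : columnNode M s (κ (Sum.inl m)) = (2 * ((m : ℕ) : ℂ) + 2) ^ 2 := by
        simp [columnNode, hκ]
      rw [hcol] at hne
      have hs2 := (natCast_sq_ne_of_lt_re (s := s) (k := 2 * (m : ℕ) + 1 + 1)
        (by exact_mod_cast heven m)).2.2
      have hk : (2 * ((m : ℕ) : ℂ) + 2) = ((2 * (m : ℕ) + 1 : ℕ) : ℂ) + 1 := by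
        push_cast
        ring
      have hs2' : s ^ 2 - (2 * ((m : ℕ) : ℂ) + 2) ^ 2 ≠ 0 := by
        rw [hk]
        exact_mod_cast hs2
      simp only [Matrix.of_apply, Sum.elim_inl, hw, hcol]
      rw [pairInt_of_even_of_odd (hodd i) (heven m) (even_two_mul _) ⟨_, rfl⟩
        (j := 2 * ((κ i : ℕ) : ℂ) + 1) (by push_cast; ring) hk]
      field_simp
    · have hcol : columnNode M s (κ (Sum.inr k)) = s ^ 2 := by
        simp [columnNode, hκ]
      rw [hcol] at hne
      simp only [Matrix.of_apply, Sum.elim_inr, hw, hcol]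
      rw [integral_wcheb_of_even (hodd i) (even_two_mul _)]
      push_cast
      field_simp
  rw [hQ, Matrix.det_mul_column, Matrix.det_mul_row]
  have hc := det_cauchy κ (x := fun i => (2 * ((κ i : ℕ) : ℂ) + 1) ^ 2)
    (y := fun j => columnNode M s (κ j)) hnode
  rw [det_vand_range κ (fun n => (2 * (n : ℂ) + 1) ^ 2), det_vand_range κ (columnNode M s)] at hc
  rw [← hc]
  have hprod : ∀ f : ℕ → ℂ, ∏ i, f (κ i) = ∏ i ∈ Finset.range (M + e), f i := by
    intro f
    rw [← Fin.prod_univ_eq_prod_range, ← Equiv.prod_comp κ]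
  have hw' : ∏ j, w j = (∏ m ∈ Finset.range M, (16 * (2 * (m : ℂ) + 2) *
      (s ^ 2 / (s ^ 2 - (2 * (m : ℂ) + 2) ^ 2)))) * (4 * s ^ 2) ^ e := by
    rw [Fintype.prod_sum_type, hw, ← Fin.prod_univ_eq_prod_range
      (fun m => (16 * (2 * (m : ℂ) + 2) * (s ^ 2 / (s ^ 2 - (2 * (m : ℂ) + 2) ^ 2))))]
    simp
  rw [hprod (fun i => 1 / (2 * (i : ℂ) + 1)), hw',
    hprod (fun i => ∏ l, ((2 * (i : ℂ) + 1) ^ 2 - columnNode M s (κ l))),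
    Finset.prod_congr rfl fun (i : ℕ) _ =>
      hprod (fun n => (2 * (i : ℂ) + 1) ^ 2 - columnNode M s n)]
  ring

end RealDet

/-! ### Comparison of the Cauchy constant with `vConst` -/

section Constants

open Finset

/-- The product of the first `n` odd numbers. -/
def oddProd (n : ℕ) : ℂ := ∏ i ∈ range n, (2 * (i : ℂ) + 1)

theorem prod_succ_eq_factorial (n : ℕ) : ∏ i ∈ range n, ((i : ℂ) + 1) = n.factorial := by
  rw [← prod_range_add_one_eq_factorial]
  push_cast
  rfl

theorem oddProd_ne_zero (n : ℕ) : oddProd n ≠ 0 :=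
  prod_ne_zero_iff.2 fun i _ => by exact_mod_cast Nat.succ_ne_zero (2 * i)

theorem prod_sub_eq_factorial (n : ℕ) : ∏ i ∈ range n, ((n : ℂ) - i) = n.factorial := by
  rw [← prod_succ_eq_factorial, ← prod_range_reflect]
  refine prod_congr rfl fun i hi => ?_
  have hi := mem_range.1 hi
  rw [Nat.cast_sub (by omega), Nat.cast_sub (by omega)]
  push_cast
  ring

theorem prod_odd_sub (n : ℕ) : ∏ i ∈ range n, (2 * ((n : ℂ) - i) - 1) = oddProd n := by
  rw [oddProd, ← prod_range_reflect]
  refine prod_congr rfl fun i hi => ?_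
  have hi := mem_range.1 hi
  rw [Nat.cast_sub (by omega), Nat.cast_sub (by omega)]
  push_cast
  ring

/-- Each difference of squares is `4 (M - i) (M + i + 1)`; the two families of factors run through
`1, …, M` and `M + 1, …, 2 M`. -/
theorem prod_odd_sq_sub_odd_sq (M : ℕ) :
    ∏ i ∈ range M, ((2 * (M : ℂ) + 1) ^ 2 - (2 * (i : ℂ) + 1) ^ 2) =
      4 ^ M * ((2 * M).factorial : ℂ) := by
  have h : ∀ i ∈ range M, ((2 * (M : ℂ) + 1) ^ 2 - (2 * (i : ℂ) + 1) ^ 2) =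
      4 * ((M : ℂ) - i) * (((M + i : ℕ) : ℂ) + 1) := fun i _ => by
    push_cast
    ring
  rw [prod_congr rfl h, prod_mul_distrib, prod_mul_distrib, prod_const, card_range,
    prod_sub_eq_factorial, ← prod_succ_eq_factorial (2 * M), two_mul, prod_range_add,
    prod_succ_eq_factorial, mul_assoc]

/-- The factors run through the odd numbers up to `4 M + 1` except `2 M + 1`, which is supplied by
hand. -/
theorem prod_odd_sq_sub_even_sq (M : ℕ) :
    (∏ m ∈ range M, ((2 * (M : ℂ) + 1) ^ 2 - (2 * (m : ℂ) + 2) ^ 2)) * (2 * (M : ℂ) + 1) =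
      oddProd (2 * M + 1) := by
  have h : ∀ i ∈ range M, ((2 * (M : ℂ) + 1) ^ 2 - (2 * (i : ℂ) + 2) ^ 2) =
      (2 * ((M : ℂ) - i) - 1) * (2 * ((M + 1 + i : ℕ) : ℂ) + 1) := fun i _ => by
    push_cast
    ring
  rw [prod_congr rfl h, prod_mul_distrib, prod_odd_sub,
    show 2 * M + 1 = (M + 1) + M by ring, oddProd, oddProd, prod_range_add, prod_range_succ]
  ring

theorem prod_even_sq_sub_even_sq (M : ℕ) :
    (∏ m ∈ range M, ((2 * (M : ℂ) + 2) ^ 2 - (2 * (m : ℂ) + 2) ^ 2)) * ((M : ℂ) + 1) =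
      4 ^ M * (2 * M + 1).factorial := by
  have h : ∀ i ∈ range M, ((2 * (M : ℂ) + 2) ^ 2 - (2 * (i : ℂ) + 2) ^ 2) =
      4 * ((M : ℂ) - i) * (((M + 1 + i : ℕ) : ℂ) + 1) := fun i _ => by
    push_cast
    ring
  rw [prod_congr rfl h, prod_mul_distrib, prod_mul_distrib, prod_const, card_range,
    prod_sub_eq_factorial, ← prod_succ_eq_factorial (2 * M + 1),
    show 2 * M + 1 = (M + 1) + M by ring, prod_range_add, prod_range_succ, prod_succ_eq_factorial]
  ring

theorem prod_even_sq_sub_odd_sq (M : ℕ) :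
    ∏ i ∈ range (M + 1), ((2 * (M : ℂ) + 2) ^ 2 - (2 * (i : ℂ) + 1) ^ 2) =
      oddProd (2 * M + 2) := by
  have h : ∀ i ∈ range (M + 1), ((2 * (M : ℂ) + 2) ^ 2 - (2 * (i : ℂ) + 1) ^ 2) =
      (2 * (((M + 1 : ℕ) : ℂ) - i) - 1) * (2 * ((M + 1 + i : ℕ) : ℂ) + 1) := fun i _ => by
    push_cast
    ring
  rw [prod_congr rfl h, prod_mul_distrib, prod_odd_sub,
    show 2 * M + 2 = (M + 1) + (M + 1) by ring, oddProd, oddProd,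
    prod_range_add (fun i => 2 * (i : ℂ) + 1) (M + 1) (M + 1)]

/-- The constant part of the Cauchy determinant with nodes at odd and even squares. -/
def cauchyConst (n M : ℕ) : ℂ :=
  (∏ i ∈ range n, (1 / (2 * (i : ℂ) + 1))) * (∏ m ∈ range M, (16 * (2 * (m : ℂ) + 2))) *
    (∏ j ∈ range n, ∏ i ∈ range j, ((2 * (j : ℂ) + 1) ^ 2 - (2 * (i : ℂ) + 1) ^ 2)) *
    (∏ j ∈ range M, ∏ i ∈ range j, ((2 * (j : ℂ) + 2) ^ 2 - (2 * (i : ℂ) + 2) ^ 2)) /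
    ∏ i ∈ range n, ∏ m ∈ range M, ((2 * (i : ℂ) + 1) ^ 2 - (2 * (m : ℂ) + 2) ^ 2)

theorem cauchyConst_succ_left (M : ℕ) :
    cauchyConst (M + 1) M = cauchyConst M M * (4 ^ M * (2 * M).factorial / oddProd (2 * M + 1)) := by
  have h0 : (2 * (M : ℂ) + 1) ≠ 0 := by exact_mod_cast Nat.succ_ne_zero (2 * M)
  rw [cauchyConst, cauchyConst, prod_range_succ, prod_range_succ _ M, prod_range_succ _ M,
    prod_odd_sq_sub_odd_sq, ← prod_odd_sq_sub_even_sq]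
  field_simp

/-- Only norms are compared: the new denominator has its differences oriented opposite to those of
`prod_even_sq_sub_odd_sq`, and the sign is settled later by positivity. -/
theorem norm_cauchyConst_succ_right (M : ℕ) :
    ‖cauchyConst (M + 1) (M + 1)‖ = ‖cauchyConst (M + 1) M *
      (32 * (4 ^ M * (2 * M + 1).factorial) / oddProd (2 * M + 2))‖ := by
  have h0 : ((M : ℂ) + 1) ≠ 0 := by exact_mod_cast Nat.succ_ne_zero M
  have hnorm : ‖∏ i ∈ range (M + 1), ((2 * (i : ℂ) + 1) ^ 2 - (2 * (M : ℂ) + 2) ^ 2)‖ =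
      ‖oddProd (2 * M + 2)‖ := by
    rw [← prod_even_sq_sub_odd_sq, norm_prod, norm_prod]
    exact prod_congr rfl fun i _ => norm_sub_rev _ _
  have hden : ∏ i ∈ range (M + 1), ∏ m ∈ range (M + 1),
      ((2 * (i : ℂ) + 1) ^ 2 - (2 * (m : ℂ) + 2) ^ 2) =
      (∏ i ∈ range (M + 1), ∏ m ∈ range M, ((2 * (i : ℂ) + 1) ^ 2 - (2 * (m : ℂ) + 2) ^ 2)) *
        ∏ i ∈ range (M + 1), ((2 * (i : ℂ) + 1) ^ 2 - (2 * (M : ℂ) + 2) ^ 2) := by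
    rw [← prod_mul_distrib]
    exact prod_congr rfl fun i _ => prod_range_succ _ M
  have h2 : cauchyConst (M + 1) (M + 1) = cauchyConst (M + 1) M *
      (32 * (4 ^ M * (2 * M + 1).factorial) /
        ∏ i ∈ range (M + 1), ((2 * (i : ℂ) + 1) ^ 2 - (2 * (M : ℂ) + 2) ^ 2)) := by
    rw [cauchyConst, hden, prod_range_succ (fun m => (16 * (2 * (m : ℂ) + 2))),
      prod_range_succ (fun j => ∏ i ∈ range j, ((2 * (j : ℂ) + 2) ^ 2 - (2 * (i : ℂ) + 2) ^ 2)),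
      ← prod_even_sq_sub_even_sq, cauchyConst]
    ring
  rw [h2, norm_mul, norm_mul, norm_div, norm_div, hnorm]

theorem prod_two_mul_div (N : ℕ) :
    ((∏ n ∈ Icc 1 N, ((2 * n : ℚ) / (2 * n - 1)) : ℚ) : ℂ) * oddProd N =
      2 ^ N * N.factorial := by
  induction N with
  | zero => simp [oddProd]
  | succ N ih =>
    have h0 : (2 * (N : ℂ) + 1) ≠ 0 := by exact_mod_cast Nat.succ_ne_zero (2 * N)
    have h1 : oddProd (N + 1) = oddProd N * (2 * (N : ℂ) + 1) := prod_range_succ _ N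
    rw [prod_Icc_succ_top (by omega), h1, Nat.factorial_succ, pow_succ]
    push_cast at ih ⊢
    have h2 : (2 * ((N : ℂ) + 1) - 1) = 2 * (N : ℂ) + 1 := by ring
    rw [h2]
    calc _ = ((∏ n ∈ Icc 1 N, ((2 * n : ℂ) / (2 * n - 1))) * oddProd N) *
          (2 * ((N : ℂ) + 1) / (2 * (N : ℂ) + 1) * (2 * (N : ℂ) + 1)) := by ring
      _ = _ := by
        rw [ih, div_mul_cancel₀ _ h0]
        ring

theorem vConst_succ (N : ℕ) :
    (vConst (N + 1) : ℂ) = vConst N * (2 * (2 ^ (N + 1) * N.factorial) / oddProd (N + 1)) := by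
  have h1 : vConst (N + 1) = vConst N * (2 / (N + 1 : ℚ) *
      ∏ n ∈ Icc 1 (N + 1), ((2 * n : ℚ) / (2 * n - 1))) := by
    have h2 : ∀ n ∈ Icc 1 (N + 1), ((2 * n : ℚ) / (2 * n - 1)) ^ (N + 1 + 1 - n) =
        ((2 * n : ℚ) / (2 * n - 1)) ^ (N + 1 - n) * ((2 * n : ℚ) / (2 * n - 1)) := by
      intro n hn
      rw [← pow_succ]
      congr 1
      have := (mem_Icc.1 hn).2
      omega
    have h3 : ((N.factorial : ℕ) : ℚ) ≠ 0 := by exact_mod_cast (Nat.factorial_pos N).ne'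
    have h4 : ((N : ℚ) + 1) ≠ 0 := by positivity
    rw [vConst, vConst, prod_congr rfl h2, prod_mul_distrib,
      prod_Icc_succ_top (a := 1) (b := N) (by omega)
        (fun n => ((2 * n : ℚ) / (2 * n - 1)) ^ (N + 1 - n)), Nat.factorial_succ]
    simp only [tsub_self, pow_zero, mul_one]
    push_cast
    field_simp
    ring
  have h5 := prod_two_mul_div (N + 1)
  have h6 : ((N : ℂ) + 1) ≠ 0 := by exact_mod_cast Nat.succ_ne_zero N
  rw [← eq_div_iff (oddProd_ne_zero _)] at h5
  rw [h1, Rat.cast_mul, Rat.cast_mul, h5, Nat.factorial_succ]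
  push_cast
  field_simp

/-- Nodes are added alternately, an odd square and then an even one. In norm, each addition
multiplies by the ratio of consecutive `vConst`, once the factor `4` of the single column is taken
into account. -/
theorem norm_cauchyConst (M : ℕ) :
    ‖cauchyConst M M‖ = ‖(vConst (2 * M) : ℂ)‖ ∧
      ‖4 * cauchyConst (M + 1) M‖ = ‖(vConst (2 * M + 1) : ℂ)‖ := by
  have hstep : ∀ M : ℕ, ‖cauchyConst M M‖ = ‖(vConst (2 * M) : ℂ)‖ →
      ‖4 * cauchyConst (M + 1) M‖ = ‖(vConst (2 * M + 1) : ℂ)‖ := by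
    intro M h
    rw [cauchyConst_succ_left, vConst_succ, mul_left_comm,
      norm_mul (cauchyConst M M), norm_mul (vConst (2 * M) : ℂ), h]
    congr 2
    rw [pow_succ, pow_mul]
    ring
  have hmain : ∀ M : ℕ, ‖cauchyConst M M‖ = ‖(vConst (2 * M) : ℂ)‖ := by
    intro M
    induction M with
    | zero => simp [cauchyConst, vConst]
    | succ M ih =>
      have h1 := hstep M ih
      rw [norm_cauchyConst_succ_right, show 2 * (M + 1) = 2 * M + 1 + 1 by ring, vConst_succ,
        norm_mul (vConst (2 * M + 1) : ℂ), ← h1, ← norm_mul]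
      congr 1
      have : (2 : ℂ) ^ (2 * M + 1 + 1) = 4 * 4 ^ M := by
        rw [pow_succ, pow_succ, pow_mul]
        norm_num
        ring
      rw [this]
      ring
  exact ⟨hmain M, hstep M (hmain M)⟩

theorem vConst_nonneg (N : ℕ) : 0 ≤ vConst N := by
  refine mul_nonneg (by positivity) (prod_nonneg fun n hn => pow_nonneg (div_nonneg ?_ ?_) _)
  · positivity
  · have : (1 : ℚ) ≤ n := by exact_mod_cast (mem_Icc.1 hn).1
    linarith

end Constants

/-! ### The real moment up to a unimodular constant -/

section RealValue

open Finset

variable {M e : ℕ}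

theorem norm_real_moment_const_zero (M : ℕ) : ∃ C : ℂ, ‖C‖ = ‖(vConst (2 * M) : ℂ)‖ ∧
    ∀ s : ℂ, ((2 * M + 0 : ℕ) : ℝ) < s.re → ∫ c : Slots M 0 → ℝ,
      (reciprocalMahlerMeasure (coeffPoly (slotEquiv M 0) fun i => (c i : ℂ)) : ℂ) ^ (-s) =
      C * ∏ m ∈ range M, s ^ 2 / (s ^ 2 - (2 * (m : ℂ) + 2) ^ 2) := by
  refine ⟨vandSign M * cauchyConst M M, by
    rw [norm_mul, norm_vandSign, one_mul, (norm_cauchyConst M).1], fun s hs => ?_⟩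
  have h := real_moment_mul_prod (M := M) (e := 0) zero_le_one hs
  have hnode : ∀ n ∈ range M, columnNode M s n = (2 * (n : ℂ) + 2) ^ 2 := fun n hn =>
    if_pos (mem_range.1 hn)
  have hne : ∏ i ∈ range M, ∏ n ∈ range M,
      ((2 * (i : ℂ) + 1) ^ 2 - (2 * (n : ℂ) + 2) ^ 2) ≠ 0 :=
    prod_ne_zero_iff.2 fun i hi => prod_ne_zero_iff.2 fun n hn => by
      rw [← hnode n hn]
      exact sub_ne_zero.2 (columnNode_ne zero_le_one hs (by simpa using mem_range.1 hi))
  simp only [add_zero, pow_zero, mul_one] at h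
  have hcol : ∏ j ∈ range M, ∏ i ∈ range j, (columnNode M s j - columnNode M s i) =
      ∏ j ∈ range M, ∏ i ∈ range j, ((2 * (j : ℂ) + 2) ^ 2 - (2 * (i : ℂ) + 2) ^ 2) :=
    prod_congr rfl fun j hj => prod_congr rfl fun i hi => by
      rw [hnode j hj, hnode i (mem_range.2 ((mem_range.1 hi).trans (mem_range.1 hj)))]
  rw [prod_congr rfl fun i _ => prod_congr rfl fun n hn => by rw [hnode n hn], hcol] at h
  rw [← eq_div_iff hne] at h
  rw [h, cauchyConst, prod_mul_distrib]
  ring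

/-- The Vandermonde factors joining `s ^ 2` to the even squares cancel the denominators of the
column factors. The Cauchy denominators joining `s ^ 2` to the odd squares remain, and reversing
them costs `(-1) ^ (M + 1)`. -/
theorem norm_real_moment_const_one (M : ℕ) : ∃ C : ℂ, ‖C‖ = ‖(vConst (2 * M + 1) : ℂ)‖ ∧
    ∀ s : ℂ, ((2 * M + 1 : ℕ) : ℝ) < s.re → ∫ c : Slots M 1 → ℝ,
      (reciprocalMahlerMeasure (coeffPoly (slotEquiv M 1) fun i => (c i : ℂ)) : ℂ) ^ (-s) =
      C * ∏ m ∈ range (M + 1), s ^ 2 / (s ^ 2 - (2 * (m : ℂ) + 1) ^ 2) := by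
  refine ⟨(-1) ^ (M + 1) * vandSign (M + 1) * (4 * cauchyConst (M + 1) M), by
    rw [norm_mul, norm_mul, norm_vandSign, (norm_cauchyConst M).2]; simp, fun s hs => ?_⟩
  have h := real_moment_mul_prod (M := M) (e := 1) le_rfl hs
  have hnode : ∀ n ∈ range M, columnNode M s n = (2 * (n : ℂ) + 2) ^ 2 := fun n hn =>
    if_pos (mem_range.1 hn)
  have hlast : columnNode M s M = s ^ 2 := if_neg (lt_irrefl M)
  have hne1 : ∏ i ∈ range (M + 1), ∏ n ∈ range M,
      ((2 * (i : ℂ) + 1) ^ 2 - (2 * (n : ℂ) + 2) ^ 2) ≠ 0 :=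
    prod_ne_zero_iff.2 fun i hi => prod_ne_zero_iff.2 fun n hn => by
      rw [← hnode n hn]
      exact sub_ne_zero.2 (columnNode_ne le_rfl hs (mem_range.1 hi))
  have hne2 : ∏ i ∈ range (M + 1), (s ^ 2 - (2 * (i : ℂ) + 1) ^ 2) ≠ 0 :=
    prod_ne_zero_iff.2 fun i hi => by
      rw [← hlast]
      exact sub_ne_zero.2 (columnNode_ne le_rfl hs (mem_range.1 hi)).symm
  have hne3 : ∏ m ∈ range M, (s ^ 2 - (2 * (m : ℂ) + 2) ^ 2) ≠ 0 :=
    prod_ne_zero_iff.2 fun m hm => by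
      have h1 : ((2 * m + 2 : ℕ) : ℝ) < s.re := lt_of_le_of_lt
        (by exact_mod_cast (by have := mem_range.1 hm; omega : 2 * m + 2 ≤ 2 * M + 1)) hs
      have h2 := (natCast_sq_ne_of_lt_re h1).2.2
      push_cast at h2
      exact h2
  have hsplit : ∏ i ∈ range (M + 1), ∏ n ∈ range (M + 1),
      ((2 * (i : ℂ) + 1) ^ 2 - columnNode M s n) =
      (∏ i ∈ range (M + 1), ∏ n ∈ range M, ((2 * (i : ℂ) + 1) ^ 2 - (2 * (n : ℂ) + 2) ^ 2)) *
        ((-1) ^ (M + 1) * ∏ i ∈ range (M + 1), (s ^ 2 - (2 * (i : ℂ) + 1) ^ 2)) := by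
    have h1 : ∀ i ∈ range (M + 1), ∏ n ∈ range (M + 1),
        ((2 * (i : ℂ) + 1) ^ 2 - columnNode M s n) =
        (∏ n ∈ range M, ((2 * (i : ℂ) + 1) ^ 2 - (2 * (n : ℂ) + 2) ^ 2)) *
          ((-1) * (s ^ 2 - (2 * (i : ℂ) + 1) ^ 2)) := by
      intro i _
      rw [prod_range_succ, hlast, prod_congr rfl fun n hn => by rw [hnode n hn]]
      ring
    rw [prod_congr rfl h1, prod_mul_distrib, prod_mul_distrib, prod_const, card_range]
  have hcol : ∏ j ∈ range M, ∏ i ∈ range j, (columnNode M s j - columnNode M s i) =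
      ∏ j ∈ range M, ∏ i ∈ range j, ((2 * (j : ℂ) + 2) ^ 2 - (2 * (i : ℂ) + 2) ^ 2) :=
    prod_congr rfl fun j hj => prod_congr rfl fun i hi => by
      rw [hnode j hj, hnode i (mem_range.2 ((mem_range.1 hi).trans (mem_range.1 hj)))]
  have hcol' : ∏ i ∈ range M, (columnNode M s M - columnNode M s i) =
      ∏ i ∈ range M, (s ^ 2 - (2 * (i : ℂ) + 2) ^ 2) :=
    prod_congr rfl fun i hi => by rw [hnode i hi, hlast]
  rw [hsplit, prod_range_succ (fun j => ∏ i ∈ range j, (columnNode M s j - columnNode M s i)),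
    hcol, hcol'] at h
  rw [← eq_div_iff (mul_ne_zero hne1 (mul_ne_zero (pow_ne_zero _ (by norm_num)) hne2))] at h
  have hsign : ((-1 : ℂ) ^ (M + 1)) * (-1) ^ (M + 1) = 1 := by
    rw [← mul_pow]
    simp
  clear hcol hcol' hsplit hlast hnode
  rw [h, cauchyConst, prod_mul_distrib (f := fun m : ℕ => 16 * (2 * (m : ℂ) + 2)),
    prod_div_distrib (f := fun _ => s ^ 2), prod_div_distrib (f := fun _ => s ^ 2), prod_const,
    prod_const, card_range, card_range]
  generalize hA : ∏ i ∈ range (M + 1), ∏ n ∈ range M,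
      ((2 * (i : ℂ) + 1) ^ 2 - (2 * (n : ℂ) + 2) ^ 2) = A at *
  generalize hB : ∏ i ∈ range (M + 1), (s ^ 2 - (2 * (i : ℂ) + 1) ^ 2) = B at *
  generalize hD : ∏ m ∈ range M, (s ^ 2 - (2 * (m : ℂ) + 2) ^ 2) = D at *
  have hu : ((-1 : ℂ) ^ (M + 1)) ≠ 0 := pow_ne_zero _ (by norm_num)
  generalize (-1 : ℂ) ^ (M + 1) = u at *
  have hu2 : u⁻¹ = u := by
    rw [inv_eq_iff_eq_inv]
    exact eq_inv_of_mul_eq_one_left hsign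
  rw [div_eq_mul_inv _ (A * (u * B)), mul_inv, mul_inv, hu2]
  field_simp
  ring

end RealValue

/-! ### Evaluation of rational functions away from poles -/

section RationalEvaluation

/-- The rational function `R` has no pole at `s` and takes the value `v` there. -/
def RatValueAt (R : RatFunc ℂ) (s v : ℂ) : Prop :=
  R.denom.eval s ≠ 0 ∧ R.eval (RingHom.id ℂ) s = v

/-- The reduced denominator of a product divides the product of the denominators, so absence of a
pole is inherited; this is also what multiplicativity of evaluation needs. -/
theorem RatValueAt.mul {R S : RatFunc ℂ} {s v w : ℂ} (hR : RatValueAt R s v)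
    (hS : RatValueAt S s w) : RatValueAt (R * S) s (v * w) := by
  constructor
  · intro h
    have := eval_dvd (x := s) (RatFunc.denom_mul_dvd R S)
    rw [h, zero_dvd_iff, eval_mul] at this
    exact mul_ne_zero hR.1 hS.1 this
  · rw [RatFunc.eval_mul _ _ hR.1 hS.1, hR.2, hS.2]

theorem ratValueAt_C (c s : ℂ) : RatValueAt (RatFunc.C c) s c :=
  ⟨by simp, by simp⟩

theorem RatValueAt.prod {α : Type*} (t : Finset α) {R : α → RatFunc ℂ} {s : ℂ} {v : α → ℂ}
    (h : ∀ a ∈ t, RatValueAt (R a) s (v a)) :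
    RatValueAt (∏ a ∈ t, R a) s (∏ a ∈ t, v a) := by
  classical
  induction t using Finset.induction_on with
  | empty => simpa using ratValueAt_C 1 s
  | insert a t ha ih =>
    rw [Finset.prod_insert ha, Finset.prod_insert ha]
    exact (h a (Finset.mem_insert_self a t)).mul
      (ih fun b hb => h b (Finset.mem_insert_of_mem hb))

theorem ratValueAt_div (p q : ℂ[X]) {s : ℂ} (hq : q.eval s ≠ 0) :
    RatValueAt (algebraMap ℂ[X] (RatFunc ℂ) p / algebraMap ℂ[X] (RatFunc ℂ) q) s
      (p.eval s / q.eval s) := by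
  have h1 : (algebraMap ℂ[X] (RatFunc ℂ) p / algebraMap ℂ[X] (RatFunc ℂ) q).denom.eval s ≠ 0 := by
    intro h
    have := eval_dvd (x := s) (RatFunc.denom_div_dvd p q)
    rw [h, zero_dvd_iff] at this
    exact hq this
  refine ⟨h1, ?_⟩
  have hq0 : q ≠ 0 := by
    rintro rfl
    simp at hq
  rw [eq_div_iff hq]
  have h2 := RatFunc.eval_mul (RingHom.id ℂ) s (y := algebraMap ℂ[X] (RatFunc ℂ) q) h1 (by simp)
  rw [div_mul_cancel₀ _ (RatFunc.algebraMap_ne_zero hq0), RatFunc.eval_algebraMap,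
    RatFunc.eval_algebraMap] at h2
  exact h2.symm

theorem ratValueAt_X_pow_div (n : ℕ) {s c : ℂ} (h : s ^ 2 - c ^ 2 ≠ 0) :
    RatValueAt (RatFunc.X ^ n / (RatFunc.X ^ 2 - RatFunc.C c ^ 2)) s
      (s ^ n / (s ^ 2 - c ^ 2)) := by
  have h1 := ratValueAt_div (X ^ n) (X ^ 2 - C c ^ 2) (s := s) (by simpa using h)
  simpa only [map_pow, map_sub, RatFunc.algebraMap_X, RatFunc.algebraMap_C, eval_pow, eval_sub,
    eval_X, eval_C] using h1

/-- Analyticity is read off from the closed form on an open set, so the integral is never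
differentiated in `s`. -/
theorem continuesToRational_of_eqOn {F G : ℂ → ℂ} {U : Set ℂ} {R : RatFunc ℂ} (hU : IsOpen U)
    (hFG : ∀ s ∈ U, F s = G s) (hG : ∀ s ∈ U, DifferentiableAt ℂ G s)
    (hR : ∀ s ∈ U, RatValueAt R s (G s)) : ContinuesToRational F U R := by
  refine ⟨?_, fun s hs => ⟨(hR s hs).1, by rw [hFG s hs, (hR s hs).2]⟩⟩
  refine DifferentiableOn.analyticOnNhd (fun s hs => ?_) hU
  exact ((hG s hs).differentiableWithinAt).congr hFG (hFG s hs)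

theorem isOpen_lt_re (N : ℕ) : IsOpen {s : ℂ | (N : ℝ) < s.re} :=
  isOpen_lt continuous_const Complex.continuous_re

end RationalEvaluation

/-! ### Assembly of the moment functions -/

section Moments

open scoped ComplexOrder

theorem coeffPoly_revPerm (N : ℕ) (b : Fin N → ℂ) :
    coeffPoly Fin.revPerm b = X ^ N + ∑ i : Fin N, C (b i) * X ^ (N - (i + 1 : ℕ)) := by
  simp [coeffPoly, Fin.val_rev]

theorem coeffPoly_reindex {ι : Type*} [Fintype ι] [DecidableEq ι] {N : ℕ} (κ : ι ≃ Fin N)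
    (b : Fin N → ℂ) :
    coeffPoly κ (fun i => b (Fin.rev (κ i))) =
      X ^ N + ∑ i : Fin N, C (b i) * X ^ (N - (i + 1 : ℕ)) := by
  rw [← coeffPoly_revPerm, coeffPoly, coeffPoly, ← Equiv.sum_comp (κ.trans Fin.revPerm)]
  simp

theorem complexMoment_reciprocalMahlerMeasure (N : ℕ) {s : ℂ} (hs : (N : ℝ) < s.re) :
    Integrable (complexMomentIntegrand reciprocalMahlerMeasure N s) ∧
      complexMoment reciprocalMahlerMeasure N s =
        2 ^ N * (Real.pi : ℂ) ^ N * ∏ n ∈ Finset.Icc 1 N, s / (s ^ 2 - (n : ℂ) ^ 2) := by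
  obtain ⟨h1, h2⟩ := integral_complex_reciprocalMahlerMeasure (Fin.revPerm (n := N)) hs
  have h3 : complexMomentIntegrand reciprocalMahlerMeasure N s = fun c : Fin N → ℂ =>
      (reciprocalMahlerMeasure (coeffPoly Fin.revPerm c) : ℂ) ^ (-(2 * s)) := by
    ext c
    rw [complexMomentIntegrand, monicRestriction, coeffPoly_revPerm]
  refine ⟨h3 ▸ h1, ?_⟩
  rw [complexMoment, h3, h2,
    Fin.prod_univ_eq_prod_range (fun i => 2 * (Real.pi : ℂ) * (s / (s ^ 2 - ((i + 1 : ℕ) : ℂ) ^ 2))),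
    Finset.prod_mul_distrib, Finset.prod_const, Finset.card_range, mul_pow,
    Finset.range_eq_Ico, Finset.prod_Ico_add' (fun n : ℕ => s / (s ^ 2 - (n : ℂ) ^ 2)) 0 N 1]
  rfl

theorem realMoment_reindex {ι : Type*} [Fintype ι] [DecidableEq ι] {N : ℕ} (κ : ι ≃ Fin N)
    {s : ℂ} (h : Integrable fun c : ι → ℝ =>
      (reciprocalMahlerMeasure (coeffPoly κ fun i => (c i : ℂ)) : ℂ) ^ (-s)) :
    Integrable (realMomentIntegrand reciprocalMahlerMeasure N s) ∧
      realMoment reciprocalMahlerMeasure N s = ∫ c : ι → ℝ,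
        (reciprocalMahlerMeasure (coeffPoly κ fun i => (c i : ℂ)) : ℂ) ^ (-s) := by
  have hmp := (volume_measurePreserving_piCongrLeft (fun _ : Fin N => ℝ)
    (κ.trans Fin.revPerm)).symm
  have h3 : realMomentIntegrand reciprocalMahlerMeasure N s = (fun c : ι → ℝ =>
      (reciprocalMahlerMeasure (coeffPoly κ fun i => (c i : ℂ)) : ℂ) ^ (-s)) ∘
      (MeasurableEquiv.piCongrLeft (fun _ : Fin N => ℝ) (κ.trans Fin.revPerm)).symm := by
    ext b
    rw [realMomentIntegrand, monicRestriction, ← coeffPoly_reindex κ]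
    rfl
  constructor
  · rw [h3]
    exact (hmp.integrable_comp_emb (MeasurableEquiv.measurableEmbedding _)).2 h
  · rw [realMoment, h3]
    exact hmp.integral_comp (MeasurableEquiv.measurableEmbedding _) fun c : ι → ℝ =>
      (reciprocalMahlerMeasure (coeffPoly κ fun i => (c i : ℂ)) : ℂ) ^ (-s)

/-- Fixes the remaining sign: a single real point at which the product is positive and the moment is
nonnegative determines the constant from its modulus. -/
theorem eq_norm_of_mul_pos {C p x : ℂ} (hp : 0 < p) (hx : 0 ≤ x) (h : x = C * p) :
    C = ‖C‖ := by
  have hC : C = x / p := by rw [h, mul_div_cancel_right₀ _ hp.ne']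
  have h0 : 0 ≤ C := by
    rw [hC]
    exact div_nonneg hx hp.le
  exact (Complex.norm_of_nonneg' h0).symm

theorem real_moment_nonneg {ι : Type*} [Fintype ι] [DecidableEq ι] {N : ℕ} (κ : ι ≃ Fin N)
    (x : ℝ) : 0 ≤ ∫ c : ι → ℝ,
      (reciprocalMahlerMeasure (coeffPoly κ fun i => (c i : ℂ)) : ℂ) ^ (-(x : ℂ)) := by
  have h : ∀ c : ι → ℝ, (reciprocalMahlerMeasure (coeffPoly κ fun i => (c i : ℂ)) : ℂ) ^ (-(x : ℂ))
      = ((reciprocalMahlerMeasure (coeffPoly κ fun i => (c i : ℂ)) ^ (-x) : ℝ) : ℂ) := by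
    intro c
    rw [Complex.ofReal_cpow (reciprocalMahlerMeasure_coeffPoly_pos κ _).le, Complex.ofReal_neg]
  simp only [h]
  rw [integral_complex_ofReal]
  refine Complex.zero_le_real.2 (integral_nonneg fun c => ?_)
  exact Real.rpow_nonneg (reciprocalMahlerMeasure_coeffPoly_pos κ _).le _

theorem prod_sq_div_pos {t : Finset ℕ} {x : ℝ} {f : ℕ → ℝ} (hx : 0 < x)
    (h : ∀ m ∈ t, 0 ≤ f m ∧ f m < x) :
    (0 : ℂ) < ∏ m ∈ t, (x : ℂ) ^ 2 / ((x : ℂ) ^ 2 - (f m : ℂ) ^ 2) := by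
  have h1 : ∏ m ∈ t, (x : ℂ) ^ 2 / ((x : ℂ) ^ 2 - (f m : ℂ) ^ 2) =
      ((∏ m ∈ t, x ^ 2 / (x ^ 2 - f m ^ 2) : ℝ) : ℂ) := by
    push_cast
    rfl
  rw [h1]
  refine Complex.zero_lt_real.2 (Finset.prod_pos fun m hm => div_pos (by positivity) ?_)
  obtain ⟨h2, h3⟩ := h m hm
  nlinarith

theorem norm_vConst (N : ℕ) : ((‖(vConst N : ℂ)‖ : ℝ) : ℂ) = vConst N := by
  have : (vConst N : ℂ) = ((vConst N : ℝ) : ℂ) := by push_cast; rfl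
  rw [this, Complex.norm_real, Real.norm_of_nonneg (by exact_mod_cast vConst_nonneg N)]

theorem realMoment_reciprocalMahlerMeasure_even (M : ℕ) {s : ℂ}
    (hs : ((2 * M + 0 : ℕ) : ℝ) < s.re) :
    ∫ c : Slots M 0 → ℝ,
      (reciprocalMahlerMeasure (coeffPoly (slotEquiv M 0) fun i => (c i : ℂ)) : ℂ) ^ (-s) =
      vConst (2 * M) * ∏ m ∈ Finset.range M, s ^ 2 / (s ^ 2 - (2 * (m : ℂ) + 2) ^ 2) := by
  obtain ⟨C, hC, h⟩ := norm_real_moment_const_zero M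
  rw [h s hs, ← norm_vConst, ← hC]
  congr 1
  -- Any real point beyond `2 * M` serves, as all denominators are then positive.
  set x : ℝ := 2 * M + 1 with hx
  have h1 := h (x : ℂ) (by simp [hx])
  refine eq_norm_of_mul_pos ?_ (real_moment_nonneg (slotEquiv M 0) x) h1
  have := prod_sq_div_pos (t := Finset.range M) (x := x) (f := fun m => 2 * (m : ℝ) + 2)
    (by positivity) fun m hm => ⟨by positivity, by
      have : (m : ℝ) + 1 ≤ M := by exact_mod_cast Finset.mem_range.1 hm
      rw [hx]
      linarith⟩
  push_cast at this
  exact this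

theorem realMoment_reciprocalMahlerMeasure_odd (M : ℕ) {s : ℂ}
    (hs : ((2 * M + 1 : ℕ) : ℝ) < s.re) :
    ∫ c : Slots M 1 → ℝ,
      (reciprocalMahlerMeasure (coeffPoly (slotEquiv M 1) fun i => (c i : ℂ)) : ℂ) ^ (-s) =
      vConst (2 * M + 1) *
        ∏ m ∈ Finset.range (M + 1), s ^ 2 / (s ^ 2 - (2 * (m : ℂ) + 1) ^ 2) := by
  obtain ⟨C, hC, h⟩ := norm_real_moment_const_one M
  rw [h s hs, ← norm_vConst, ← hC]
  congr 1
  set x : ℝ := 2 * M + 2 with hx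
  have h1 := h (x : ℂ) (by simp [hx])
  refine eq_norm_of_mul_pos ?_ (real_moment_nonneg (slotEquiv M 1) x) h1
  have := prod_sq_div_pos (t := Finset.range (M + 1)) (x := x) (f := fun m => 2 * (m : ℝ) + 1)
    (by positivity) fun m hm => ⟨by positivity, by
      have : (m : ℝ) + 1 ≤ M + 1 := by exact_mod_cast Finset.mem_range.1 hm
      rw [hx]
      linarith⟩
  push_cast at this
  exact this

theorem realMoment_reciprocalMahlerMeasure {N : ℕ} (hN : 1 ≤ N) {s : ℂ} (hs : (N : ℝ) < s.re) :
    Integrable (realMomentIntegrand reciprocalMahlerMeasure N s) ∧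
      realMoment reciprocalMahlerMeasure N s = (vConst N : ℂ) *
        ∏ j ∈ Finset.range ((N - 1) / 2 + 1), s ^ 2 / (s ^ 2 - ((N : ℂ) - 2 * (j : ℂ)) ^ 2) := by
  obtain ⟨M, rfl | rfl⟩ := Nat.even_or_odd' N
  · obtain ⟨h1, h2⟩ := realMoment_reindex (N := 2 * M) (slotEquiv M 0)
      (integral_real_reciprocalMahlerMeasure zero_le_one hs).1
    refine ⟨h1, ?_⟩
    -- Here `1 ≤ 2 * M` matters: for `M = 0` the truncated subtraction would leave one factor
    -- instead of none. The products list the same squares in opposite order, hence the reflection.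
    rw [h2, realMoment_reciprocalMahlerMeasure_even M hs, show (2 * M - 1) / 2 + 1 = M by omega,
      ← Finset.prod_range_reflect]
    congr 1
    refine Finset.prod_congr rfl fun j hj => ?_
    have hj := Finset.mem_range.1 hj
    rw [Nat.cast_sub (by omega), Nat.cast_sub (by omega)]
    push_cast
    ring_nf
  · obtain ⟨h1, h2⟩ := realMoment_reindex (N := 2 * M + 1) (slotEquiv M 1)
      (integral_real_reciprocalMahlerMeasure le_rfl hs).1
    refine ⟨h1, ?_⟩
    rw [h2, realMoment_reciprocalMahlerMeasure_odd M hs,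
      show (2 * M + 1 - 1) / 2 + 1 = M + 1 by omega, ← Finset.prod_range_reflect]
    congr 1
    refine Finset.prod_congr rfl fun j hj => ?_
    have hj := Finset.mem_range.1 hj
    rw [Nat.cast_sub (by omega), Nat.cast_sub (by omega)]
    push_cast
    ring_nf

theorem real_denominator_ne_zero {N : ℕ} (hN : 1 ≤ N) {s : ℂ} (hs : (N : ℝ) < s.re) {j : ℕ}
    (hj : j ∈ Finset.range ((N - 1) / 2 + 1)) : s ^ 2 - ((N : ℂ) - 2 * (j : ℂ)) ^ 2 ≠ 0 := by
  have hj := Finset.mem_range.1 hj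
  have h1 : (N : ℂ) - 2 * (j : ℂ) = ((N - 2 * j : ℕ) : ℂ) := by
    rw [Nat.cast_sub (by omega)]
    push_cast
    rfl
  rw [h1]
  exact (natCast_sq_ne_of_lt_re (lt_of_le_of_lt (by exact_mod_cast Nat.sub_le _ _) hs)).2.2

theorem complex_denominator_ne_zero {N : ℕ} {s : ℂ} (hs : (N : ℝ) < s.re) {n : ℕ}
    (hn : n ∈ Finset.Icc 1 N) : s ^ 2 - (n : ℂ) ^ 2 ≠ 0 :=
  (natCast_sq_ne_of_lt_re (lt_of_le_of_lt (by exact_mod_cast (Finset.mem_Icc.1 hn).2) hs)).2.2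

theorem continuesToRational_complexMoment (N : ℕ) :
    ContinuesToRational (complexMoment reciprocalMahlerMeasure N) {s : ℂ | (N : ℝ) < s.re}
      (complexMomentRat N) := by
  refine continuesToRational_of_eqOn (isOpen_lt_re N)
    (fun s hs => (complexMoment_reciprocalMahlerMeasure N hs).2) (fun s hs => ?_) fun s hs => ?_
  · refine DifferentiableAt.const_mul (DifferentiableAt.fun_finsetProd fun n hn => ?_) _
    exact differentiableAt_id.div (by fun_prop) (complex_denominator_ne_zero hs hn)
  · refine (ratValueAt_C _ s).mul (RatValueAt.prod _ fun n hn => ?_)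
    simpa using ratValueAt_X_pow_div 1 (complex_denominator_ne_zero hs hn)

theorem continuesToRational_realMoment {N : ℕ} (hN : 1 ≤ N) :
    ContinuesToRational (realMoment reciprocalMahlerMeasure N) {s : ℂ | (N : ℝ) < s.re}
      (realMomentRat N) := by
  refine continuesToRational_of_eqOn (isOpen_lt_re N)
    (fun s hs => (realMoment_reciprocalMahlerMeasure hN hs).2) (fun s hs => ?_) fun s hs => ?_
  · refine DifferentiableAt.const_mul (DifferentiableAt.fun_finsetProd fun n hn => ?_) _
    exact (differentiableAt_id.pow 2).div (by fun_prop) (real_denominator_ne_zero hN hs hn)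
  · exact (ratValueAt_C _ s).mul (RatValueAt.prod _ fun n hn =>
      ratValueAt_X_pow_div 2 (real_denominator_ne_zero hN hs hn))

end Moments

end MomentFunctions

end

theorem theorem8 (N : ℕ) (hN : 1 ≤ N) :
    -- the defining integrals converge absolutely for `Re s > N`
    (∀ s : ℂ, (N : ℝ) < s.re →
      MeasureTheory.Integrable
        (MomentFunctions.realMomentIntegrand MomentFunctions.reciprocalMahlerMeasure N s) ∧
      MeasureTheory.Integrable
        (MomentFunctions.complexMomentIntegrand MomentFunctions.reciprocalMahlerMeasure N s)) ∧
    -- both moment functions continue to the stated rational functions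
    MomentFunctions.ContinuesToRational
      (MomentFunctions.complexMoment MomentFunctions.reciprocalMahlerMeasure N)
      {s : ℂ | (N : ℝ) < s.re} (MomentFunctions.complexMomentRat N) ∧
    MomentFunctions.ContinuesToRational
      (MomentFunctions.realMoment MomentFunctions.reciprocalMahlerMeasure N)
      {s : ℂ | (N : ℝ) < s.re} (MomentFunctions.realMomentRat N) ∧
    -- the explicit values
    (∀ s : ℂ, (N : ℝ) < s.re →
      MomentFunctions.complexMoment MomentFunctions.reciprocalMahlerMeasure N s =
        2 ^ N * (Real.pi : ℂ) ^ N * ∏ n ∈ Finset.Icc 1 N, s / (s ^ 2 - (n : ℂ) ^ 2)) ∧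
    (∀ s : ℂ, (N : ℝ) < s.re →
      MomentFunctions.realMoment MomentFunctions.reciprocalMahlerMeasure N s =
        (MomentFunctions.vConst N : ℂ) *
          ∏ j ∈ Finset.range ((N - 1) / 2 + 1),
            s ^ 2 / (s ^ 2 - ((N : ℂ) - 2 * (j : ℂ)) ^ 2)) := by
  refine ⟨fun s hs => ⟨?_, ?_⟩, MomentFunctions.continuesToRational_complexMoment N,
    MomentFunctions.continuesToRational_realMoment hN, fun s hs => ?_, fun s hs => ?_⟩
  · exact (MomentFunctions.realMoment_reciprocalMahlerMeasure hN hs).1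
  · exact (MomentFunctions.complexMoment_reciprocalMahlerMeasure N hs).1
  · exact (MomentFunctions.complexMoment_reciprocalMahlerMeasure N hs).2
  · exact (MomentFunctions.realMoment_reciprocalMahlerMeasure hN hs).2
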